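/- Let $(M,g)$ be a smooth Riemannian manifold of dimension $n$ (Hausdorff, second countable, without boundary; not assumed connected, complete or compact), with Levi-Civita connection $\nabla$, and let $\Omega\subset M$ be a relatively compact open set with smooth boundary. "Smooth on $\overline\Omega$" means smooth up to the boundary. Let $E,F$ be smooth real vector bundles of finite rank over $M$ with smooth fibre metrics, $E$ with a smooth connection, also denoted $\nabla$ (for instance natural tensor bundles with the Levi-Civita connection). Let $m\ge 1$ and let $P^*$ be a linear differential operator from sections of $E$ to sections of $F$, of the form $$P^*u=A(\nabla^{(m)}u)+\sum_{k<m}B_k(\nabla^{(k)}u),$$ where $A_x:(T_x^*M)^{\otimes m}\otimes E_x\to F_x$ and $B_{k,x}:(T_x^*M)^{\otimes k}\otimes E_x\to F_x$ are linear and depend smoothly on $x\in\overline\Omega$, and, for every $x\in\overline\Omega$, $A_x$ is injective; it is enough that $A_x$ be injective on the tensors that are symmetric in the $m$ cotangent slots. Then: (1) (Asymptotic Poincaré Inequality, API) Let $\rho$ be a defining function of $\partial\Omega$: $\rho$ is smooth on $\overline\Omega$, positive in $\Omega$, and $\rho=0$, $d\rho\ne0$ on $\partial\Omega$. Let $a\in\mathbb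 N$, $s\in\mathbb R\setminus\{0\}$, $\phi=\rho^2$, $\psi=\rho^{2(a-n/2)}e^{-s/\rho}$, and $\|v\|_{L^2_\psi}^2=\int_\Omega|v|^2\psi^2\,d\mu_g$. Then there are a compact set $K\subset\Omega$ and a constant $C$ such that $$\|u\|_{L^2_\psi}\le C\,\|\phi^mP^*u\|_{L^2_\psi}$$ for all smooth sections $u$ of $E$ with support contained in $\Omega\setminus K$. (2) (Kernel Restriction Condition, KRC) Every smooth section $u$ of $E$ over $\Omega$ with $P^*u=0$ on $\Omega$ is in $C^{m-1}(\overline\Omega)$. Moreover, every $u\in C^m(\Omega)$ with $P^*u=0$ on $\Omega$ extends to a section that is smooth on $\overline\Omega$. (3) The Killing operator $\omega\mapsto\nabla_i\omega_j+\nabla_j\omega_i$ on one-forms satisfies (KRC) with $m=1$, and every smooth one-form in its kernel on $\Omega$ extends to a one-form that is smooth on $\overline\Omega$. (4) If $n\ge3$, the same as in (3) holds for the conformal Killing operator $\omega\mapsto\frac12(\nabla_i\omega_j+\nabla_j\omega_i)+\frac1n(d^*\omega)\,g_{ij}$, where $d^*\omega=-\nabla^i\omega_i$. -/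

import Mathlib

open Bundle MeasureTheory Set
open scoped Manifold ContDiff Topology ENNReal NNReal

noncomputable section

namespace KernelRestriction

/-! ### Sections of vector bundles -/

section Sections

variable {n : ℕ} {M : Type*} [TopologicalSpace M] [ChartedSpace (EuclideanSpace ℝ (Fin n)) M]

/-- The section `u` of the vector bundle `V` (with model fibre `F`) is of class `C^k` on the set
`s`.  For `s` open this is the usual notion; for `s` the closure of a domain with smooth boundary
it is `C^k` regularity up to the boundary. -/
def SectionOn (F : Type*) [NormedAddCommGroup F] [NormedSpace ℝ F]
    {V : M → Type*} [TopologicalSpace (TotalSpace F V)] [∀ x, TopologicalSpace (V x)]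
    [FiberBundle F V]
    (k : ℕ∞ω) (u : ∀ x, V x) (s : Set M) : Prop :=
  ContMDiffOn (𝓡 n) ((𝓡 n).prod 𝓘(ℝ, F)) k (fun x => TotalSpace.mk' F x (u x)) s

end Sections

/-! ### Domains with smooth boundary, defining functions, weights -/

section Domains

variable {n : ℕ} {M : Type*} [TopologicalSpace M] [ChartedSpace (EuclideanSpace ℝ (Fin n)) M]

/-- The set `Ω` has smooth boundary: near each boundary point it is the positivity set of a
smooth function with non-vanishing differential. -/
def HasSmoothBoundary (n : ℕ) {M : Type*} [TopologicalSpace M]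
    [ChartedSpace (EuclideanSpace ℝ (Fin n)) M] (Ω : Set M) : Prop :=
  ∀ p ∈ frontier Ω, ∃ r : M → ℝ, ContMDiffAt (𝓡 n) 𝓘(ℝ, ℝ) ∞ r p ∧
    mvfderiv (𝓡 n) r p ≠ 0 ∧ r p = 0 ∧ ∀ᶠ y in 𝓝 p, (y ∈ Ω ↔ 0 < r y)

/-- `ρ` is a defining function of the boundary of `Ω`: it is smooth up to the boundary, positive
in `Ω`, and vanishes exactly to first order on the boundary. -/
structure IsDefiningFunction (n : ℕ) {M : Type*} [TopologicalSpace M]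
    [ChartedSpace (EuclideanSpace ℝ (Fin n)) M] (Ω : Set M) (ρ : M → ℝ) : Prop where
  smooth : ContMDiffOn (𝓡 n) 𝓘(ℝ, ℝ) ∞ ρ (closure Ω)
  pos : ∀ y ∈ Ω, 0 < ρ y
  eq_zero : ∀ y ∈ frontier Ω, ρ y = 0
  deriv_ne_zero : ∀ y ∈ frontier Ω, mvfderivWithin (𝓡 n) ρ (closure Ω) y ≠ 0

/-- The weight `φ = ρ²`. -/
def weightPhi (ρ : M → ℝ) (y : M) : ℝ := ρ y ^ 2

/-- The weight `ψ = ρ^{2(a - n/2)} e^{-s/ρ}`. -/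
def weightPsi (n a : ℕ) (s : ℝ) (ρ : M → ℝ) (y : M) : ℝ :=
  ρ y ^ (2 * ((a : ℝ) - (n : ℝ) / 2)) * Real.exp (-s / ρ y)

end Domains

/-! ### The Riemannian measure -/

section Volume

variable {n : ℕ} {M : Type*} [TopologicalSpace M] [ChartedSpace (EuclideanSpace ℝ (Fin n)) M]
  [RiemannianBundle (fun x : M => TangentSpace (𝓡 n) x)]

/-- The `i`-th coordinate vector field of the chart at `p`, at the point with coordinates `z`. -/
def coordVector (p : M) (z : EuclideanSpace ℝ (Fin n)) (i : Fin n) :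
    TangentSpace (𝓡 n) ((chartAt (EuclideanSpace ℝ (Fin n)) p).symm z) :=
  mfderiv (𝓡 n) (𝓡 n) (chartAt (EuclideanSpace ℝ (Fin n)) p).symm z
    (EuclideanSpace.single i (1 : ℝ) : EuclideanSpace ℝ (Fin n))

/-- The matrix `(g_{ij})` of the metric in the chart at `p`. -/
def gramMatrix (p : M) (z : EuclideanSpace ℝ (Fin n)) : Matrix (Fin n) (Fin n) ℝ :=
  Matrix.of fun i j => inner ℝ (coordVector p z i) (coordVector p z j)

/-- The Riemannian measure of `(M, g)`: the measure that is `√det(g_{ij}) dz` in each of the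
charts `chartAt p`.  It is the supremum of its restrictions to the chart domains. -/
def riemannianVolume (n : ℕ) (M : Type*) [TopologicalSpace M]
    [ChartedSpace (EuclideanSpace ℝ (Fin n)) M] [MeasurableSpace M]
    [RiemannianBundle (fun x : M => TangentSpace (𝓡 n) x)] : Measure M :=
  ⨆ p : M, Measure.map (chartAt (EuclideanSpace ℝ (Fin n)) p).symm
    (((volume : Measure (EuclideanSpace ℝ (Fin n))).restrict
      (chartAt (EuclideanSpace ℝ (Fin n)) p).target).withDensity
        fun z => ENNReal.ofReal (Real.sqrt (gramMatrix p z).det))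

end Volume

/-! ### Connections and iterated covariant derivatives -/

section Connections

variable {n : ℕ} {M : Type*} [TopologicalSpace M] [ChartedSpace (EuclideanSpace ℝ (Fin n)) M]
  [IsManifold (𝓡 n) ∞ M]

/-- The Levi-Civita connection: the smooth connection on the tangent bundle that is torsion-free
and compatible with the metric. -/
structure IsLeviCivita [RiemannianBundle (fun x : M => TangentSpace (𝓡 n) x)]
    [IsContMDiffRiemannianBundle (𝓡 n) ∞ (EuclideanSpace ℝ (Fin n))
      (fun x : M => TangentSpace (𝓡 n) x)]
    (D : CovariantDerivative (𝓡 n) (EuclideanSpace ℝ (Fin n))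
      (fun x : M => TangentSpace (𝓡 n) x)) : Prop where
  smooth : CovariantDerivative.ContMDiffCovariantDerivative D ∞
  torsion_eq_zero : CovariantDerivative.torsion D = 0
  metric :
    haveI : IsContMDiffRiemannianBundle (𝓡 n) 1 (EuclideanSpace ℝ (Fin n))
      (fun x : M => TangentSpace (𝓡 n) x) := IsContMDiffRiemannianBundle.of_le (n := ∞) (by simp)
    CovariantDerivative.IsMetricCompatible D

/-- Elements of `(T*_x M)^{⊗k} ⊗ V_x`, as `k`-linear maps on `T_x M` with values in `V_x`. -/
abbrev Tens (n : ℕ) {M : Type*} [TopologicalSpace M]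
    [ChartedSpace (EuclideanSpace ℝ (Fin n)) M]
    (V : M → Type*) [∀ x, AddCommGroup (V x)] [∀ x, Module ℝ (V x)] (k : ℕ) (x : M) : Type _ :=
  MultilinearMap ℝ (fun _ : Fin k => TangentSpace (𝓡 n) x) (V x)

variable {F : Type*} [NormedAddCommGroup F] [NormedSpace ℝ F]
  {V : M → Type*} [TopologicalSpace (TotalSpace F V)]
  [∀ x, NormedAddCommGroup (V x)] [∀ x, InnerProductSpace ℝ (V x)]
  [FiberBundle F V] [VectorBundle ℝ F V]

open Classical in
/-- The covariant derivative `∇T` of a section `T` of `(T*M)^{⊗k} ⊗ V`: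
`(∇T)(Y₀, Y₁, …, Y_k) = ∇_{Y₀} (T(Y₁, …, Y_k)) - ∑ᵢ T(Y₁, …, ∇_{Y₀} Yᵢ, …, Y_k)`,
computed with any smooth extension of the vectors `Yᵢ`.  The expression is multilinear in the
`Yᵢ` as soon as `T` is differentiable at the point; the value is `0` otherwise. -/
def covTensor (D : CovariantDerivative (𝓡 n) (EuclideanSpace ℝ (Fin n))
      (fun x : M => TangentSpace (𝓡 n) x))
    (DV : CovariantDerivative (𝓡 n) F V) {k : ℕ} (T : ∀ x, Tens n V k x) (x : M) :
    Tens n V (k + 1) x :=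
  if h : ∃ S : Tens n V (k + 1) x, ∀ Y : Fin (k + 1) → TangentSpace (𝓡 n) x,
      S Y = DV (fun y => T y fun i =>
              FiberBundle.extend (EuclideanSpace ℝ (Fin n)) (Y i.succ) y) x (Y 0)
          - ∑ i : Fin k, T x (Function.update (fun j => Y j.succ) i
              (D (FiberBundle.extend (EuclideanSpace ℝ (Fin n)) (Y i.succ)) x (Y 0)))
  then h.choose else 0

/-- The iterated covariant derivative `∇^{(k)} u` of a section `u` of `V`. -/
def iterCov (D : CovariantDerivative (𝓡 n) (EuclideanSpace ℝ (Fin n))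
      (fun x : M => TangentSpace (𝓡 n) x))
    (DV : CovariantDerivative (𝓡 n) F V) (u : ∀ x, V x) : (k : ℕ) → ∀ x, Tens n V k x
  | 0 => fun x => MultilinearMap.constOfIsEmpty ℝ _ (u x)
  | k + 1 => covTensor D DV (iterCov D DV u k)

end Connections

/-! ### Differential operators -/

section Operators

variable {n : ℕ} {M : Type*} [TopologicalSpace M] [ChartedSpace (EuclideanSpace ℝ (Fin n)) M]
  [IsManifold (𝓡 n) ∞ M]
  {F : Type*} [NormedAddCommGroup F] [NormedSpace ℝ F]
  {V : M → Type*} [TopologicalSpace (TotalSpace F V)]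
  [∀ x, NormedAddCommGroup (V x)] [∀ x, InnerProductSpace ℝ (V x)]
  [FiberBundle F V] [VectorBundle ℝ F V]
  {G : Type*} [NormedAddCommGroup G] [NormedSpace ℝ G]
  {W : M → Type*} [TopologicalSpace (TotalSpace G W)]
  [∀ x, NormedAddCommGroup (W x)] [∀ x, InnerProductSpace ℝ (W x)]
  [FiberBundle G W] [VectorBundle ℝ G W]

/-- The tensor `ξ₁ ⊗ ⋯ ⊗ ξ_k ⊗ v`, where `ξᵢ = ⟨Xᵢ, ·⟩`. -/
def pureTensor [RiemannianBundle (fun x : M => TangentSpace (𝓡 n) x)] {k : ℕ} {x : M}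
    (X : Fin k → TangentSpace (𝓡 n) x) (v : V x) : Tens n V k x :=
  ((MultilinearMap.mkPiAlgebra ℝ (Fin k) ℝ).compLinearMap
    fun i => (innerSL ℝ (X i)).toLinearMap).smulRight v

/-- The family of linear maps `A_x : (T*_x M)^{⊗k} ⊗ V_x → W_x` is smooth on `s`: it maps smooth
(decomposable) sections to sections that are smooth on `s`. -/
def IsSmoothCoeff (F G : Type*) [NormedAddCommGroup F] [NormedSpace ℝ F]
    [NormedAddCommGroup G] [NormedSpace ℝ G]
    [RiemannianBundle (fun x : M => TangentSpace (𝓡 n) x)]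
    {V : M → Type*} [TopologicalSpace (TotalSpace F V)]
    [∀ x, NormedAddCommGroup (V x)] [∀ x, InnerProductSpace ℝ (V x)]
    [FiberBundle F V]
    {W : M → Type*} [TopologicalSpace (TotalSpace G W)]
    [∀ x, NormedAddCommGroup (W x)] [∀ x, InnerProductSpace ℝ (W x)]
    [FiberBundle G W] {k : ℕ}
    (A : ∀ x, Tens n V k x →ₗ[ℝ] W x) (s : Set M) : Prop :=
  ∀ (X : Fin k → ∀ x : M, TangentSpace (𝓡 n) x) (v : ∀ x, V x),
    (∀ i, SectionOn (n := n) (EuclideanSpace ℝ (Fin n)) ∞ (X i) univ) →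
    SectionOn (n := n) F ∞ v univ →
    SectionOn (n := n) G ∞ (fun x => A x (pureTensor (fun i => X i x) (v x))) s

/-- A tensor in `(T*_x M)^{⊗k} ⊗ V_x` is symmetric in its `k` covariant slots. -/
def IsSymmTens {k : ℕ} {x : M} (T : Tens n V k x) : Prop :=
  ∀ (σ : Equiv.Perm (Fin k)) (Y : Fin k → TangentSpace (𝓡 n) x), T (Y ∘ σ) = T Y

/-- The differential operator `u ↦ A(∇^{(m)} u) + ∑_{k < m} B_k(∇^{(k)} u)`. -/
def diffOp (D : CovariantDerivative (𝓡 n) (EuclideanSpace ℝ (Fin n))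
      (fun x : M => TangentSpace (𝓡 n) x))
    (DV : CovariantDerivative (𝓡 n) F V) (m : ℕ) (A : ∀ x, Tens n V m x →ₗ[ℝ] W x)
    (B : ∀ k x, Tens n V k x →ₗ[ℝ] W x) (u : ∀ x, V x) (x : M) : W x :=
  A x (iterCov D DV u m x) + ∑ k ∈ Finset.range m, B k x (iterCov D DV u k x)

/-- The Asymptotic Poincaré Inequality for an operator `Q` of order `m` on `Ω`, with respect to the
weights built from the defining function `ρ` and the parameters `a`, `s`. -/
def SatisfiesAPI (F : Type*) [NormedAddCommGroup F] [NormedSpace ℝ F]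
    [RiemannianBundle (fun x : M => TangentSpace (𝓡 n) x)] [MeasurableSpace M]
    {V : M → Type*} [TopologicalSpace (TotalSpace F V)]
    [∀ x, NormedAddCommGroup (V x)] [FiberBundle F V]
    {W : M → Type*} [∀ x, NormedAddCommGroup (W x)]
    (Ω : Set M) (ρ : M → ℝ) (a : ℕ) (s : ℝ) (m : ℕ) (Q : (∀ x, V x) → ∀ x, W x) : Prop :=
  ∃ K : Set M, IsCompact K ∧ K ⊆ Ω ∧ ∃ C : ℝ≥0, ∀ u : ∀ x, V x,
    SectionOn (n := n) F ∞ u univ → closure {x | u x ≠ 0} ⊆ Ω \ K →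
    eLpNorm (fun y => weightPsi n a s ρ y * ‖u y‖) 2 ((riemannianVolume n M).restrict Ω) ≤
      C * eLpNorm (fun y => weightPsi n a s ρ y * (weightPhi ρ y ^ m * ‖Q u y‖)) 2
        ((riemannianVolume n M).restrict Ω)

/-- Every element `u ∈ C^r(Ω)` of the kernel of `Q` on `Ω` belongs to `C^k` of the closure of `Ω`,
that is, it extends to the closure as a section that is `C^k` up to the boundary. -/
def KernelExtends (n : ℕ) {M : Type*} [TopologicalSpace M]
    [ChartedSpace (EuclideanSpace ℝ (Fin n)) M]
    (F : Type*) [NormedAddCommGroup F] [NormedSpace ℝ F]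
    {V : M → Type*} [TopologicalSpace (TotalSpace F V)] [∀ x, TopologicalSpace (V x)]
    [FiberBundle F V] {W : M → Type*} [∀ x, Zero (W x)]
    (Ω : Set M) (r k : ℕ∞ω) (Q : (∀ x, V x) → ∀ x, W x) : Prop :=
  ∀ u : ∀ x, V x, SectionOn (n := n) F r u Ω → (∀ x ∈ Ω, Q u x = 0) →
    ∃ w : ∀ x, V x, SectionOn (n := n) F k w (closure Ω) ∧ ∀ x ∈ Ω, w x = u x

/-- The Kernel Restriction Condition for an operator `Q` of order `m` on `Ω`: the elements of the
kernel of `Q` on `Ω` are in `C^{m-1}` of the closure of `Ω`. -/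
def SatisfiesKRC (n : ℕ) {M : Type*} [TopologicalSpace M]
    [ChartedSpace (EuclideanSpace ℝ (Fin n)) M]
    (F : Type*) [NormedAddCommGroup F] [NormedSpace ℝ F]
    {V : M → Type*} [TopologicalSpace (TotalSpace F V)] [∀ x, TopologicalSpace (V x)]
    [FiberBundle F V] {W : M → Type*} [∀ x, Zero (W x)]
    (Ω : Set M) (m : ℕ) (Q : (∀ x, V x) → ∀ x, W x) : Prop :=
  KernelExtends n F Ω ∞ ((m - 1 : ℕ) : ℕ∞ω) Q

end Operators

/-! ### The Killing and conformal Killing operators -/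

section Killing

variable {n : ℕ} {M : Type*} [TopologicalSpace M] [ChartedSpace (EuclideanSpace ℝ (Fin n)) M]
  [IsManifold (𝓡 n) ∞ M]

/-- The cotangent bundle. -/
abbrev Cotangent (n : ℕ) {M : Type*} [TopologicalSpace M]
    [ChartedSpace (EuclideanSpace ℝ (Fin n)) M] (x : M) : Type :=
  TangentSpace (𝓡 n) x →L[ℝ] Bundle.Trivial M ℝ x

/-- Covariant 2-tensors at `x`, as functions of two tangent vectors. -/
abbrev TwoTensor (n : ℕ) {M : Type*} [TopologicalSpace M]
    [ChartedSpace (EuclideanSpace ℝ (Fin n)) M] (x : M) : Type :=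
  TangentSpace (𝓡 n) x → TangentSpace (𝓡 n) x → ℝ

variable (D : CovariantDerivative (𝓡 n) (EuclideanSpace ℝ (Fin n))
      (fun x : M => TangentSpace (𝓡 n) x))

/-- The covariant derivative of a one-form: `(∇_X η)(Y) = X(η(Y)) - η(∇_X Y)`. -/
def covOneForm (η : ∀ x : M, Cotangent n x) (x : M) : TwoTensor n x := fun X Y =>
  mvfderiv (𝓡 n)
      (fun y => (η y (FiberBundle.extend (EuclideanSpace ℝ (Fin n)) Y y) : ℝ)) x X
    - (η x (D (FiberBundle.extend (EuclideanSpace ℝ (Fin n)) Y) x X) : ℝ)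

/-- The Killing operator `η ↦ ∇_i η_j + ∇_j η_i`. -/
def killingOp (η : ∀ x : M, Cotangent n x) (x : M) : TwoTensor n x := fun X Y =>
  covOneForm D η x X Y + covOneForm D η x Y X

variable [RiemannianBundle (fun x : M => TangentSpace (𝓡 n) x)]

/-- The codifferential `d^* η = -∇^i η_i`, computed in an orthonormal basis. -/
def codiff (η : ∀ x : M, Cotangent n x) (x : M) : ℝ :=
  haveI : FiniteDimensional ℝ (TangentSpace (𝓡 n) x) :=
    inferInstanceAs (FiniteDimensional ℝ (EuclideanSpace ℝ (Fin n)));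
  -∑ i, covOneForm D η x (stdOrthonormalBasis ℝ (TangentSpace (𝓡 n) x) i)
    (stdOrthonormalBasis ℝ (TangentSpace (𝓡 n) x) i)

/-- The conformal Killing (Ahlfors) operator
`η ↦ (1/2) (∇_i η_j + ∇_j η_i) + (1/n) (d^* η) g_{ij}`. -/
def conformalKillingOp (η : ∀ x : M, Cotangent n x) (x : M) : TwoTensor n x := fun X Y =>
  (1 / 2 : ℝ) * (covOneForm D η x X Y + covOneForm D η x Y X)
    + (1 / (n : ℝ)) * codiff D η x * inner ℝ X Y

end Killing

end KernelRestriction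

end

open Bundle MeasureTheory Set
open scoped Manifold ContDiff Topology ENNReal NNReal

noncomputable section

set_option linter.unusedSectionVars false
set_option synthInstance.maxHeartbeats 400000

/-! Everything about the general operator rests on one local identity. In a chart and a
trivialization at a point of the closure of Ω, the tensor ∇^{(k)}u is the ordinary derivative D^k u
plus terms of order less than k with smooth coefficients (`exists_tensRep_iterCov`). Since D^m u is
symmetric and A is injective on symmetric tensors, A has a smooth family of left inverses there.
Hence D^m u = R(u) + Λ(P*u), where R has order less than m and all coefficients are smooth up to the
boundary (`exists_iteratedFDeriv_eq`).

Regularity. If P*u = 0, the (m-1)-jet f of u solves a closed linear system df = Γf with Γ smooth up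
to the boundary. Near a boundary point, interior points are joined by paths in Ω of length
comparable to their distance. Grönwall bounds f, bounded df makes f Lipschitz, so f extends
continuously; the equation persists on the closure and bootstraps f to C^∞
(`exists_contDiffOn_extension`). Local extensions agree on the overlaps because Ω is dense in its
closure, so they glue.

The Killing equation is treated by prolongation. The second derivatives of a one-form a are
combinations of first derivatives of its symmetrized gradient, exactly as Christoffel symbols come
from a metric, so (a, ∂a) satisfies a closed system. For the conformal equation the symmetrized
gradient also contains a term r g with an unknown factor r. Commuting derivatives of ∂∂a leaves a
curvature-type combination of the Hessian of r, and two contractions with the inverse metric recover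
that Hessian if n ≥ 3, so (a, ∂a, r, ∂r) closes up.

The Poincaré inequality. Put w(t) = t^{2b} e^{-2s/t}. Then (t² w)' = w (2s + (2b+2)t) has the sign
of s for small t. Integrating the derivative of v² ρ² w along a direction e transversal to the
boundary gives a Hardy inequality ∫ w v² ≤ C ∫ w ρ⁴ |Dv|². Iterated m times, it bounds u by D^m u
with the weight w ρ^{4m} = w φ^{2m}. The lower order terms in the identity for D^m u carry an extra
power of ρ at this weight, so close to the boundary they are absorbed, leaving only P*u.
Localization produces no commutators: the cut-off is part of the weight, and its derivative along e
vanishes in the region where u lives. Finitely many such tubes cover the compact boundary, and near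
each centre the Riemannian and Lebesgue measures are comparable. -/

namespace KernelRestriction

/-! ### Closed first order linear systems in a normed space: smoothness up to the boundary. -/

section FlatExtension

variable {E : Type*} [NormedAddCommGroup E] [NormedSpace ℝ E]
  {X : Type*} [NormedAddCommGroup X] [NormedSpace ℝ X]

/-- Near `p`, any two points of `U` are joined within `U` by a path made of three segments whose
length is controlled by the distance, and a fixed translation moves the points of `U` into a
compact subset of `U`. -/
def HasConeProperty (U : Set E) (p : E) : Prop :=
  ∃ (e : E) (C : ℝ), 0 ≤ C ∧ ∀ N ∈ 𝓝 p, ∃ N' ∈ 𝓝 p,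
    (∀ x ∈ U ∩ N', ∀ y ∈ U ∩ N', ∃ t, 0 ≤ t ∧ t ≤ C * ‖x - y‖ ∧
      segment ℝ x (x + t • e) ⊆ U ∩ N ∧ segment ℝ (x + t • e) (y + t • e) ⊆ U ∩ N ∧
      segment ℝ (y + t • e) y ⊆ U ∩ N) ∧
    ∃ K, IsCompact K ∧ K ⊆ U ∩ N ∧ ∃ t : ℝ, ∀ x ∈ U ∩ N', x + t • e ∈ K ∧
      segment ℝ (x + t • e) x ⊆ U ∩ N

/-- At an interior point a small closed ball is convex and compact, so no displacement is needed: `e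
= 0` and `C = 0` work. -/
theorem hasConeProperty_of_mem [ProperSpace E] {U : Set E} (hU : IsOpen U) {p : E} (hp : p ∈ U) :
    HasConeProperty U p := by
  refine ⟨0, 0, le_rfl, fun N hN => ?_⟩
  obtain ⟨δ, hδ, hδN⟩ := Metric.nhds_basis_closedBall.mem_iff.1
    (Filter.inter_mem (hU.mem_nhds hp) hN)
  refine ⟨Metric.closedBall p δ, Metric.closedBall_mem_nhds _ hδ, ?_, ?_⟩
  · rintro x ⟨-, hx⟩ y ⟨-, hy⟩
    refine ⟨0, le_rfl, by simp, ?_, ?_, ?_⟩ <;>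
    · refine ((convex_closedBall p δ).segment_subset ?_ ?_).trans hδN <;> simpa
  · refine ⟨_, isCompact_closedBall p δ, hδN, 0, ?_⟩
    rintro x ⟨-, hx⟩
    refine ⟨by simpa using hx, ?_⟩
    refine ((convex_closedBall p δ).segment_subset ?_ ?_).trans hδN <;> simpa

/-- Along `e`, with `ℓ e = 1`, the function `r` grows at rate at least 1/2. Displacing both points
by `t = C * ‖x - y‖` in this direction raises `r` by `t / 2`, which pays for whatever `r` loses on
the segment between the displaced points. -/
theorem hasConeProperty_of_hasStrictFDerivAt [ProperSpace E] {U : Set E} {p : E} {r : E → ℝ}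
    {ℓ : E →L[ℝ] ℝ} (hr : HasStrictFDerivAt r ℓ p) (hℓ : ℓ ≠ 0)
    (hU : ∀ᶠ z in 𝓝 p, z ∈ U ↔ 0 < r z) : HasConeProperty U p := by
  obtain ⟨e, he⟩ : ∃ e, ℓ e = 1 := by
    obtain ⟨v, hv⟩ : ∃ v, ℓ v ≠ 0 := by
      by_contra! h
      exact hℓ (ContinuousLinearMap.ext h)
    exact ⟨(ℓ v)⁻¹ • v, by simp [hv]⟩
  -- The tolerance in strict differentiability: since `c * ‖e‖ ≤ 1/2`, the error costs at most half
  -- of the growth along `e`.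
  set c : ℝ := 1 / (2 * (‖e‖ + 1)) with hc
  have hc0 : 0 < c := by positivity
  have hce : c * ‖e‖ ≤ 1 / 2 := by
    rw [hc, div_mul_eq_mul_div, one_mul, div_le_iff₀ (by positivity)]
    linarith
  -- Near `p`, `r` is Lipschitz with constant `‖ℓ‖ + c`; the factor 2 compensates for the growth
  -- rate 1/2.
  set C : ℝ := 2 * (‖ℓ‖ + c) with hC
  have hC0 : 0 ≤ C := by positivity
  refine ⟨e, C, hC0, fun N hN => ?_⟩
  have h1 := hr.isLittleO.def hc0
  rw [nhds_prod_eq] at h1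
  obtain ⟨A, hA, hA'⟩ := Filter.eventually_prod_self_iff
    (r := fun a b => ‖r a - r b - ℓ (a - b)‖ ≤ c * ‖a - b‖).1 h1
  obtain ⟨δ, hδ, hδN⟩ := Metric.nhds_basis_ball.mem_iff.1 (Filter.inter_mem hA
    (Filter.inter_mem hN hU))
  have hest : ∀ a ∈ Metric.ball p δ, ∀ b ∈ Metric.ball p δ,
      |r a - r b - ℓ (a - b)| ≤ c * ‖a - b‖ := fun a ha b hb => by
    simpa using hA' a (hδN ha).1 b (hδN hb).1
  have hup : ∀ x ∈ Metric.ball p δ, ∀ t : ℝ, 0 ≤ t → x + t • e ∈ Metric.ball p δ →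
      r x + t / 2 ≤ r (x + t • e) := fun x hx t ht hxt => by
    have := hest _ hxt _ hx
    simp only [add_sub_cancel_left, map_smul, he, norm_smul, Real.norm_eq_abs, abs_of_nonneg ht,
      smul_eq_mul, mul_one] at this
    have h2 := (abs_le.1 this).1
    nlinarith
  have hUb : ∀ x ∈ Metric.ball p δ, 0 < r x → x ∈ U ∩ N := fun x hx hrx =>
    ⟨(hδN hx).2.2.2 hrx, (hδN hx).2.1⟩
  have hseg : ∀ x ∈ U ∩ Metric.ball p δ, ∀ t : ℝ, 0 ≤ t → x + t • e ∈ Metric.ball p δ →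
      segment ℝ x (x + t • e) ⊆ U ∩ N := by
    rintro x ⟨hxU, hx⟩ t ht hxt w hw
    have hwb := (convex_ball p δ).segment_subset hx hxt hw
    rw [segment_eq_image'] at hw
    obtain ⟨θ, hθ, rfl⟩ := hw
    simp only [add_sub_cancel_left, smul_smul] at hwb ⊢
    refine hUb _ hwb ?_
    have := hup x hx (θ * t) (mul_nonneg hθ.1 ht) hwb
    have h3 := (hδN hx).2.2.1 hxU
    have := mul_nonneg hθ.1 ht
    linarith
  -- The fixed translation: it brings points of `U` to depth `r ≥ t₀ / 2` and moves them by at most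
  -- `δ / 2`.
  set t₀ : ℝ := δ / (2 * (‖e‖ + 1)) with ht₀
  have ht₀0 : 0 < t₀ := by positivity
  have ht₀e : t₀ * ‖e‖ ≤ δ / 2 := by
    rw [ht₀, div_mul_eq_mul_div, div_le_div_iff₀ (by positivity) (by positivity)]
    nlinarith [norm_nonneg e]
  -- Points of the `η`-ball are at distance less than `2η`, so displacements of size `C * ‖x - y‖`
  -- along `e` remain in the `δ`-ball.
  set η : ℝ := δ / (4 * (1 + C * ‖e‖)) with hη
  have hη0 : 0 < η := by positivity
  have hηe : η * (1 + C * ‖e‖) = δ / 4 := by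
    rw [hη]; field_simp
  have hCe : 0 ≤ η * (C * ‖e‖) := by positivity
  have hηδ : η ≤ δ / 4 := by nlinarith
  have hball : Metric.ball p η ⊆ Metric.ball p δ := Metric.ball_subset_ball (by linarith)
  have htr : ∀ x ∈ Metric.ball p η, ∀ t : ℝ, 0 ≤ t → η + t * ‖e‖ ≤ δ →
      x + t • e ∈ Metric.ball p δ := fun x hx t ht h => by
    rw [mem_ball_iff_norm] at hx ⊢
    calc ‖x + t • e - p‖ = ‖(x - p) + t • e‖ := by congr 1; abel
      _ ≤ ‖x - p‖ + ‖t • e‖ := norm_add_le _ _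
      _ < η + t * ‖e‖ := by rw [norm_smul, Real.norm_eq_abs, abs_of_nonneg ht]; linarith
      _ ≤ δ := h
  refine ⟨Metric.ball p η, Metric.ball_mem_nhds _ hη0, ?_, ?_⟩
  · rintro x ⟨hxU, hx⟩ y ⟨hyU, hy⟩
    have hxy : ‖x - y‖ ≤ 2 * η := by
      rw [mem_ball_iff_norm] at hx hy
      calc ‖x - y‖ = ‖(x - p) - (y - p)‖ := by congr 1; abel
        _ ≤ ‖x - p‖ + ‖y - p‖ := norm_sub_le _ _
        _ ≤ 2 * η := by linarith
    set t := C * ‖x - y‖ with ht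
    have ht0 : 0 ≤ t := by positivity
    have hte : η + t * ‖e‖ ≤ δ := by
      have : t * ‖e‖ ≤ 2 * (η * (C * ‖e‖)) := by
        calc t * ‖e‖ = (C * ‖e‖) * ‖x - y‖ := by rw [ht]; ring
          _ ≤ (C * ‖e‖) * (2 * η) := by gcongr
          _ = _ := by ring
      nlinarith
    have hxt := htr x hx t ht0 hte
    have hyt := htr y hy t ht0 hte
    refine ⟨t, ht0, le_rfl, hseg x ⟨hxU, hball hx⟩ t ht0 hxt, ?_, ?_⟩
    · intro w hw
      have hwb := (convex_ball p δ).segment_subset hxt hyt hw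
      refine hUb w hwb ?_
      have h2 := hest _ hwb _ hxt
      have h3 : ‖w - (x + t • e)‖ ≤ ‖x - y‖ := by
        rw [segment_eq_image'] at hw
        obtain ⟨θ, hθ, rfl⟩ := hw
        simp only [add_sub_cancel_left, add_sub_add_right_eq_sub, norm_smul, Real.norm_eq_abs,
          abs_of_nonneg hθ.1]
        rw [norm_sub_rev x y]
        exact mul_le_of_le_one_left (norm_nonneg _) hθ.2
      have h4 := hup x (hball hx) t ht0 hxt
      have h5 := (hδN (hball hx)).2.2.1 hxU
      have h6 : |ℓ (w - (x + t • e))| ≤ ‖ℓ‖ * ‖x - y‖ :=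
        (ℓ.le_opNorm _).trans (by gcongr)
      have h7 : c * ‖w - (x + t • e)‖ ≤ c * ‖x - y‖ := by gcongr
      have h8 := (abs_le.1 h2).1
      have h9 := (abs_le.1 h6).1
      have h10 : t / 2 = ‖ℓ‖ * ‖x - y‖ + c * ‖x - y‖ := by rw [ht, hC]; ring
      linarith
    · rw [segment_symm]
      exact hseg y ⟨hyU, hball hy⟩ t ht0 hyt
  · have hcont : ContinuousOn r (Metric.ball p δ) := by
      have : LipschitzOnWith (Real.toNNReal (‖ℓ‖ + c)) r (Metric.ball p δ) := by
        refine LipschitzOnWith.of_dist_le_mul fun a ha b hb => ?_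
        rw [Real.coe_toNNReal _ (by positivity), dist_eq_norm, dist_eq_norm, Real.norm_eq_abs]
        have h2 := hest a ha b hb
        have h6 : |ℓ (a - b)| ≤ ‖ℓ‖ * ‖a - b‖ := ℓ.le_opNorm _
        rw [abs_le] at h2 h6 ⊢
        constructor <;> linarith [h2.1, h2.2, h6.1, h6.2]
      exact this.continuousOn
    have hηt : η + t₀ * ‖e‖ < δ := by linarith
    refine ⟨Metric.closedBall p (η + t₀ * ‖e‖) ∩ r ⁻¹' Ici (t₀ / 2), ?_, ?_, t₀, ?_⟩
    · refine (isCompact_closedBall p _).of_isClosed_subset ?_ inter_subset_left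
      exact (hcont.mono (Metric.closedBall_subset_ball hηt)).preimage_isClosed_of_isClosed
        Metric.isClosed_closedBall isClosed_Ici
    · rintro w ⟨hw, hw2⟩
      refine hUb w (Metric.closedBall_subset_ball hηt hw) ?_
      have : t₀ / 2 ≤ r w := hw2
      linarith
    · rintro x ⟨hxU, hx⟩
      have hxt := htr x hx t₀ ht₀0.le hηt.le
      refine ⟨⟨?_, ?_⟩, ?_⟩
      · rw [mem_ball_iff_norm] at hx
        rw [mem_closedBall_iff_norm]
        calc ‖x + t₀ • e - p‖ = ‖(x - p) + t₀ • e‖ := by congr 1; abel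
          _ ≤ ‖x - p‖ + ‖t₀ • e‖ := norm_add_le _ _
          _ ≤ η + t₀ * ‖e‖ := by rw [norm_smul, Real.norm_eq_abs, abs_of_pos ht₀0]; linarith
      · have h4 := hup x (hball hx) t₀ ht₀0.le hxt
        have h5 := (hδN (hball hx)).2.2.1 hxU
        show t₀ / 2 ≤ r (x + t₀ • e)
        linarith
      · rw [segment_symm]
        exact hseg x ⟨hxU, hball hx⟩ t₀ ht₀0.le hxt

/-- Apply the mean value inequality to `f - L` on each of the three pieces. The contributions `L v`
and `L (-v)` of the outer pieces cancel, so only the oscillation of `f'` around `L` is paid for,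
over the length of the path. -/
theorem norm_sub_sub_le_of_segments {f : E → X} {f' : E → E →L[ℝ] X} {L : E →L[ℝ] X} {V : Set E}
    {ε : ℝ} (hf : ∀ z ∈ V, HasFDerivAt f (f' z) z) (hL : ∀ z ∈ V, ‖f' z - L‖ ≤ ε) {x y v : E}
    (h₁ : segment ℝ x (x + v) ⊆ V) (h₂ : segment ℝ (x + v) (y + v) ⊆ V)
    (h₃ : segment ℝ (y + v) y ⊆ V) :
    ‖f y - f x - L (y - x)‖ ≤ ε * (2 * ‖v‖ + ‖y - x‖) := by
  have key : ∀ {a b : E}, segment ℝ a b ⊆ V → ‖f b - f a - L (b - a)‖ ≤ ε * ‖b - a‖ :=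
    fun {a b} h => (convex_segment a b).norm_image_sub_le_of_norm_hasFDerivWithin_le'
      (fun z hz => (hf z (h hz)).hasFDerivWithinAt) (fun z hz => hL z (h hz))
      (left_mem_segment ℝ a b) (right_mem_segment ℝ a b)
  have k₁ := key h₁
  have k₂ := key h₂
  have k₃ := key h₃
  have e₁ : x + v - x = v := by abel
  have e₂ : y + v - (x + v) = y - x := by abel
  have e₃ : y - (y + v) = -v := by abel
  rw [e₁] at k₁
  rw [e₂] at k₂
  rw [e₃, norm_neg] at k₃
  calc ‖f y - f x - L (y - x)‖
      = ‖(f (x + v) - f x - L v) + (f (y + v) - f (x + v) - L (y - x))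
          + (f y - f (y + v) - L (-v))‖ := by
        congr 1; rw [map_neg]; abel
    _ ≤ ‖f (x + v) - f x - L v‖ + ‖f (y + v) - f (x + v) - L (y - x)‖
          + ‖f y - f (y + v) - L (-v)‖ := norm_add₃_le
    _ ≤ ε * ‖v‖ + ε * ‖y - x‖ + ε * ‖v‖ := by gcongr
    _ = _ := by ring

/-- A solution of a linear differential inequality along a segment is bounded in terms of its
value at one end. -/
theorem norm_le_exp_of_segment {f : E → X} {f' : E → E →L[ℝ] X} {V : Set E} {M : ℝ}
    (hf : ∀ z ∈ V, HasFDerivAt f (f' z) z) (hM : ∀ z ∈ V, ‖f' z‖ ≤ M * ‖f z‖) {x y : E}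
    (h : segment ℝ x y ⊆ V) : ‖f y‖ ≤ ‖f x‖ * Real.exp (M * ‖y - x‖) := by
  have hmem : ∀ θ ∈ Icc (0 : ℝ) 1, x + θ • (y - x) ∈ V := fun θ hθ => h (by
    rw [segment_eq_image']; exact ⟨θ, hθ, rfl⟩)
  have hd : ∀ θ ∈ Icc (0 : ℝ) 1, HasDerivAt (fun θ : ℝ => f (x + θ • (y - x)))
      (f' (x + θ • (y - x)) (y - x)) θ := fun θ hθ => by
    have h1 : HasDerivAt (fun θ : ℝ => x + θ • (y - x)) (y - x) θ := by
      simpa using ((hasDerivAt_id θ).smul_const (y - x)).const_add x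
    exact (hf _ (hmem θ hθ)).comp_hasDerivAt θ h1
  have := norm_le_gronwallBound_of_norm_deriv_right_le (f := fun θ : ℝ => f (x + θ • (y - x)))
    (δ := ‖f x‖) (K := M * ‖y - x‖) (ε := 0) (a := 0) (b := 1)
    (fun θ hθ => (hd θ hθ).continuousAt.continuousWithinAt)
    (fun θ hθ => (hd θ (Ico_subset_Icc_self hθ)).hasDerivWithinAt) (by simp)
    (fun θ hθ => by
      have h1 := hM _ (hmem θ (Ico_subset_Icc_self hθ))
      calc _ ≤ ‖f' (x + θ • (y - x))‖ * ‖y - x‖ := ContinuousLinearMap.le_opNorm _ _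
        _ ≤ (M * ‖f (x + θ • (y - x))‖) * ‖y - x‖ := by gcongr
        _ = _ := by ring) 1 (by simp)
  simpa [gronwallBound_ε0] using this

theorem exists_norm_le_of_continuousWithinAt {T : Type*} [TopologicalSpace T] {Y : Type*}
    [NormedAddCommGroup Y] {h : T → Y} {s : Set T} {p : T} (hh : ContinuousWithinAt h s p) :
    ∃ M : ℝ, 0 ≤ M ∧ ∃ A ∈ 𝓝 p, ∀ z ∈ s ∩ A, ‖h z‖ ≤ M := by
  have h1 : ∀ᶠ z in 𝓝[s] p, ‖h z‖ < ‖h p‖ + 1 :=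
    hh.norm.eventually (gt_mem_nhds (lt_add_one _))
  obtain ⟨A, hA, hAs⟩ := mem_nhdsWithin_iff_exists_mem_nhds_inter.1 h1
  exact ⟨‖h p‖ + 1, by positivity, A, hA, fun z hz => le_of_lt (hAs ⟨hz.2, hz.1⟩)⟩

set_option synthInstance.maxHeartbeats 200000 in
/-- A solution of a total first order linear system whose coefficients are smooth up to the
boundary is itself smooth up to the boundary. -/
theorem exists_contDiffOn_extension [FiniteDimensional ℝ X] {U : Set E} {p : E}
    (hp : p ∈ closure U) (hc : HasConeProperty U p) {Γ : E → X →L[ℝ] E →L[ℝ] X} {N : Set E}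
    (hN : N ∈ 𝓝 p) (hΓ : ContDiffOn ℝ ∞ Γ (closure U ∩ N)) {f : E → X}
    (hf : ∀ z ∈ U ∩ N, HasFDerivAt f (Γ z (f z)) z) :
    ∃ g : E → X, ∃ N' ∈ 𝓝 p, ContDiffOn ℝ ∞ g (closure U ∩ N') ∧ EqOn g f (U ∩ N') := by
  obtain ⟨e, C, hC, hcone⟩ := hc
  have hpN : p ∈ closure U ∩ N := ⟨hp, mem_of_mem_nhds hN⟩
  obtain ⟨M, hM0, N₁, hN₁, hN₁N, hM⟩ : ∃ M : ℝ, 0 ≤ M ∧ ∃ N₁ ∈ 𝓝 p, N₁ ⊆ N ∧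
      ∀ z ∈ U ∩ N₁, ‖Γ z‖ ≤ M := by
    obtain ⟨M, hM0, A, hA, hAs⟩ := exists_norm_le_of_continuousWithinAt (hΓ.continuousOn p hpN)
    refine ⟨M, hM0, A ∩ N, Filter.inter_mem hA hN, inter_subset_right, ?_⟩
    rintro z ⟨hzU, hzA, hzN⟩
    exact hAs z ⟨⟨subset_closure hzU, hzN⟩, hzA⟩
  obtain ⟨N₂, hN₂, -, K, hK, hKU, t₀, ht₀⟩ := hcone N₁ hN₁
  obtain ⟨N₂', hN₂', hN₂sub⟩ : ∃ N₂' ∈ 𝓝 p, N₂' ⊆ N₂ ∩ N₁ :=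
    ⟨_, Filter.inter_mem hN₂ hN₁, Subset.rfl⟩
  -- `f` is bounded on the compact set `K` inside `U`, and Grönwall along the segment from `K` back
  -- to `z` carries the bound to points arbitrarily close to the boundary.
  obtain ⟨M₁, hM₁⟩ : ∃ M₁, ∀ z ∈ U ∩ N₂, ‖f z‖ ≤ M₁ := by
    have hfK : ContinuousOn f K := fun z hz =>
      (hf z ⟨(hKU hz).1, hN₁N (hKU hz).2⟩).continuousAt.continuousWithinAt
    obtain ⟨B, hB⟩ := hK.exists_bound_of_continuousOn hfK
    refine ⟨B * Real.exp (M * ‖t₀ • e‖), fun z hz => ?_⟩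
    obtain ⟨hzK, hzs⟩ := ht₀ z hz
    have h2 := norm_le_exp_of_segment (V := U ∩ N₁) (M := M)
      (fun z hz => hf z ⟨hz.1, hN₁N hz.2⟩) (fun z hz =>
        (ContinuousLinearMap.le_opNorm _ _).trans (by gcongr; exact hM z hz)) hzs
    have h3 : ‖z - (z + t₀ • e)‖ = ‖t₀ • e‖ := by
      rw [← norm_neg]; congr 1; abel
    rw [h3] at h2
    exact h2.trans (by gcongr; exact hB _ hzK)
  obtain ⟨N₃, hN₃, hpath, -⟩ := hcone N₂' hN₂'
  have hf₂ : ∀ z ∈ U ∩ N₂', HasFDerivAt f (Γ z (f z)) z := fun z hz =>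
    hf z ⟨hz.1, hN₁N (hN₂sub hz.2).2⟩
  have hd₂ : ∀ z ∈ U ∩ N₂', ‖Γ z (f z) - 0‖ ≤ M * M₁ := fun z hz => by
    rw [sub_zero]
    exact (ContinuousLinearMap.le_opNorm _ _).trans
      (mul_le_mul (hM z ⟨hz.1, (hN₂sub hz.2).2⟩) (hM₁ z ⟨hz.1, (hN₂sub hz.2).1⟩)
        (norm_nonneg _) hM0)
  -- The derivative `Γ z (f z)` is now bounded; the three-segment paths replace convexity of `U`.
  have hLip : LipschitzOnWith (Real.toNNReal (M * M₁ * (2 * C * ‖e‖ + 1))) f (U ∩ N₃) := by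
    refine LipschitzOnWith.of_dist_le_mul fun x hx y hy => ?_
    obtain ⟨t, ht, htC, h₁, h₂, h₃⟩ := hpath x hx y hy
    have h4 := norm_sub_sub_le_of_segments hf₂ hd₂ h₁ h₂ h₃
    have hMM : 0 ≤ M * M₁ := (norm_nonneg _).trans (hd₂ x (h₁ (left_mem_segment ℝ _ _)))
    rw [dist_comm, dist_eq_norm, dist_eq_norm]
    simp only [zero_apply, sub_zero] at h4
    refine h4.trans ?_
    refine le_trans ?_ (mul_le_mul_of_nonneg_right (Real.le_coe_toNNReal _) (norm_nonneg _))
    rw [mul_assoc (M * M₁)]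
    refine mul_le_mul_of_nonneg_left ?_ hMM
    rw [norm_smul, Real.norm_eq_abs, abs_of_nonneg ht, norm_sub_rev y x]
    have : t * ‖e‖ ≤ C * ‖x - y‖ * ‖e‖ := by gcongr
    linarith
  -- A Lipschitz map into a finite dimensional space extends to the whole space; `g` supplies the
  -- boundary values.
  obtain ⟨g, hg, hgf⟩ := hLip.extend_finite_dimension
  obtain ⟨N₄, hN₄sub, hN₄o, hpN₄⟩ := mem_nhds_iff.1 (Filter.inter_mem hN₃ hN₂')
  have hgf' : ∀ z ∈ U ∩ N₄, g z = f z := fun z hz => (hgf ⟨hz.1, (hN₄sub hz.2).1⟩).symm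
  have hN₄N : N₄ ⊆ N := fun z hz => hN₁N (hN₂sub (hN₄sub hz).2).2
  -- The differential equation persists on the closure: near `z` the derivative is close to its
  -- limiting value `L`, so increments between points of `U` are almost `L (y - x)`.
  have hderiv : ∀ z ∈ closure U ∩ N₄, HasFDerivWithinAt g (Γ z (g z)) (closure U ∩ N₄) z := by
    rintro z ⟨hzU, hzN⟩
    set L := Γ z (g z) with hL
    have hcont : ContinuousWithinAt (fun w => Γ w (g w)) (closure U ∩ N₄) z :=
      ((hΓ.continuousOn.mono (inter_subset_inter_right _ hN₄N)) z ⟨hzU, hzN⟩).clm_apply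
        hg.continuous.continuousWithinAt
    rw [hasFDerivWithinAt_iff_isLittleO, Asymptotics.isLittleO_iff]
    intro ε hε
    set D : ℝ := 2 * C * ‖e‖ + 1 with hD
    have hD0 : 0 < D := by positivity
    have h5 : ∀ᶠ w in 𝓝[closure U ∩ N₄] z, ‖Γ w (g w) - L‖ < ε / D := by
      have := (hcont.sub (continuousWithinAt_const (b := L))).norm
      refine this.eventually (gt_mem_nhds ?_)
      simpa [hL] using div_pos hε hD0
    obtain ⟨A, hA, hAs⟩ := mem_nhdsWithin_iff_exists_mem_nhds_inter.1 h5
    obtain ⟨δ, hδ, hδA⟩ := Metric.nhds_basis_ball.mem_iff.1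
      (Filter.inter_mem hA (hN₄o.mem_nhds hzN))
    -- `D` bounds path length over distance, so paths between points of the `η`-ball stay in the
    -- `δ`-ball, where `Γ w (g w)` is within `ε / D` of `L`.
    set η : ℝ := δ / (2 * D) with hη
    have hη0 : 0 < η := by positivity
    have hηD : η * D = δ / 2 := by rw [hη]; field_simp
    have hB : ∀ x ∈ U ∩ Metric.ball z η, ∀ y ∈ U ∩ Metric.ball z η,
        ‖g y - g x - L (y - x)‖ ≤ ε * ‖y - x‖ := by
      rintro x ⟨hxU, hx⟩ y ⟨hyU, hy⟩
      have hD1 : 1 ≤ D := by rw [hD]; nlinarith [mul_nonneg hC (norm_nonneg e)]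
      have hηδ : η ≤ δ / 2 := by nlinarith
      have hxδ : x ∈ Metric.ball z δ := Metric.ball_subset_ball (by linarith) hx
      have hyδ : y ∈ Metric.ball z δ := Metric.ball_subset_ball (by linarith) hy
      obtain ⟨t, ht, htC, h₁, h₂, h₃⟩ := hpath x ⟨hxU, (hN₄sub (hδA hxδ).2).1⟩ y
        ⟨hyU, (hN₄sub (hδA hyδ).2).1⟩
      rw [mem_ball_iff_norm] at hx hy
      have hxy : ‖x - y‖ ≤ 2 * η := by
        calc ‖x - y‖ = ‖(x - z) - (y - z)‖ := by congr 1; abel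
          _ ≤ ‖x - z‖ + ‖y - z‖ := norm_sub_le _ _
          _ ≤ 2 * η := by linarith
      have hte : ‖t • e‖ ≤ C * ‖e‖ * ‖x - y‖ := by
        rw [norm_smul, Real.norm_eq_abs, abs_of_nonneg ht]
        nlinarith [norm_nonneg e]
      have hte2 : η + ‖t • e‖ ≤ δ := by
        have : C * ‖e‖ * ‖x - y‖ ≤ C * ‖e‖ * (2 * η) := by gcongr
        nlinarith
      have hxt : x + t • e ∈ Metric.ball z δ := by
        rw [mem_ball_iff_norm]
        calc ‖x + t • e - z‖ = ‖(x - z) + t • e‖ := by congr 1; abel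
          _ ≤ ‖x - z‖ + ‖t • e‖ := norm_add_le _ _
          _ < δ := by linarith
      have hyt : y + t • e ∈ Metric.ball z δ := by
        rw [mem_ball_iff_norm]
        calc ‖y + t • e - z‖ = ‖(y - z) + t • e‖ := by congr 1; abel
          _ ≤ ‖y - z‖ + ‖t • e‖ := norm_add_le _ _
          _ < δ := by linarith
      have hsub : ∀ {a b : E}, a ∈ Metric.ball z δ → b ∈ Metric.ball z δ →
          segment ℝ a b ⊆ U ∩ N₂' → segment ℝ a b ⊆ U ∩ N₂' ∩ Metric.ball z δ :=
        fun ha hb h => subset_inter h ((convex_ball z δ).segment_subset ha hb)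
      have h4 := norm_sub_sub_le_of_segments (V := U ∩ N₂' ∩ Metric.ball z δ) (L := L)
        (ε := ε / D) (fun w hw => hf₂ w hw.1) (fun w hw => by
          have h6 := hδA hw.2
          have h7 := hAs ⟨h6.1, subset_closure hw.1.1, h6.2⟩
          simp only [mem_ofPred_eq] at h7
          rw [hgf' w ⟨hw.1.1, h6.2⟩] at h7
          exact h7.le)
        (hsub hxδ hxt h₁) (hsub hxt hyt h₂) (hsub hyt hyδ h₃)
      rw [hgf' x ⟨hxU, (hδA hxδ).2⟩, hgf' y ⟨hyU, (hδA hyδ).2⟩]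
      refine h4.trans ?_
      rw [div_mul_eq_mul_div, div_le_iff₀ hD0, mul_assoc]
      refine mul_le_mul_of_nonneg_left ?_ hε.le
      rw [norm_sub_rev x y] at hte
      rw [hD]
      linarith
    -- The increment estimate is a closed condition on pairs, so it passes from `U` to its closure.
    have hclosed : IsClosed {q : E × E | ‖g q.2 - g q.1 - L (q.2 - q.1)‖ ≤ ε * ‖q.2 - q.1‖} := by
      have hg' := hg.continuous
      exact isClosed_le (by fun_prop) (by fun_prop)
    have hB' : ∀ x ∈ closure U ∩ Metric.ball z η, ∀ y ∈ closure U ∩ Metric.ball z η,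
        ‖g y - g x - L (y - x)‖ ≤ ε * ‖y - x‖ := by
      intro x hx y hy
      have h6 : closure ((U ∩ Metric.ball z η) ×ˢ (U ∩ Metric.ball z η)) ⊆
          {q : E × E | ‖g q.2 - g q.1 - L (q.2 - q.1)‖ ≤ ε * ‖q.2 - q.1‖} :=
        closure_minimal (fun q hq => hB q.1 hq.1 q.2 hq.2) hclosed
      have h7 : ∀ x ∈ closure U ∩ Metric.ball z η, x ∈ closure (U ∩ Metric.ball z η) :=
        fun x hx => Metric.isOpen_ball.closure_inter hx
      exact h6 (by rw [closure_prod_eq]; exact ⟨h7 x hx, h7 y hy⟩ : (x, y) ∈ _)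
    filter_upwards [inter_mem_nhdsWithin _ (Metric.ball_mem_nhds z hη0)] with w hw
    exact hB' z ⟨hzU, Metric.mem_ball_self hη0⟩ w ⟨hw.1.1, hw.2⟩
  refine ⟨g, N₄, hN₄o.mem_nhds hpN₄, ?_, hgf'⟩
  have hΓ₄ : ContDiffOn ℝ ∞ Γ (closure U ∩ N₄) := hΓ.mono (inter_subset_inter_right _ hN₄N)
  -- Bootstrap: if `g` is C^k, so is its derivative `Γ w (g w)`, hence `g` is C^{k+1}.
  rw [contDiffOn_infty]
  intro k
  induction k with
  | zero => exact contDiffOn_zero.2 hg.continuous.continuousOn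
  | succ k ih =>
    rw [Nat.cast_succ, contDiffOn_succ_iff_hasFDerivWithinAt (by simp)]
    intro z hz
    refine ⟨closure U ∩ N₄, by rw [insert_eq_of_mem hz]; exact self_mem_nhdsWithin, by simp,
      fun w => Γ w (g w), hderiv, ?_⟩
    exact (hΓ₄.of_le (by exact_mod_cast le_top)).clm_apply ih

end FlatExtension

/-! ### A Hardy inequality with the weight `t^{2b} e^{-2s/t}`. -/

section Hardy

/-- The squared weight `t^{2b} e^{-2s/t}`. -/
def sqWeight (b s t : ℝ) : ℝ := t ^ (2 * b) * Real.exp (-2 * s / t)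

theorem sqWeight_nonneg (b s : ℝ) {t : ℝ} (ht : 0 ≤ t) : 0 ≤ sqWeight b s t := by
  unfold sqWeight; positivity

/-- Factors `t^{4k}` can be hidden in the parameter `b`; this is what makes the Hardy inequality
iterable. -/
theorem sqWeight_add_natCast (b s : ℝ) {t : ℝ} (ht : 0 < t) (k : ℕ) :
    sqWeight (b + 2 * k) s t = sqWeight b s t * t ^ (4 * k) := by
  unfold sqWeight
  rw [show 2 * (b + 2 * (k : ℝ)) = 2 * b + ((4 * k : ℕ) : ℝ) by push_cast; ring,
    Real.rpow_add ht, Real.rpow_natCast]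
  ring

theorem rpow_mul_exp_sq (b s : ℝ) {t : ℝ} (ht : 0 < t) :
    (t ^ b * Real.exp (-s / t)) ^ 2 = sqWeight b s t := by
  unfold sqWeight
  rw [mul_pow, ← Real.rpow_natCast (t ^ b), ← Real.rpow_mul ht.le, ← Real.exp_nat_mul]
  congr 2
  · push_cast; ring
  · push_cast; ring

/-- The factor `t²` cancels the `t^{-2}` produced by differentiating `-2s/t`. The bracket tends to
`2s ≠ 0` as `t → 0`, which is the source of the Hardy inequality. -/
theorem hasDerivAt_sq_mul_sqWeight (b s : ℝ) {t : ℝ} (ht : 0 < t) :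
    HasDerivAt (fun t => t ^ 2 * sqWeight b s t)
      (sqWeight b s t * ((2 * b + 2) * t + 2 * s)) t := by
  have h1 : HasDerivAt (fun t : ℝ => t ^ (2 * b)) (2 * b * t ^ (2 * b - 1)) t :=
    Real.hasDerivAt_rpow_const (Or.inl ht.ne')
  have h2 : HasDerivAt (fun t : ℝ => -2 * s / t) (2 * s / t ^ 2) t := by
    refine ((hasDerivAt_inv ht.ne').const_mul (-2 * s)).congr_deriv ?_
    field_simp
  have h3 := (hasDerivAt_pow 2 t).mul (h1.mul h2.exp)
  unfold sqWeight
  refine h3.congr_deriv ?_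
  rw [Real.rpow_sub_one ht.ne']
  simp only [Pi.mul_apply]
  field_simp
  ring

theorem continuousOn_sqWeight (b s : ℝ) : ContinuousOn (sqWeight b s) (Ioi 0) := by
  unfold sqWeight
  refine ContinuousOn.mul (continuousOn_id.rpow_const fun t ht => Or.inl (ne_of_gt ht)) ?_
  exact (continuousOn_const.div continuousOn_id fun t ht => ne_of_gt ht).rexp

variable {E : Type*} [NormedAddCommGroup E] [NormedSpace ℝ E]

theorem continuous_of_eq_zero_off {Y : Type*} [TopologicalSpace Y] [Zero Y] {T : Type*}
    [TopologicalSpace T] {O K : Set T} (hO : IsOpen O) (hK : IsClosed K) (hKO : K ⊆ O) {G : T → Y}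
    (hG : ContinuousOn G O) (h0 : ∀ z ∉ K, G z = 0) : Continuous G := by
  rw [continuous_iff_continuousAt]
  intro z
  by_cases hz : z ∈ K
  · exact hG.continuousAt (hO.mem_nhds (hKO hz))
  · have : G =ᶠ[𝓝 z] fun _ => 0 := by
      filter_upwards [hK.isOpen_compl.mem_nhds hz] with w hw using h0 w hw
    exact continuousAt_const.congr this.symm

theorem integrable_of_eq_zero_off [MeasurableSpace E] [BorelSpace E] {μ : Measure E}
    [IsFiniteMeasureOnCompacts μ] {O K : Set E} (hO : IsOpen O) (hK : IsCompact K) (hKO : K ⊆ O)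
    {G : E → ℝ} (hG : ContinuousOn G O) (h0 : ∀ z ∉ K, G z = 0) : Integrable G μ :=
  (continuous_of_eq_zero_off hO hK.isClosed hKO hG h0).integrable_of_hasCompactSupport
    (HasCompactSupport.intro hK h0)

/-- Integration by parts against the constant function 1. -/
theorem integral_lineDeriv_eq_zero [FiniteDimensional ℝ E] [MeasurableSpace E] [BorelSpace E]
    {μ : Measure E} [μ.IsAddHaarMeasure] {g g' : E → ℝ} {e : E} (hg : Integrable g μ)
    (hg' : Integrable g' μ) (h : ∀ x, HasLineDerivAt ℝ g (g' x) x e) : ∫ x, g' x ∂μ = 0 := by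
  have := integral_bilinear_hasLineDerivAt_right_eq_neg_left_of_integrable (μ := μ) (v := e)
    (f := fun _ : E => (1 : ℝ)) (f' := fun _ => 0) (g := g) (g' := g')
    (B := ContinuousLinearMap.mul ℝ ℝ) (by simp) (by simpa using hg') (by simpa using hg)
    (fun x _ => by simpa using! (hasFDerivAt_const (1 : ℝ) x).hasLineDerivAt e) (fun x _ => h x)
  simpa using this

/-- The data of a one-sided neighbourhood of a boundary point foliated by segments in direction `e`:
`h` is a cut-off function, `K ⊆ O` contains the support of the functions under consideration. -/
structure TubeData (O K : Set E) (ρ h : E → ℝ) (e : E) (c : ℝ) : Prop where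
  isOpen : IsOpen O
  isCompact : IsCompact K
  subset : K ⊆ O
  contDiffOn : ContDiffOn ℝ 1 ρ O
  pos : ∀ z ∈ O, 0 < ρ z
  cutoff_contDiff : ContDiff ℝ 1 h
  cutoff_nonneg : ∀ z, 0 ≤ h z
  le_fderiv : ∀ z ∈ K, c ≤ fderiv ℝ ρ z e
  cutoff_fderiv : ∀ z ∈ K, fderiv ℝ h z e = 0

variable [FiniteDimensional ℝ E] [MeasurableSpace E] [BorelSpace E]
  {μ : Measure E} [μ.IsAddHaarMeasure]

/-- The integrand vanishes off the compact set `K`, which stays away from the zeros of `ρ` where the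
weight is singular. Thus every integral below is finite and no boundary terms occur. -/
theorem TubeData.integrable_mul {O K : Set E} {ρ h : E → ℝ} {e : E} {c : ℝ}
    (H : TubeData O K ρ h e c) (b s : ℝ) (j : ℕ) {v : E → ℝ} (hv : ContinuousOn v O)
    (h0 : ∀ z ∉ K, h z = 0 ∨ v z = 0) :
    Integrable (fun z => h z * (sqWeight b s (ρ z) * ρ z ^ j) * v z) μ := by
  refine integrable_of_eq_zero_off H.isOpen H.isCompact H.subset ?_ fun z hz => ?_
  · have h1 : ContinuousOn (fun z => sqWeight b s (ρ z)) O :=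
      (continuousOn_sqWeight b s).comp H.contDiffOn.continuousOn H.pos
    exact (H.cutoff_contDiff.continuous.continuousOn.mul
      (h1.mul (H.contDiffOn.continuousOn.pow j))).mul hv
  · rcases h0 z hz with h | h <;> simp [h]

/-- A Hardy type inequality with exponential weights, for functions on a tube. -/
theorem TubeData.hardy_real {O K : Set E} {ρ h : E → ℝ} {e : E} {c : ℝ}
    (H : TubeData O K ρ h e c) (hc : 0 < c) {b s : ℝ} (hs : s ≠ 0)
    (hbs : ∀ z ∈ K, |2 * b + 2| * ρ z ≤ |s|) {v : E → ℝ} (hv : ContDiffOn ℝ 1 v O)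
    (h0 : ∀ z ∉ K, h =ᶠ[𝓝 z] 0 ∨ v =ᶠ[𝓝 z] 0) :
    ∫ z, h z * (sqWeight b s (ρ z) * ρ z ^ 0) * v z ^ 2 ∂μ ≤
      (2 / (c * |s|)) ^ 2 * ∫ z, h z * (sqWeight b s (ρ z) * ρ z ^ 4) * (fderiv ℝ v z e) ^ 2 ∂μ := by
  have hO := H.isOpen
  have hvd : ∀ z ∈ O, DifferentiableAt ℝ v z := fun z hz =>
    (hv.differentiableOn one_ne_zero).differentiableAt (hO.mem_nhds hz)
  have hρd : ∀ z ∈ O, DifferentiableAt ℝ ρ z := fun z hz =>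
    (H.contDiffOn.differentiableOn one_ne_zero).differentiableAt (hO.mem_nhds hz)
  have hvec : ContinuousOn (fun z => fderiv ℝ v z e) O :=
    (hv.continuousOn_fderiv_of_isOpen hO le_rfl).clm_apply continuousOn_const
  have hρec : ContinuousOn (fun z => fderiv ℝ ρ z e) O :=
    (H.contDiffOn.continuousOn_fderiv_of_isOpen hO le_rfl).clm_apply continuousOn_const
  have h0v : ∀ z ∉ K, h z = 0 ∨ v z = 0 := fun z hz => (h0 z hz).imp (·.eq_of_nhds) (·.eq_of_nhds)
  have h0v' : ∀ z ∉ K, h z = 0 ∨ fderiv ℝ v z e = 0 := fun z hz =>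
    (h0 z hz).imp (·.eq_of_nhds) (fun h => by rw [h.fderiv_eq]; simp)
  -- `G` is the derivative of `g` along `e`; it has no term with the derivative of `h`, which
  -- vanishes along `e` on `K`.
  set g : E → ℝ := fun z => h z * v z ^ 2 * (ρ z ^ 2 * sqWeight b s (ρ z)) with hg
  set G : E → ℝ := fun z => 2 * (h z * (sqWeight b s (ρ z) * ρ z ^ 2) * (v z * fderiv ℝ v z e)) +
    h z * (sqWeight b s (ρ z) * ρ z ^ 0) *
      (v z ^ 2 * (fderiv ℝ ρ z e * ((2 * b + 2) * ρ z + 2 * s))) with hG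
  have hgi : Integrable g μ := by
    have := H.integrable_mul (μ := μ) b s 2 (v := fun z => v z ^ 2) (hv.continuousOn.pow 2)
      (fun z hz => (h0v z hz).imp id (fun h => by simp [h]))
    refine this.congr (Filter.Eventually.of_forall fun z => ?_)
    simp only [hg]; ring
  have hGi : Integrable G μ := by
    refine Integrable.add (Integrable.const_mul ?_ 2) ?_
    · exact H.integrable_mul b s 2 (hv.continuousOn.mul hvec)
        (fun z hz => (h0v z hz).imp id (fun h => by simp [h]))
    · exact H.integrable_mul b s 0 ((hv.continuousOn.pow 2).mul
        (hρec.mul ((continuousOn_const.mul H.contDiffOn.continuousOn).add continuousOn_const)))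
        (fun z hz => (h0v z hz).imp id (fun h => by simp [h]))
  have hline : ∀ z, HasLineDerivAt ℝ g (G z) z e := by
    intro z
    by_cases hz : z ∈ K
    · have hzO := H.subset hz
      have d1 : HasFDerivAt h (fderiv ℝ h z) z :=
        (H.cutoff_contDiff.differentiable one_ne_zero z).hasFDerivAt
      have d2 := (hvd z hzO).hasFDerivAt
      have d3 := (hasDerivAt_sq_mul_sqWeight b s (H.pos z hzO)).comp_hasFDerivAt z
        (hρd z hzO).hasFDerivAt
      have d4 := ((d1.mul (d2.pow 2)).mul d3).hasLineDerivAt e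
      refine HasDerivAt.congr_deriv (f := fun t : ℝ => g (z + t • e)) d4 ?_
      simp [hG, H.cutoff_fderiv z hz]
      ring
    · have e1 : g =ᶠ[𝓝 z] 0 := by
        rcases h0 z hz with h | h <;>
        · filter_upwards [h] with w hw
          simp only [Pi.zero_apply] at hw
          simp [hg, hw]
      have e2 : G z = 0 := by
        rcases h0v z hz with h | h <;> simp [hG, h]
      rw [e2]
      have e3 : HasFDerivAt g (0 : E →L[ℝ] ℝ) z :=
        (hasFDerivAt_const (0 : ℝ) z).congr_of_eventuallyEq e1
      simpa using e3.hasLineDerivAt e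
  have hGz := integral_lineDeriv_eq_zero hgi hGi hline
  have hs' : 0 < |s| := abs_pos.2 hs
  have hi1 : Integrable (fun z => h z * (sqWeight b s (ρ z) * ρ z ^ 0) * v z ^ 2) μ :=
    H.integrable_mul b s 0 (hv.continuousOn.pow 2)
      (fun z hz => (h0v z hz).imp id (fun h => by simp [h]))
  have hi2 : Integrable (fun z => h z * (sqWeight b s (ρ z) * ρ z ^ 4) * (fderiv ℝ v z e) ^ 2) μ :=
    H.integrable_mul b s 4 (hvec.pow 2) (fun z hz => (h0v' z hz).imp id (fun h => by simp [h]))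
  -- Multiplying the identity `∫ G = 0` by the sign of `s` treats both signs at once.
  set σ : ℝ := (SignType.sign s : ℝ) with hσ
  have hσs : σ * s = |s| := sign_mul_self s
  have hσ1 : σ ^ 2 = 1 := by
    rcases lt_or_gt_of_ne hs with h | h <;> simp [hσ, h]
  have hσabs : |σ| = 1 := by
    rcases lt_or_gt_of_ne hs with h | h <;> simp [hσ, h]
  have hpt : ∀ z, c * |s| / 2 * (h z * (sqWeight b s (ρ z) * ρ z ^ 0) * v z ^ 2) ≤
      σ * G z + 2 / (c * |s|) *
        (h z * (sqWeight b s (ρ z) * ρ z ^ 4) * (fderiv ℝ v z e) ^ 2) := by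
    intro z
    by_cases hz : z ∈ K
    · have hzO := H.subset hz
      set a := h z * sqWeight b s (ρ z) with ha
      have ha0 : 0 ≤ a := mul_nonneg (H.cutoff_nonneg z) (sqWeight_nonneg b s (H.pos z hzO).le)
      set x := v z
      set y := fderiv ℝ v z e
      set r := ρ z with hr
      set d := fderiv ℝ ρ z e
      have hd : c ≤ d := H.le_fderiv z hz
      have hr0 : 0 < r := H.pos z hzO
      -- The main term is `2|s|`, and the smallness of `ρ` on `K` makes the other at most `|s|`.
      have hK : |s| ≤ σ * ((2 * b + 2) * r + 2 * s) := by
        have h1 : |σ * ((2 * b + 2) * r)| ≤ |s| := by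
          rw [abs_mul, hσabs, one_mul, abs_mul, abs_of_pos hr0]
          exact hbs z hz
        have h2 := (abs_le.1 h1).1
        nlinarith
      have hq : c * |s| ≤ σ * (d * ((2 * b + 2) * r + 2 * s)) := by
        nlinarith
      -- The cross term `2 r² x y` is absorbed by completing a square: half of the coefficient
      -- `c|s|` of `x²` is spent here, the other half survives.
      have hyy : 0 ≤ c * |s| / 2 * x ^ 2 + 2 * σ * (r ^ 2 * (x * y)) +
          2 / (c * |s|) * (r ^ 4 * y ^ 2) := by
        have hcs : 0 < c * |s| := by positivity
        have : c * |s| / 2 * x ^ 2 + 2 * σ * (r ^ 2 * (x * y)) + 2 / (c * |s|) * (r ^ 4 * y ^ 2)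
            = 2 / (c * |s|) * (c * |s| / 2 * x + σ * r ^ 2 * y) ^ 2 := by
          have e1 : (c * |s| / 2 * x + σ * r ^ 2 * y) ^ 2 = (c * |s| / 2 * x) ^ 2 +
            2 * (c * |s| / 2 * x) * (σ * r ^ 2 * y) + σ ^ 2 * (r ^ 4 * y ^ 2) := by ring
          rw [e1, hσ1]
          field_simp
        rw [this]; positivity
      have hx2 : c * |s| * x ^ 2 ≤ σ * (d * ((2 * b + 2) * r + 2 * s)) * x ^ 2 := by gcongr
      have key : c * |s| / 2 * x ^ 2 ≤ σ * (2 * (r ^ 2 * (x * y)) +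
          x ^ 2 * (d * ((2 * b + 2) * r + 2 * s))) + 2 / (c * |s|) * (r ^ 4 * y ^ 2) := by
        nlinarith
      have := mul_le_mul_of_nonneg_left key ha0
      simp only [hG]
      calc _ = a * (c * |s| / 2 * x ^ 2) := by rw [ha]; ring
        _ ≤ _ := this
        _ = _ := by rw [ha]; ring
    · have e2 : G z = 0 := by
        rcases h0v z hz with h | h <;> simp [hG, h]
      have e3 : h z * (sqWeight b s (ρ z) * ρ z ^ 0) * v z ^ 2 = 0 := by
        rcases h0v z hz with h | h <;> simp [h]
      have e4 : h z * (sqWeight b s (ρ z) * ρ z ^ 4) * (fderiv ℝ v z e) ^ 2 = 0 := by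
        rcases h0v' z hz with h | h <;> simp [h]
      rw [e2, e3, e4]; simp
  have hint := integral_mono (hi1.const_mul _) ((hGi.const_mul σ).add (hi2.const_mul _)) hpt
  rw [integral_add' (hGi.const_mul σ) (hi2.const_mul _), integral_const_mul, integral_const_mul,
    integral_const_mul, hGz, mul_zero, zero_add] at hint
  have hcs : 0 < c * |s| := by positivity
  set I := ∫ z, h z * (sqWeight b s (ρ z) * ρ z ^ 0) * v z ^ 2 ∂μ
  set J := ∫ z, h z * (sqWeight b s (ρ z) * ρ z ^ 4) * (fderiv ℝ v z e) ^ 2 ∂μ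
  calc I = 2 / (c * |s|) * (c * |s| / 2 * I) := by field_simp
    _ ≤ 2 / (c * |s|) * (2 / (c * |s|) * J) := by gcongr
    _ = _ := by ring

/-- The Hardy type inequality for functions with values in a finite dimensional space. -/
theorem exists_hardy (Y : Type*) [NormedAddCommGroup Y] [NormedSpace ℝ Y] [FiniteDimensional ℝ Y]
    (μ : Measure E) [μ.IsAddHaarMeasure] (e : E) {c : ℝ} (hc : 0 < c) {s : ℝ} (hs : s ≠ 0) :
    ∃ C : ℝ, 0 ≤ C ∧ ∀ (O K : Set E) (ρ h : E → ℝ), TubeData O K ρ h e c → ∀ b : ℝ,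
      (∀ z ∈ K, |2 * b + 2| * ρ z ≤ |s|) → ∀ v : E → Y, ContDiffOn ℝ 1 v O →
      (∀ z ∉ K, h =ᶠ[𝓝 z] 0 ∨ v =ᶠ[𝓝 z] 0) →
      ∫ z, h z * (sqWeight b s (ρ z) * ρ z ^ 0) * ‖v z‖ ^ 2 ∂μ ≤
        C * ∫ z, h z * (sqWeight b s (ρ z) * ρ z ^ 4) * ‖fderiv ℝ v z‖ ^ 2 ∂μ := by
  set T := toEuclidean (E := Y)
  -- The real inequality is summed over Euclidean components. The constant depends neither on the
  -- tube nor on `b`: below, `K` varies with the section and `b` with the order of differentiation.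
  refine ⟨‖T.symm.toContinuousLinearMap‖ ^ 2 * ((2 / (c * |s|)) ^ 2 *
    (‖T.toContinuousLinearMap‖ * ‖e‖) ^ 2), by positivity, ?_⟩
  intro O K ρ h H b hb v hv h0
  have hO := H.isOpen
  have h0v : ∀ z ∉ K, h z = 0 ∨ v z = 0 := fun z hz => (h0 z hz).imp (·.eq_of_nhds) (·.eq_of_nhds)
  have h0v' : ∀ z ∉ K, h z = 0 ∨ fderiv ℝ v z = 0 := fun z hz =>
    (h0 z hz).imp (·.eq_of_nhds) (fun h => by rw [h.fderiv_eq]; simp)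
  have hfc := hv.continuousOn_fderiv_of_isOpen hO le_rfl
  have hvi : ∀ i, ContDiffOn ℝ 1 (fun z => T (v z) i) O := fun i =>
    ((EuclideanSpace.proj (𝕜 := ℝ) i : _ →L[ℝ] ℝ).contDiff.comp
      T.toContinuousLinearMap.contDiff).comp_contDiffOn hv
  have hfi : ∀ i, ∀ z ∈ O, fderiv ℝ (fun z => T (v z) i) z e = T (fderiv ℝ v z e) i := by
    intro i z hz
    have hvd := ((hv.differentiableOn one_ne_zero).differentiableAt (hO.mem_nhds hz)).hasFDerivAt
    have := ((EuclideanSpace.proj (𝕜 := ℝ) i : _ →L[ℝ] ℝ).hasFDerivAt.comp z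
      (T.toContinuousLinearMap.hasFDerivAt.comp z hvd)).fderiv
    exact congrArg (· e) this
  have h0i : ∀ i, ∀ z ∉ K, h =ᶠ[𝓝 z] 0 ∨ (fun z => T (v z) i) =ᶠ[𝓝 z] 0 := fun i z hz =>
    (h0 z hz).imp id (fun h => by filter_upwards [h] with w hw; simp [hw])
  have hint1 : Integrable (fun z => h z * (sqWeight b s (ρ z) * ρ z ^ 0) * ‖v z‖ ^ 2) μ :=
    H.integrable_mul b s 0 (hv.continuousOn.norm.pow 2)
      (fun z hz => (h0v z hz).imp id (fun h => by simp [h]))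
  have hint2 : Integrable (fun z => h z * (sqWeight b s (ρ z) * ρ z ^ 4) *
      ‖fderiv ℝ v z‖ ^ 2) μ :=
    H.integrable_mul b s 4 (hfc.norm.pow 2)
      (fun z hz => (h0v' z hz).imp id (fun h => by simp [h]))
  have hinti : ∀ i, Integrable (fun z => h z * (sqWeight b s (ρ z) * ρ z ^ 0) *
      (T (v z) i) ^ 2) μ := fun i =>
    H.integrable_mul b s 0 ((hvi i).continuousOn.pow 2)
      (fun z hz => (h0v z hz).imp id (fun h => by simp [h]))
  have hinti' : ∀ i, Integrable (fun z => h z * (sqWeight b s (ρ z) * ρ z ^ 4) *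
      (fderiv ℝ (fun z => T (v z) i) z e) ^ 2) μ := fun i =>
    H.integrable_mul b s 4
      ((((hvi i).continuousOn_fderiv_of_isOpen hO le_rfl).clm_apply continuousOn_const).pow 2)
      (fun z hz => ((h0i i) z hz).imp (·.eq_of_nhds) (fun h => by rw [h.fderiv_eq]; simp))
  have hw0 : ∀ z ∈ O, ∀ j, 0 ≤ h z * (sqWeight b s (ρ z) * ρ z ^ j) := fun z hz j =>
    mul_nonneg (H.cutoff_nonneg z) (mul_nonneg (sqWeight_nonneg b s (H.pos z hz).le)
      (pow_nonneg (H.pos z hz).le j))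
  have s1 : ∫ z, h z * (sqWeight b s (ρ z) * ρ z ^ 0) * ‖v z‖ ^ 2 ∂μ ≤
      ‖T.symm.toContinuousLinearMap‖ ^ 2 *
        ∑ i, ∫ z, h z * (sqWeight b s (ρ z) * ρ z ^ 0) * (T (v z) i) ^ 2 ∂μ := by
    rw [← integral_finsetSum _ (fun i _ => hinti i), ← integral_const_mul]
    refine integral_mono hint1 ((integrable_finsetSum _ (fun i _ => hinti i)).const_mul _) ?_
    intro z
    by_cases hz : z ∈ K
    · have h1 : ‖v z‖ ≤ ‖T.symm.toContinuousLinearMap‖ * ‖T (v z)‖ := by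
        simpa using T.symm.toContinuousLinearMap.le_opNorm (T (v z))
      have h2 : ‖v z‖ ^ 2 ≤ ‖T.symm.toContinuousLinearMap‖ ^ 2 * ∑ i, (T (v z) i) ^ 2 := by
        have h3 : ‖T (v z)‖ ^ 2 = ∑ i, (T (v z) i) ^ 2 := by
          simp [EuclideanSpace.norm_sq_eq]
        rw [← h3, ← mul_pow]
        gcongr
      calc _ ≤ h z * (sqWeight b s (ρ z) * ρ z ^ 0) *
            (‖T.symm.toContinuousLinearMap‖ ^ 2 * ∑ i, (T (v z) i) ^ 2) := by
            have := hw0 z (H.subset hz) 0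
            dsimp only
            gcongr
        _ = _ := by dsimp only; rw [← Finset.mul_sum]; ring
    · rcases h0v z hz with h | h <;> simp [h]
  have s2 : ∑ i, ∫ z, h z * (sqWeight b s (ρ z) * ρ z ^ 4) *
      (fderiv ℝ (fun z => T (v z) i) z e) ^ 2 ∂μ ≤ (‖T.toContinuousLinearMap‖ * ‖e‖) ^ 2 *
        ∫ z, h z * (sqWeight b s (ρ z) * ρ z ^ 4) * ‖fderiv ℝ v z‖ ^ 2 ∂μ := by
    rw [← integral_finsetSum _ (fun i _ => hinti' i), ← integral_const_mul]
    refine integral_mono (integrable_finsetSum _ (fun i _ => hinti' i)) (hint2.const_mul _) ?_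
    intro z
    by_cases hz : z ∈ K
    · have hzO := H.subset hz
      have h1 : ‖T (fderiv ℝ v z e)‖ ≤ ‖T.toContinuousLinearMap‖ * ‖e‖ * ‖fderiv ℝ v z‖ := by
        calc _ ≤ ‖T.toContinuousLinearMap‖ * ‖fderiv ℝ v z e‖ := T.toContinuousLinearMap.le_opNorm _
          _ ≤ ‖T.toContinuousLinearMap‖ * (‖fderiv ℝ v z‖ * ‖e‖) := by
            gcongr; exact ContinuousLinearMap.le_opNorm _ _
          _ = _ := by ring
      have h2 : ∑ i, (fderiv ℝ (fun z => T (v z) i) z e) ^ 2 ≤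
          (‖T.toContinuousLinearMap‖ * ‖e‖) ^ 2 * ‖fderiv ℝ v z‖ ^ 2 := by
        have h3 : ‖T (fderiv ℝ v z e)‖ ^ 2 = ∑ i, (fderiv ℝ (fun z => T (v z) i) z e) ^ 2 := by
          simp [EuclideanSpace.norm_sq_eq, hfi _ z hzO]
        rw [← h3, ← mul_pow]
        gcongr
      calc _ = h z * (sqWeight b s (ρ z) * ρ z ^ 4) *
            ∑ i, (fderiv ℝ (fun z => T (v z) i) z e) ^ 2 := by dsimp only; rw [← Finset.mul_sum]
        _ ≤ h z * (sqWeight b s (ρ z) * ρ z ^ 4) *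
            ((‖T.toContinuousLinearMap‖ * ‖e‖) ^ 2 * ‖fderiv ℝ v z‖ ^ 2) := by
            have := hw0 z hzO 4
            gcongr
        _ = _ := by ring
    · rcases h0 z hz with h | h
      · simp [h.eq_of_nhds]
      · have : ∀ i, fderiv ℝ (fun z => T (v z) i) z e = 0 := fun i => by
          have h' : (fun z => T (v z) i) =ᶠ[𝓝 z] 0 := by
            filter_upwards [h] with w hw; simp [hw]
          rw [h'.fderiv_eq]; simp
        simp [this, h.fderiv_eq]
  calc _ ≤ _ := s1
    _ ≤ ‖T.symm.toContinuousLinearMap‖ ^ 2 * ∑ i, (2 / (c * |s|)) ^ 2 *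
        ∫ z, h z * (sqWeight b s (ρ z) * ρ z ^ 4) *
          (fderiv ℝ (fun z => T (v z) i) z e) ^ 2 ∂μ := by
      gcongr with i
      exact H.hardy_real hc hs hb (hvi i) (h0i i)
    _ ≤ ‖T.symm.toContinuousLinearMap‖ ^ 2 * ((2 / (c * |s|)) ^ 2 * ((‖T.toContinuousLinearMap‖ * ‖e‖) ^ 2 *
        ∫ z, h z * (sqWeight b s (ρ z) * ρ z ^ 4) * ‖fderiv ℝ v z‖ ^ 2 ∂μ)) := by
      rw [← Finset.mul_sum]
      gcongr
    _ = _ := by ring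

end Hardy

/-! ### Iterating the Hardy inequality and absorbing the lower order terms. -/

section FlatAPI

variable {E : Type*} [NormedAddCommGroup E] [NormedSpace ℝ E]
  [FiniteDimensional ℝ E] [MeasurableSpace E] [BorelSpace E]

/-- Allows the Hardy inequality to be applied to iterated derivatives. -/
instance finiteDimensional_continuousMultilinearMap {ι : Type*} [Finite ι] {E F : Type*}
    [NormedAddCommGroup E] [NormedSpace ℝ E] [FiniteDimensional ℝ E]
    [NormedAddCommGroup F] [NormedSpace ℝ F] [FiniteDimensional ℝ F] :
    FiniteDimensional ℝ (ContinuousMultilinearMap ℝ (fun _ : ι => E) F) :=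
  Module.Finite.of_injective
    ({ toFun := fun f => f.toMultilinearMap
       map_add' := fun _ _ => rfl
       map_smul' := fun _ _ => rfl } :
      ContinuousMultilinearMap ℝ (fun _ : ι => E) F →ₗ[ℝ] MultilinearMap ℝ (fun _ : ι => E) F)
    ContinuousMultilinearMap.toMultilinearMap_injective

theorem eventuallyEq_iteratedFDeriv_zero {F : Type*} [NormedAddCommGroup F] [NormedSpace ℝ F]
    {v : E → F} {z : E} (h : v =ᶠ[𝓝 z] 0) (k : ℕ) : iteratedFDeriv ℝ k v =ᶠ[𝓝 z] 0 := by
  have := h.iteratedFDeriv ℝ k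
  refine this.trans (Filter.Eventually.of_forall fun w => ?_)
  simp

/-- The asymptotic Poincaré inequality on a tube, for functions whose top order derivative is
controlled by the lower order ones and a remainder `Q`. -/
theorem exists_flat_api (F : Type*) [NormedAddCommGroup F] [NormedSpace ℝ F]
    [FiniteDimensional ℝ F] (μ : Measure E) [μ.IsAddHaarMeasure] (e : E) {c : ℝ} (hc : 0 < c)
    (b : ℝ) {s : ℝ} (hs : s ≠ 0) (m : ℕ) (C₀ : ℝ) :
    ∃ ε : ℝ, 0 < ε ∧ ∃ C : ℝ, 0 ≤ C ∧ ∀ (O K : Set E) (ρ h : E → ℝ), TubeData O K ρ h e c →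
      (∀ z ∈ K, ρ z ≤ ε) → ∀ v : E → F, ContDiffOn ℝ ∞ v O →
      (∀ z ∉ K, h =ᶠ[𝓝 z] 0 ∨ v =ᶠ[𝓝 z] 0) → ∀ Q : E → ℝ, (∀ z, 0 ≤ Q z) →
      (∀ z ∈ K, ‖iteratedFDeriv ℝ m v z‖ ≤
        C₀ * (∑ k ∈ Finset.range m, ‖iteratedFDeriv ℝ k v z‖ + Q z)) →
      ∫⁻ z, ENNReal.ofReal (h z * sqWeight b s (ρ z) * ‖v z‖ ^ 2) ∂μ ≤
        ENNReal.ofReal C *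
          ∫⁻ z, ENNReal.ofReal (h z * (sqWeight b s (ρ z) * ρ z ^ (4 * m)) * Q z ^ 2) ∂μ := by
  choose A hA0 hA using fun k : ℕ => exists_hardy (E [×k]→L[ℝ] F) μ e hc hs
  -- A common Hardy constant for all orders below `m`; the summand 1 makes its powers increasing.
  set B : ℝ := 1 + ∑ k ∈ Finset.range m, A k with hB
  have hB1 : 1 ≤ B := by
    have : 0 ≤ ∑ k ∈ Finset.range m, A k := Finset.sum_nonneg fun k _ => hA0 k
    linarith
  have hAB : ∀ k < m, A k ≤ B := fun k hk => by
    have := Finset.single_le_sum (f := A) (fun k _ => hA0 k) (Finset.mem_range.2 hk)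
    linarith
  -- The factor `m + 1` is Cauchy-Schwarz for the square of a sum of `m + 1` terms.
  set C₁ : ℝ := C₀ ^ 2 * (m + 1) with hC₁
  have hC₁0 : 0 ≤ C₁ := by positivity
  -- Chosen so that the lower order terms, of total size `C₁ m B^m δ` times the top one, can be
  -- absorbed with factor 1/2.
  set δ : ℝ := 1 / (2 * (C₁ * m * B ^ m + 1)) with hδ
  have hδ0 : 0 < δ := by positivity
  have hδC : C₁ * m * B ^ m * δ ≤ 1 / 2 := by
    rw [hδ, mul_one_div, div_le_div_iff₀ (by positivity) (by positivity)]
    linarith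
  set L : ℝ := ∑ k ∈ Finset.range m, |2 * (b + 2 * k) + 2| with hL
  have hL0 : 0 ≤ L := Finset.sum_nonneg fun k _ => abs_nonneg _
  have hs' : 0 < |s| := abs_pos.2 hs
  -- Three demands on `ρ` in the tube: powers of `ρ` decrease, one factor `ρ` is at most `δ`, and
  -- the Hardy condition holds for every shifted exponent `b + 2k` with `k < m`.
  set ε : ℝ := min (min 1 δ) (|s| / (L + 1)) with hε
  refine ⟨ε, by positivity, 2 * (B ^ m * C₁), by positivity, ?_⟩
  intro O K ρ h H hρε v hv h0 Q hQ hmain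
  have hO := H.isOpen
  have hD : ∀ k, ContDiffOn ℝ 1 (iteratedFDeriv ℝ k v) O := fun k z hz =>
    ((hv.contDiffAt (hO.mem_nhds hz)).iteratedFDeriv_right (m := 1) (i := k)
      (by exact_mod_cast le_top)).contDiffWithinAt
  have h0D : ∀ k, ∀ z ∉ K, h =ᶠ[𝓝 z] 0 ∨ iteratedFDeriv ℝ k v =ᶠ[𝓝 z] 0 := fun k z hz =>
    (h0 z hz).imp id (fun h => eventuallyEq_iteratedFDeriv_zero h k)
  set I : ℕ → ℝ := fun k => ∫ z, h z * (sqWeight b s (ρ z) * ρ z ^ (4 * k)) *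
    ‖iteratedFDeriv ℝ k v z‖ ^ 2 ∂μ with hI
  have hint : ∀ k j, Integrable (fun z => h z * (sqWeight b s (ρ z) * ρ z ^ j) *
      ‖iteratedFDeriv ℝ k v z‖ ^ 2) μ := fun k j =>
    H.integrable_mul b s j ((hD k).continuousOn.norm.pow 2)
      (fun z hz => (h0D k z hz).imp (·.eq_of_nhds) (fun h => by simp [h.eq_of_nhds]))
  have hw0 : ∀ z ∈ K, ∀ j, 0 ≤ h z * (sqWeight b s (ρ z) * ρ z ^ j) := fun z hz j =>
    mul_nonneg (H.cutoff_nonneg z) (mul_nonneg (sqWeight_nonneg b s (H.pos z (H.subset hz)).le)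
      (pow_nonneg (H.pos z (H.subset hz)).le j))
  have hzero : ∀ k, ∀ z ∉ K, h z = 0 ∨ ‖iteratedFDeriv ℝ k v z‖ = 0 := fun k z hz =>
    (h0D k z hz).imp (·.eq_of_nhds) (fun h => by simp [h.eq_of_nhds])
  have hnn : ∀ k j, ∀ z, 0 ≤ h z * (sqWeight b s (ρ z) * ρ z ^ j) *
      ‖iteratedFDeriv ℝ k v z‖ ^ 2 := fun k j z => by
    by_cases hz : z ∈ K
    · exact mul_nonneg (hw0 z hz j) (by positivity)
    · rcases hzero k z hz with h | h <;> simp [h]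
  have hI0 : ∀ k, 0 ≤ I k := fun k => integral_nonneg (hnn k _)
  -- Hardy for `D^k v` with `b` replaced by `b + 2k`: the weights become `ρ^{4k}` on the left and
  -- `ρ^{4(k+1)}` on the right.
  have hstep : ∀ k < m, I k ≤ B * I (k + 1) := by
    intro k hk
    have h1 := hA k O K ρ h H (b + 2 * k) (fun z hz => by
      have hr := hρε z hz
      have hr0 := (H.pos z (H.subset hz)).le
      have h2 : |2 * (b + 2 * (k : ℝ)) + 2| ≤ L :=
        Finset.single_le_sum (f := fun k : ℕ => |2 * (b + 2 * (k : ℝ)) + 2|)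
          (fun k _ => abs_nonneg _) (Finset.mem_range.2 hk)
      calc _ ≤ L * (|s| / (L + 1)) := by
            gcongr
            exact hr.trans (min_le_right _ _)
        _ ≤ |s| := by
            rw [mul_div_assoc', div_le_iff₀ (by positivity)]
            nlinarith) (iteratedFDeriv ℝ k v) (hD k) (h0D k)
    have e1 : ∀ (j i : ℕ) (y : E → ℝ), (∀ z ∉ K, h z = 0 ∨ y z = 0) →
        ∫ z, h z * (sqWeight (b + 2 * k) s (ρ z) * ρ z ^ j) * y z ^ 2 ∂μ =
        ∫ z, h z * (sqWeight b s (ρ z) * ρ z ^ (4 * k + j)) * y z ^ 2 ∂μ := by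
      intro j i y hy
      refine integral_congr_ae (Filter.Eventually.of_forall fun z => ?_)
      dsimp only
      by_cases hz : z ∈ K
      · rw [sqWeight_add_natCast b s (H.pos z (H.subset hz)), pow_add]
        ring
      · rcases hy z hz with h | h <;> simp [h]
    rw [e1 0 0 _ (hzero k), e1 4 0 _ (fun z hz => by
      rw [norm_fderiv_iteratedFDeriv]; exact hzero (k + 1) z hz)] at h1
    simp only [norm_fderiv_iteratedFDeriv, add_zero] at h1
    refine h1.trans ?_
    exact mul_le_mul_of_nonneg_right (hAB k hk) (hI0 (k + 1))
  have hpow : ∀ j ≤ m, I (m - j) ≤ B ^ j * I m := by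
    intro j
    induction j with
    | zero => intro _; simp
    | succ j ih =>
      intro hj
      have h1 := hstep (m - (j + 1)) (by omega)
      rw [show m - (j + 1) + 1 = m - j by omega] at h1
      calc _ ≤ B * I (m - j) := h1
        _ ≤ B * (B ^ j * I m) := by gcongr; exact ih (by omega)
        _ = _ := by ring
  have hpow' : ∀ k ≤ m, I k ≤ B ^ m * I m := fun k hk => by
    have h1 := hpow (m - k) (by omega)
    rw [show m - (m - k) = k by omega] at h1
    exact h1.trans (mul_le_mul_of_nonneg_right (pow_le_pow_right₀ hB1 (by omega)) (hI0 m))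
  -- `Q` need be neither measurable nor integrable, so this integral stays in `[0, ∞]`.
  set J := ∫⁻ z, ENNReal.ofReal (h z * (sqWeight b s (ρ z) * ρ z ^ (4 * m)) * Q z ^ 2) ∂μ with hJ
  have hofI : ∀ k j, ENNReal.ofReal (∫ z, h z * (sqWeight b s (ρ z) * ρ z ^ j) *
      ‖iteratedFDeriv ℝ k v z‖ ^ 2 ∂μ) = ∫⁻ z, ENNReal.ofReal (h z * (sqWeight b s (ρ z) * ρ z ^ j) *
      ‖iteratedFDeriv ℝ k v z‖ ^ 2) ∂μ := fun k j =>
    ofReal_integral_eq_lintegral_ofReal (hint k j) (Filter.Eventually.of_forall (hnn k j))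
  have habs : ENNReal.ofReal (I m) ≤ ENNReal.ofReal (I m / 2) + ENNReal.ofReal C₁ * J := by
    set S : E → ℝ := fun z => C₁ * δ * ∑ k ∈ Finset.range m,
      h z * (sqWeight b s (ρ z) * ρ z ^ (4 * k)) * ‖iteratedFDeriv ℝ k v z‖ ^ 2 with hS
    have hSi : Integrable S μ := (integrable_finsetSum _ fun k _ => hint k (4 * k)).const_mul _
    have hS0 : ∀ z, 0 ≤ S z := fun z =>
      mul_nonneg (by positivity) (Finset.sum_nonneg fun k _ => hnn k (4 * k) z)
    have hpt : ∀ z, ENNReal.ofReal (h z * (sqWeight b s (ρ z) * ρ z ^ (4 * m)) *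
        ‖iteratedFDeriv ℝ m v z‖ ^ 2) ≤ ENNReal.ofReal (S z) + ENNReal.ofReal C₁ *
        ENNReal.ofReal (h z * (sqWeight b s (ρ z) * ρ z ^ (4 * m)) * Q z ^ 2) := by
      intro z
      by_cases hz : z ∈ K
      · have hr0 := (H.pos z (H.subset hz)).le
        have hr := hρε z hz
        have hr1 : ρ z ≤ 1 := hr.trans ((min_le_left _ _).trans (min_le_left _ _))
        have hrδ : ρ z ≤ δ := hr.trans ((min_le_left _ _).trans (min_le_right _ _))
        rw [← ENNReal.ofReal_mul hC₁0, ← ENNReal.ofReal_add (hS0 z)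
          (mul_nonneg hC₁0 (mul_nonneg (hw0 z hz _) (sq_nonneg _)))]
        refine ENNReal.ofReal_le_ofReal ?_
        have h1 := hmain z hz
        have h2 : ‖iteratedFDeriv ℝ m v z‖ ^ 2 ≤
            C₁ * (∑ k ∈ Finset.range m, ‖iteratedFDeriv ℝ k v z‖ ^ 2 + Q z ^ 2) := by
          have h3 : (∑ k ∈ Finset.range m, ‖iteratedFDeriv ℝ k v z‖ + Q z) ^ 2 ≤
              (m + 1) * (∑ k ∈ Finset.range m, ‖iteratedFDeriv ℝ k v z‖ ^ 2 + Q z ^ 2) := by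
            set y : ℕ → ℝ := fun k => if k = m then Q z else ‖iteratedFDeriv ℝ k v z‖
            have e1 : ∀ k ∈ Finset.range m, y k = ‖iteratedFDeriv ℝ k v z‖ := fun k hk =>
              if_neg (Finset.mem_range.1 hk).ne
            have e2 : y m = Q z := if_pos rfl
            have := sq_sum_le_card_mul_sum_sq (s := Finset.range (m + 1)) (f := y)
            rw [Finset.sum_range_succ, Finset.sum_range_succ, Finset.sum_congr rfl e1, e2,
              Finset.sum_congr rfl (fun k hk => by rw [e1 k hk] :
                ∀ k ∈ Finset.range m, y k ^ 2 = ‖iteratedFDeriv ℝ k v z‖ ^ 2)] at this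
            simpa using this
          calc _ ≤ (C₀ * (∑ k ∈ Finset.range m, ‖iteratedFDeriv ℝ k v z‖ + Q z)) ^ 2 := by
                gcongr
            _ = C₀ ^ 2 * (∑ k ∈ Finset.range m, ‖iteratedFDeriv ℝ k v z‖ + Q z) ^ 2 := by ring
            _ ≤ C₀ ^ 2 * ((m + 1) *
                (∑ k ∈ Finset.range m, ‖iteratedFDeriv ℝ k v z‖ ^ 2 + Q z ^ 2)) := by gcongr
            _ = _ := by ring
        -- The top order weight is small compared with the weight natural for order `k < m`: one
        -- spare factor `ρ` gives `δ`, the others are at most 1.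
        have hlow : ∀ k ∈ Finset.range m, ρ z ^ (4 * m) ≤ δ * ρ z ^ (4 * k) := by
          intro k hk
          have hk' := Finset.mem_range.1 hk
          rw [show 4 * m = 4 * k + (4 * (m - k) - 1) + 1 by omega, pow_succ, pow_add]
          have h5 : ρ z ^ (4 * (m - k) - 1) ≤ 1 := pow_le_one₀ hr0 hr1
          calc _ ≤ ρ z ^ (4 * k) * 1 * δ := by gcongr
            _ = _ := by ring
        set w := h z * sqWeight b s (ρ z) with hw
        have hw00 : 0 ≤ w := mul_nonneg (H.cutoff_nonneg z) (sqWeight_nonneg b s hr0)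
        calc h z * (sqWeight b s (ρ z) * ρ z ^ (4 * m)) * ‖iteratedFDeriv ℝ m v z‖ ^ 2
            ≤ h z * (sqWeight b s (ρ z) * ρ z ^ (4 * m)) *
              (C₁ * (∑ k ∈ Finset.range m, ‖iteratedFDeriv ℝ k v z‖ ^ 2 + Q z ^ 2)) :=
              mul_le_mul_of_nonneg_left h2 (hw0 z hz _)
          _ = C₁ * w * (∑ k ∈ Finset.range m, ρ z ^ (4 * m) * ‖iteratedFDeriv ℝ k v z‖ ^ 2) +
              C₁ * (h z * (sqWeight b s (ρ z) * ρ z ^ (4 * m)) * Q z ^ 2) := by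
              rw [← Finset.mul_sum, hw]; ring
          _ ≤ C₁ * w * (∑ k ∈ Finset.range m, δ * ρ z ^ (4 * k) * ‖iteratedFDeriv ℝ k v z‖ ^ 2) +
              C₁ * (h z * (sqWeight b s (ρ z) * ρ z ^ (4 * m)) * Q z ^ 2) := by
              have : ∑ k ∈ Finset.range m, ρ z ^ (4 * m) * ‖iteratedFDeriv ℝ k v z‖ ^ 2 ≤
                  ∑ k ∈ Finset.range m, δ * ρ z ^ (4 * k) * ‖iteratedFDeriv ℝ k v z‖ ^ 2 :=
                Finset.sum_le_sum fun k hk =>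
                  mul_le_mul_of_nonneg_right (hlow k hk) (by positivity)
              gcongr
          _ = _ := by
              congr 1
              simp only [hS, Finset.mul_sum]
              refine Finset.sum_congr rfl fun k _ => ?_
              rw [hw]; ring
      · rcases hzero m z hz with h | h <;> simp [h]
    calc ENNReal.ofReal (I m) = _ := hofI m (4 * m)
      _ ≤ ∫⁻ z, (ENNReal.ofReal (S z) + ENNReal.ofReal C₁ *
        ENNReal.ofReal (h z * (sqWeight b s (ρ z) * ρ z ^ (4 * m)) * Q z ^ 2)) ∂μ :=
          lintegral_mono hpt
      _ = ∫⁻ z, ENNReal.ofReal (S z) ∂μ + ∫⁻ z, ENNReal.ofReal C₁ *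
        ENNReal.ofReal (h z * (sqWeight b s (ρ z) * ρ z ^ (4 * m)) * Q z ^ 2) ∂μ :=
          lintegral_add_left' hSi.aemeasurable.ennreal_ofReal _
      _ = ENNReal.ofReal (∫ z, S z ∂μ) + ENNReal.ofReal C₁ * J := by
          rw [lintegral_const_mul' _ _ ENNReal.ofReal_ne_top,
            ofReal_integral_eq_lintegral_ofReal hSi (Filter.Eventually.of_forall hS0)]
      _ ≤ ENNReal.ofReal (I m / 2) + ENNReal.ofReal C₁ * J := by
          gcongr
          rw [integral_const_mul, integral_finsetSum _ (fun k _ => hint k (4 * k))]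
          calc C₁ * δ * ∑ k ∈ Finset.range m, I k
              ≤ C₁ * δ * ∑ k ∈ Finset.range m, B ^ m * I m := by
                gcongr with k hk
                exact hpow' k (Finset.mem_range.1 hk).le
            _ = (C₁ * m * B ^ m * δ) * I m := by
                rw [Finset.sum_const, Finset.card_range, nsmul_eq_mul]; ring
            _ ≤ 1 / 2 * I m := mul_le_mul_of_nonneg_right hδC (hI0 m)
            _ = I m / 2 := by ring
  -- Absorption is legitimate because `I m` is a finite real number, whatever `J` is.
  have hfin : ENNReal.ofReal (I m / 2) ≤ ENNReal.ofReal C₁ * J := by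
    have h1 : ENNReal.ofReal (I m) = ENNReal.ofReal (I m / 2) + ENNReal.ofReal (I m / 2) := by
      rw [← ENNReal.ofReal_add (by linarith [hI0 m]) (by linarith [hI0 m])]
      congr 1; ring
    rw [h1] at habs
    exact (ENNReal.add_le_add_iff_left ENNReal.ofReal_ne_top).1 habs
  have e0 : ∫⁻ z, ENNReal.ofReal (h z * sqWeight b s (ρ z) * ‖v z‖ ^ 2) ∂μ =
      ENNReal.ofReal (I 0) := by
    rw [hI]
    simp only
    rw [hofI 0]
    simp
  rw [e0]
  calc ENNReal.ofReal (I 0) ≤ ENNReal.ofReal (2 * B ^ m * (I m / 2)) := by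
        refine ENNReal.ofReal_le_ofReal ((hpow' 0 (Nat.zero_le _)).trans (le_of_eq ?_))
        ring
    _ = ENNReal.ofReal (2 * B ^ m) * ENNReal.ofReal (I m / 2) :=
        ENNReal.ofReal_mul (by positivity)
    _ ≤ ENNReal.ofReal (2 * B ^ m) * (ENNReal.ofReal C₁ * J) := by gcongr
    _ = _ := by
        rw [← mul_assoc, ← ENNReal.ofReal_mul (by positivity)]
        congr 2; ring

end FlatAPI

/-! ### Tubes at a boundary point and cut-off functions adapted to them. -/

section Tube

variable {E : Type*} [NormedAddCommGroup E] [NormedSpace ℝ E]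

/-- A cut-off function that is constant in the direction `e` away from its caps. -/
theorem exists_tube_cutoff [FiniteDimensional ℝ E] (p e : E) (ℓ : E →L[ℝ] ℝ) (he : ℓ e = 1)
    {R κ : ℝ} (hR : 0 < R) (hκ : 0 < κ) :
    ∃ h : E → ℝ, ContDiff ℝ ∞ h ∧ (∀ z, 0 ≤ h z) ∧ (∀ z, h z ≤ 1) ∧ h =ᶠ[𝓝 p] 1 ∧
      (∀ z ∈ tsupport h, ‖z - p - ℓ (z - p) • e‖ ≤ κ ∧ |ℓ (z - p)| ≤ 2 * R) ∧
      ∀ z, |ℓ (z - p)| < R → fderiv ℝ h z e = 0 := by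
  let χ : ContDiffBump (0 : E) := ⟨κ / 2, κ, by positivity, by linarith⟩
  let θ : ContDiffBump (0 : ℝ) := ⟨R, 2 * R, hR, by linarith⟩
  -- The projection along `e` onto the kernel of `ℓ`, recentred at `p`. Since `ℓ e = 1` it does not
  -- see translations along `e`, so only the factor `θ` varies in that direction, and `θ = 1` for
  -- `|ℓ (z - p)| < R`.
  set q : E → E := fun z => z - p - ℓ (z - p) • e with hq
  have hqc : ContDiff ℝ ∞ q := by fun_prop
  have hlc : ContDiff ℝ ∞ fun z => ℓ (z - p) := by fun_prop
  set h : E → ℝ := fun z => χ (q z) * θ (ℓ (z - p)) with hh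
  refine ⟨h, (χ.contDiff.comp hqc).mul (θ.contDiff.comp hlc),
    fun z => mul_nonneg χ.nonneg θ.nonneg, fun z => mul_le_one₀ χ.le_one θ.nonneg θ.le_one,
    ?_, ?_, ?_⟩
  · have h1 : ∀ᶠ z in 𝓝 p, χ (q z) = 1 := by
      have : Filter.Tendsto q (𝓝 p) (𝓝 0) := by simpa [hq] using hqc.continuous.tendsto p
      exact this.eventually χ.eventuallyEq_one
    have h2 : ∀ᶠ z in 𝓝 p, θ (ℓ (z - p)) = 1 := by
      have : Filter.Tendsto (fun z => ℓ (z - p)) (𝓝 p) (𝓝 0) := by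
        simpa using hlc.continuous.tendsto p
      exact this.eventually θ.eventuallyEq_one
    filter_upwards [h1, h2] with z hz1 hz2
    simp only [hh, hz1, hz2, mul_one, Pi.one_apply]
  · have hcl : IsClosed {z : E | ‖q z‖ ≤ κ ∧ |ℓ (z - p)| ≤ 2 * R} :=
      (isClosed_le hqc.continuous.norm continuous_const).inter
        (isClosed_le hlc.continuous.abs continuous_const)
    have : tsupport h ⊆ {z : E | ‖q z‖ ≤ κ ∧ |ℓ (z - p)| ≤ 2 * R} := by
      refine closure_minimal (fun z hz => ?_) hcl
      have h1 : χ (q z) ≠ 0 := left_ne_zero_of_mul hz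
      have h2 : θ (ℓ (z - p)) ≠ 0 := right_ne_zero_of_mul hz
      have h3 : q z ∈ Metric.ball (0 : E) κ := by rw [← χ.support_eq]; exact h1
      have h4 : ℓ (z - p) ∈ Metric.ball (0 : ℝ) (2 * R) := by rw [← θ.support_eq]; exact h2
      rw [mem_ball_zero_iff] at h3 h4
      exact ⟨h3.le, h4.le⟩
    exact fun z hz => this hz
  · intro z hz
    have h1 : h =ᶠ[𝓝 z] fun z => χ (q z) := by
      have : ∀ᶠ w in 𝓝 z, ℓ (w - p) ∈ Metric.ball (0 : ℝ) R :=
        hlc.continuous.continuousAt.eventually (Metric.isOpen_ball.mem_nhds (by simpa using hz))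
      filter_upwards [this] with w hw
      simp only [hh, θ.one_of_mem_closedBall (Metric.ball_subset_closedBall hw), mul_one]
    rw [h1.fderiv_eq]
    have h2 : HasFDerivAt q (ContinuousLinearMap.id ℝ E - ℓ.smulRight e) z := by
      have a1 : HasFDerivAt (fun z : E => z - p) (ContinuousLinearMap.id ℝ E) z :=
        (hasFDerivAt_id z).sub_const p
      have a2 := (ℓ.hasFDerivAt.comp z a1).smul_const e
      exact a1.sub a2
    have h3 : DifferentiableAt ℝ (fun y => χ y) (q z) :=
      (χ.contDiff (n := 1)).differentiable one_ne_zero _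
    have h4 := (h3.hasFDerivAt.comp z h2).fderiv
    have h5 : (fun z => χ (q z)) = (fun y => χ y) ∘ q := rfl
    rw [h5, h4]
    simp [he]

/-- A direction along which both the function cutting out the domain and a defining function of
its boundary increase. -/
theorem exists_transversal {U : Set E} {p : E} {r ρ : E → ℝ} {ℓ L : E →L[ℝ] ℝ}
    (hr : HasFDerivAt r ℓ p) (hr0 : r p = 0) (hℓ : ℓ ≠ 0)
    (hU : ∀ᶠ z in 𝓝 p, z ∈ U ↔ 0 < r z) (hρ : HasFDerivWithinAt ρ L (closure U) p) (hL : L ≠ 0)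
    (hρ0 : ρ p = 0) (hpos : ∀ᶠ z in 𝓝 p, z ∈ U → 0 < ρ z) : ∃ e, ℓ e = 1 ∧ 0 < L e := by
  -- A ray from `p` with `ℓ w > 0` enters `U`, where `ρ` is positive, so `ρ` cannot decrease to
  -- first order along it.
  have key : ∀ w, 0 < ℓ w → 0 ≤ L w := by
    intro w hw
    by_contra! hneg
    have hline : Filter.Tendsto (fun t : ℝ => p + t • w) (𝓝[>] 0) (𝓝 p) := by
      have : Continuous fun t : ℝ => p + t • w := by fun_prop
      simpa using (this.tendsto 0).mono_left nhdsWithin_le_nhds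
    have hd : HasDerivAt (fun t : ℝ => r (p + t • w)) (ℓ w) 0 := hr.hasLineDerivAt w
    have hw0 : w ≠ 0 := by rintro rfl; simp at hw
    have hwn : 0 < ‖w‖ := norm_pos_iff.2 hw0
    have h1 := hr.isLittleO.def (c := ℓ w / (2 * ‖w‖)) (by positivity)
    have hin : ∀ᶠ t in 𝓝[>] (0 : ℝ), p + t • w ∈ U := by
      filter_upwards [hline.eventually h1, hline.eventually hU, self_mem_nhdsWithin] with t h1 h2 h3
      have ht : 0 < t := h3
      refine h2.2 ?_
      simp only [add_sub_cancel_left, hr0, sub_zero, map_smul, smul_eq_mul, norm_smul,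
        Real.norm_eq_abs, abs_of_pos ht] at h1
      have h4 := (abs_le.1 h1).1
      have h5 : ℓ w / (2 * ‖w‖) * (t * ‖w‖) = t * ℓ w / 2 := by field_simp
      rw [h5] at h4
      have : 0 < t * ℓ w := mul_pos ht hw
      linarith
    have h2 := hρ.isLittleO.def (c := -L w / (2 * ‖w‖)) (by
      have : 0 < -L w := by linarith
      positivity)
    have hline' : Filter.Tendsto (fun t : ℝ => p + t • w) (𝓝[>] 0) (𝓝[closure U] p) :=
      tendsto_nhdsWithin_iff.2 ⟨hline, hin.mono fun t ht => subset_closure ht⟩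
    obtain ⟨t, ha, hb, hc, ht⟩ := ((hline'.eventually h2).and
      (hin.and ((hline.eventually hpos).and self_mem_nhdsWithin))).exists
    have ht' : 0 < t := ht
    simp only [add_sub_cancel_left, hρ0, sub_zero, map_smul, smul_eq_mul, norm_smul,
      Real.norm_eq_abs, abs_of_pos ht'] at ha
    have h4 := (abs_le.1 ha).2
    have h5 : -L w / (2 * ‖w‖) * (t * ‖w‖) = -(t * L w) / 2 := by field_simp
    rw [h5] at h4
    have h6 := hc hb
    have : t * L w < 0 := mul_neg_of_pos_of_neg ht' hneg
    linarith
  obtain ⟨v, hv⟩ : ∃ v, ℓ v ≠ 0 := by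
    by_contra! h; exact hℓ (ContinuousLinearMap.ext h)
  obtain ⟨w, hw⟩ : ∃ w, L w ≠ 0 := by
    by_contra! h; exact hL (ContinuousLinearMap.ext h)
  set e₀ := (ℓ v)⁻¹ • v with he₀
  have he₀1 : ℓ e₀ = 1 := by simp [he₀, hv]
  set w₀ := (L w)⁻¹ • w with hw₀
  have hw₀1 : L w₀ = 1 := by simp [hw₀, hw]
  set δ : ℝ := 1 / (2 * (|ℓ w₀| + 1)) with hδ
  have hδ0 : 0 < δ := by positivity
  have hδ1 : δ * |ℓ w₀| ≤ 1 / 2 := by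
    rw [hδ, div_mul_eq_mul_div, one_mul, div_le_iff₀ (by positivity)]; linarith
  -- So far only `L e₀ ≥ 0`. A small multiple of `w₀`, with `L w₀ = 1`, makes it strictly positive,
  -- while `δ |ℓ w₀| ≤ 1/2` keeps `ℓ e₁` positive.
  set e₁ := e₀ + δ • w₀ with he₁
  have h1 : 0 < ℓ e₁ := by
    have := neg_abs_le (ℓ w₀)
    simp only [he₁, map_add, map_smul, he₀1, smul_eq_mul]
    nlinarith
  have h2 : 0 < L e₁ := by
    have := key e₀ (by rw [he₀1]; norm_num)
    simp only [he₁, map_add, map_smul, hw₀1, smul_eq_mul]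
    linarith
  exact ⟨(ℓ e₁)⁻¹ • e₁, by simp [h1.ne'], by simp only [map_smul, smul_eq_mul]; positivity⟩

/-- Near a boundary point of a domain there are a direction and cut-off functions adapted to a
given defining function. -/
theorem exists_tube [FiniteDimensional ℝ E] {U : Set E} (hUo : IsOpen U) {p : E} {r ρ : E → ℝ}
    {ℓ : E →L[ℝ] ℝ} (hr : HasFDerivAt r ℓ p) (hr0 : r p = 0) (hℓ : ℓ ≠ 0)
    (hU : ∀ᶠ z in 𝓝 p, z ∈ U ↔ 0 < r z) (hp : p ∈ closure U)
    (hρ : ContDiffWithinAt ℝ 1 ρ (closure U) p)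
    (hρd : fderivWithin ℝ ρ (closure U) p ≠ 0) (hρ0 : ρ p = 0)
    (hpos : ∀ᶠ z in 𝓝 p, z ∈ U → 0 < ρ z) {N : Set E} (hN : N ∈ 𝓝 p) :
    ∃ (e : E) (c ε : ℝ) (h : E → ℝ), 0 < c ∧ 0 < ε ∧ ContDiff ℝ ∞ h ∧ (∀ z, 0 ≤ h z) ∧
      (∀ z, h z ≤ 1) ∧ h =ᶠ[𝓝 p] 1 ∧ IsCompact (tsupport h) ∧ tsupport h ⊆ N ∧
      (∀ z ∈ U ∩ tsupport h, c ≤ fderiv ℝ ρ z e) ∧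
      ∀ z ∈ U ∩ tsupport h, ρ z < ε → fderiv ℝ h z e = 0 := by
  obtain ⟨u, hu, -, ρ', hρ', hρ'c⟩ := (contDiffWithinAt_succ_iff_hasFDerivWithinAt
    (n := 0) (by simp)).1 (by simpa using hρ)
  rw [insert_eq_of_mem hp] at hu
  have hpu : p ∈ u := mem_of_mem_nhdsWithin hp hu
  set L := ρ' p with hLdef
  have hρL : HasFDerivWithinAt ρ L (closure U) p := (hρ' p hpu).mono_of_mem_nhdsWithin hu
  -- Derivatives within the closure are not known to be unique at this point. But `fderivWithin` is
  -- 0 as soon as 0 is a derivative, so its nonvanishing excludes `L = 0`.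
  have hL : L ≠ 0 := by
    intro h
    rw [h] at hρL
    exact hρd (by rw [fderivWithin, if_pos hρL])
  obtain ⟨e, he, hLe⟩ := exists_transversal hr hr0 hℓ hU hρL hL hρ0 hpos
  obtain ⟨A, hA, hAu⟩ := mem_nhdsWithin_iff_exists_mem_nhds_inter.1 hu
  have hcont : ContinuousWithinAt ρ' u p := hρ'c.continuousWithinAt
  have hce : ∀ᶠ z in 𝓝[u] p, L e / 2 < ρ' z e :=
    (hcont.clm_apply continuousWithinAt_const).eventually (lt_mem_nhds (by linarith))
  obtain ⟨A₂, hA₂, hA₂u⟩ := mem_nhdsWithin_iff_exists_mem_nhds_inter.1 hce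
  -- The cut-off will be supported in the ball of radius `R (1 + 2‖e‖)`, where the first order
  -- errors of `r` and `ρ` are then at most `R / 2` and `R * L e / 4`.
  set δ : ℝ := min (1 / 2) (L e / 4) / (1 + 2 * ‖e‖) with hδ
  have hδ0 : 0 < δ := by positivity
  have hδe : δ * (1 + 2 * ‖e‖) = min (1 / 2) (L e / 4) := by rw [hδ]; field_simp
  have hr1 := hr.isLittleO.def hδ0
  obtain ⟨A₃, hA₃, hA₃u⟩ := mem_nhdsWithin_iff_exists_mem_nhds_inter.1
    (hρL.isLittleO.def hδ0)
  have hall := Filter.inter_mem (Filter.inter_mem (Filter.inter_mem (interior_mem_nhds.2 hA) hA₂)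
    (Filter.inter_mem hA₃ hN)) (Filter.inter_mem hr1 hU)
  obtain ⟨η, hη, hηsub⟩ := Metric.nhds_basis_closedBall.mem_iff.1 hall
  set R : ℝ := η / (1 + 2 * ‖e‖) with hR
  have hR0 : 0 < R := by positivity
  have hRη : R * (1 + 2 * ‖e‖) = η := by rw [hR]; field_simp
  -- The box is thin across `e`: its transversal width `κ R` changes `ρ` to first order by at most
  -- `R * L e / 4`.
  set κ : ℝ := min 1 (L e / (4 * (‖L‖ + 1))) with hκ
  have hκ0 : 0 < κ := by positivity
  have hκL : ‖L‖ * κ ≤ L e / 4 := by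
    calc ‖L‖ * κ ≤ ‖L‖ * (L e / (4 * (‖L‖ + 1))) := by gcongr; exact min_le_right _ _
      _ ≤ L e / 4 := by
        rw [mul_div_assoc', div_le_div_iff₀ (by positivity) (by norm_num)]
        nlinarith
  obtain ⟨h, hhc, hh0, hh1, hhp, hhs, hhd⟩ := exists_tube_cutoff p e ℓ he hR0
    (mul_pos hκ0 hR0)
  have hnorm : ∀ z ∈ tsupport h, ‖z - p‖ ≤ R * (1 + 2 * ‖e‖) := by
    intro z hz
    obtain ⟨h1, h2⟩ := hhs z hz
    calc ‖z - p‖ = ‖(z - p - ℓ (z - p) • e) + ℓ (z - p) • e‖ := by congr 1; abel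
      _ ≤ ‖z - p - ℓ (z - p) • e‖ + ‖ℓ (z - p) • e‖ := norm_add_le _ _
      _ ≤ 1 * R + 2 * R * ‖e‖ := by
        rw [norm_smul, Real.norm_eq_abs]
        gcongr
        exact h1.trans (by gcongr; exact min_le_left _ _)
      _ = _ := by ring
  have hsup : tsupport h ⊆ Metric.closedBall p η := fun z hz => by
    rw [mem_closedBall_iff_norm, ← hRη]; exact hnorm z hz
  refine ⟨e, L e / 2, R * (L e / 2), h, by positivity, by positivity, hhc, hh0, hh1, hhp,
    (isCompact_closedBall p η).of_isClosed_subset (isClosed_tsupport h) hsup,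
    fun z hz => (hηsub (hsup hz)).1.2.2, ?_, ?_⟩
  · rintro z ⟨hzU, hz⟩
    obtain ⟨⟨⟨hzA, hzA₂⟩, -⟩, -⟩ := hηsub (hsup hz)
    have hunhds : u ∈ 𝓝 z := by
      filter_upwards [hUo.mem_nhds hzU, isOpen_interior.mem_nhds hzA] with w h1 h2
      exact hAu ⟨interior_subset h2, subset_closure h1⟩
    have h1 := ((hρ' z (mem_of_mem_nhds hunhds)).hasFDerivAt hunhds).fderiv
    rw [h1]
    exact le_of_lt (hA₂u ⟨hzA₂, mem_of_mem_nhds hunhds⟩)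
  · rintro z ⟨hzU, hz⟩ hρz
    obtain ⟨⟨-, ⟨hzA₃, -⟩⟩, ⟨hzr, hzU'⟩⟩ := hηsub (hsup hz)
    obtain ⟨h1, h2⟩ := hhs z hz
    have h3 := hnorm z hz
    have hδz : δ * ‖z - p‖ ≤ R * min (1 / 2) (L e / 4) := by
      calc _ ≤ δ * (R * (1 + 2 * ‖e‖)) := by gcongr
        _ = R * (δ * (1 + 2 * ‖e‖)) := by ring
        _ = _ := by rw [hδe]
    have hm1 : R * min (1 / 2) (L e / 4) ≤ R * (1 / 2) := by gcongr; exact min_le_left _ _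
    have hm2 : R * min (1 / 2) (L e / 4) ≤ R * (L e / 4) := by gcongr; exact min_le_right _ _
    -- The cut-off varies along `e` only in its caps. The lower cap has `r < 0`, so it lies outside
    -- `U`; in the part of the upper cap inside `U`, `ρ ≥ R * L e - 2 * (R * L e / 4)`, which is the
    -- chosen `ε`.
    refine hhd z (abs_lt.2 ⟨?_, ?_⟩)
    · by_contra! hneg
      have h4 : |r z - r p - ℓ (z - p)| ≤ δ * ‖z - p‖ := hzr
      rw [hr0] at h4
      have h5 := (abs_le.1 h4).2
      have h6 := hzU'.1 hzU
      linarith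
    · by_contra! hge
      have h4 : |ρ z - ρ p - L (z - p)| ≤ δ * ‖z - p‖ := hA₃u ⟨hzA₃, subset_closure hzU⟩
      rw [hρ0] at h4
      have h5 := (abs_le.1 h4).1
      have h7 : L (z - p) = L (z - p - ℓ (z - p) • e) + ℓ (z - p) * L e := by
        rw [map_sub L (z - p), map_smul, smul_eq_mul]; ring
      have h8 : |L (z - p - ℓ (z - p) • e)| ≤ ‖L‖ * (κ * R) :=
        (L.le_opNorm _).trans (by gcongr)
      have h9 := (abs_le.1 h8).1
      have h10 : R * L e ≤ ℓ (z - p) * L e := by gcongr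
      have h11 : ‖L‖ * (κ * R) ≤ L e / 4 * R := by
        calc _ = ‖L‖ * κ * R := by ring
          _ ≤ _ := by gcongr
      nlinarith

end Tube

/-! ### Sections and differentials in a chart and a trivialization. -/

section Coordinates

variable {n : ℕ} {M : Type*} [TopologicalSpace M] [ChartedSpace (EuclideanSpace ℝ (Fin n)) M]
  {F : Type*} [NormedAddCommGroup F] [NormedSpace ℝ F]
  {V : M → Type*} [TopologicalSpace (TotalSpace F V)]
  [∀ x, AddCommGroup (V x)] [∀ x, Module ℝ (V x)] [∀ x, TopologicalSpace (V x)]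
  [FiberBundle F V]

local notation "Eu" => EuclideanSpace ℝ (Fin n)

variable (n) in
/-- The expression of a section in the chart and the trivialization at `p`. -/
def coordRep (F : Type*) [NormedAddCommGroup F] [NormedSpace ℝ F]
    {V : M → Type*} [TopologicalSpace (TotalSpace F V)] [∀ x, TopologicalSpace (V x)]
    [FiberBundle F V] (p : M) (u : ∀ x, V x) (z : EuclideanSpace ℝ (Fin n)) : F :=
  (trivializationAt F V p ⟨(chartAt (EuclideanSpace ℝ (Fin n)) p).symm z,
    u ((chartAt (EuclideanSpace ℝ (Fin n)) p).symm z)⟩).2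

variable (n) in
/-- The domain in `ℝⁿ` on which the chart and the trivialization at `p` are both defined. -/
def coordDomain (F : Type*) [NormedAddCommGroup F] [NormedSpace ℝ F]
    (V : M → Type*) [TopologicalSpace (TotalSpace F V)] [∀ x, TopologicalSpace (V x)]
    [FiberBundle F V] (p : M) : Set (EuclideanSpace ℝ (Fin n)) :=
  (chartAt (EuclideanSpace ℝ (Fin n)) p).target ∩
    (chartAt (EuclideanSpace ℝ (Fin n)) p).symm ⁻¹' (trivializationAt F V p).baseSet

theorem isOpen_coordDomain (p : M) : IsOpen (coordDomain n F V p) :=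
  (chartAt Eu p).isOpen_inter_preimage_symm (trivializationAt F V p).open_baseSet

theorem mem_coordDomain (p : M) : chartAt Eu p p ∈ coordDomain n F V p :=
  ⟨mem_chart_target _ p, by
    simp only [mem_preimage, (chartAt Eu p).left_inv (mem_chart_source _ p)]
    exact mem_baseSet_trivializationAt F V p⟩

theorem coordDomain_mem_nhds (p : M) : coordDomain n F V p ∈ 𝓝 (chartAt Eu p p) :=
  (isOpen_coordDomain p).mem_nhds (mem_coordDomain p)

theorem preimage_mem_nhds_of_mem {p x : M} (hx : x ∈ (chartAt Eu p).source) {N : Set Eu}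
    (hN : N ∈ 𝓝 (chartAt Eu p x)) : chartAt Eu p ⁻¹' N ∈ 𝓝 x :=
  ((chartAt Eu p).continuousAt hx).preimage_mem_nhds hN

theorem eventually_symm_of_eventually {p : M} {z : Eu} (hz : z ∈ (chartAt Eu p).target)
    {P : M → Prop} (h : ∀ᶠ x in 𝓝 ((chartAt Eu p).symm z), P x) :
    ∀ᶠ w in 𝓝 z, P ((chartAt Eu p).symm w) :=
  ((chartAt Eu p).continuousAt_symm hz).eventually h

section

variable [VectorBundle ℝ F V]

/-- Formulated within an arbitrary set, so that it serves in Ω and up to the boundary alike. -/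
theorem contDiffWithinAt_coordRep_iff [IsManifold (𝓡 n) ∞ M] [ContMDiffVectorBundle ∞ F V (𝓡 n)]
    {k : ℕ∞} {p : M} {u : ∀ x, V x} {s : Set M} {z : Eu} (hz : z ∈ coordDomain n F V p) :
    ContMDiffWithinAt (𝓡 n) ((𝓡 n).prod 𝓘(ℝ, F)) k (fun x => TotalSpace.mk' F x (u x)) s
      ((chartAt Eu p).symm z) ↔
    ContDiffWithinAt ℝ k (coordRep n F p u) ((chartAt Eu p).symm ⁻¹' s) z := by
  have : ContMDiffVectorBundle k F V (𝓡 n) := .of_le (n := ∞) (by exact_mod_cast le_top)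
  have : IsManifold (𝓡 n) k M := .of_le (n := ∞) (by exact_mod_cast le_top)
  rw [(trivializationAt F V p).contMDiffWithinAt_section s hz.2]
  have hx : (chartAt Eu p).symm z ∈ (chartAt Eu p).source := (chartAt Eu p).map_target hz.1
  rw [contMDiffWithinAt_iff_source_of_mem_source (x := p) (by simpa using hx)]
  simp only [contMDiffWithinAt_iff_contDiffWithinAt, mfld_simps, (chartAt Eu p).right_inv hz.1]
  rfl

theorem contDiffOn_coordRep [IsManifold (𝓡 n) ∞ M] [ContMDiffVectorBundle ∞ F V (𝓡 n)]
    {k : ℕ∞} (p : M) {u : ∀ x, V x} {s : Set M}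
    (hu : SectionOn (n := n) F k u s) :
    ContDiffOn ℝ k (coordRep n F p u) (coordDomain n F V p ∩ (chartAt Eu p).symm ⁻¹' s) :=
  fun z hz => ((contDiffWithinAt_coordRep_iff hz.1).1 (hu _ hz.2)).mono inter_subset_right

theorem mdifferentiableAt_section_iff_coordRep [IsManifold (𝓡 n) 1 M]
    [ContMDiffVectorBundle 1 F V (𝓡 n)]
    {p : M} {u : ∀ x, V x} {z : Eu} (hz : z ∈ coordDomain n F V p) :
    MDifferentiableAt (𝓡 n) ((𝓡 n).prod 𝓘(ℝ, F)) (fun x => TotalSpace.mk' F x (u x))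
      ((chartAt Eu p).symm z) ↔
    DifferentiableAt ℝ (coordRep n F p u) z := by
  rw [(trivializationAt F V p).mdifferentiableAt_section_iff (IB := 𝓡 n) u hz.2]
  have hx : (chartAt Eu p).symm z ∈ (chartAt Eu p).source := (chartAt Eu p).map_target hz.1
  rw [mdifferentiableAt_iff_source_of_mem_source (x := p) (by simpa using hx)]
  simp only [mdifferentiableWithinAt_iff_differentiableWithinAt, mfld_simps,
    (chartAt Eu p).right_inv hz.1, differentiableWithinAt_univ]
  rfl

end

/-- The derivative of a function at a point of a chart domain. -/
theorem mvfderiv_eq_fderiv_coord [IsManifold (𝓡 n) ∞ M] {Y : Type*} [NormedAddCommGroup Y]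
    [NormedSpace ℝ Y] {g : M → Y} {p : M} {z : Eu} (hz : z ∈ (chartAt Eu p).target)
    (hg : MDifferentiableAt (𝓡 n) 𝓘(ℝ, Y) g ((chartAt Eu p).symm z))
    (X : TangentSpace (𝓡 n) ((chartAt Eu p).symm z)) :
    mvfderiv (𝓡 n) g ((chartAt Eu p).symm z) X =
      fderiv ℝ (g ∘ (chartAt Eu p).symm) z
        ((trivializationAt Eu (TangentSpace (𝓡 n)) p).continuousLinearMapAt ℝ
          ((chartAt Eu p).symm z) X) := by
  have : IsManifold (𝓡 n) 1 M := .of_le (n := ∞) (by simp)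
  revert X
  set c := chartAt Eu p
  intro X
  have hx : c.symm z ∈ c.source := c.map_target hz
  rw [TangentBundle.continuousLinearMapAt_trivializationAt (by exact hx)]
  have h1 : MDifferentiableAt (𝓡 n) 𝓘(ℝ, Eu) (extChartAt (𝓡 n) p) (c.symm z) :=
    mdifferentiableAt_extChartAt hx
  have h2 : MDifferentiableAt 𝓘(ℝ, Eu) 𝓘(ℝ, Y) (g ∘ c.symm) (extChartAt (𝓡 n) p (c.symm z)) := by
    have e : extChartAt (𝓡 n) p (c.symm z) = z := by simp [c.right_inv hz, c]
    rw [e]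
    have h3 : MDifferentiableAt 𝓘(ℝ, Eu) (𝓡 n) c.symm z :=
      ((contMDiffOn_chart_symm (I := 𝓡 n) (n := 1) (x := p)).contMDiffAt
        (c.open_target.mem_nhds hz)).mdifferentiableAt one_ne_zero
    exact hg.comp z h3
  have h4 := mfderiv_comp (c.symm z) h2 h1
  have h5 : (g ∘ c.symm) ∘ extChartAt (𝓡 n) p =ᶠ[𝓝 (c.symm z)] g := by
    filter_upwards [c.open_source.mem_nhds hx] with y hy
    simp [c.left_inv hy, c]
  rw [h5.mfderiv_eq] at h4
  have e : extChartAt (𝓡 n) p (c.symm z) = z := by simp [c.right_inv hz, c]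
  rw [mvfderiv]
  have h6 := congrArg (fun T => T X) h4
  rw [e] at h6
  rw [mfderiv_eq_fderiv] at h6
  exact h6

end Coordinates

/-! ### Fibrewise coordinates and global sections with prescribed local expression. -/

section Frames

variable {n : ℕ} {M : Type*} [TopologicalSpace M] [ChartedSpace (EuclideanSpace ℝ (Fin n)) M]
  {F : Type*} [NormedAddCommGroup F] [NormedSpace ℝ F]
  {V : M → Type*} [TopologicalSpace (TotalSpace F V)]
  [∀ x, AddCommGroup (V x)] [∀ x, Module ℝ (V x)] [∀ x, TopologicalSpace (V x)]
  [FiberBundle F V] [VectorBundle ℝ F V]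

local notation "Eu" => EuclideanSpace ℝ (Fin n)

/-- The trivialization at `p`, on the fibre at `x`. -/
abbrev fibreCoord (F : Type*) [NormedAddCommGroup F] [NormedSpace ℝ F]
    (V : M → Type*) [TopologicalSpace (TotalSpace F V)]
    [∀ x, AddCommGroup (V x)] [∀ x, Module ℝ (V x)] [∀ x, TopologicalSpace (V x)]
    [FiberBundle F V] [VectorBundle ℝ F V] (p x : M) : V x →L[ℝ] F :=
  (trivializationAt F V p).continuousLinearMapAt ℝ x

/-- The inverse of the trivialization at `p`, on the fibre at `x`. -/
abbrev fibreLift (F : Type*) [NormedAddCommGroup F] [NormedSpace ℝ F]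
    (V : M → Type*) [TopologicalSpace (TotalSpace F V)]
    [∀ x, AddCommGroup (V x)] [∀ x, Module ℝ (V x)] [∀ x, TopologicalSpace (V x)]
    [FiberBundle F V] [VectorBundle ℝ F V] (p x : M) : F →L[ℝ] V x :=
  (trivializationAt F V p).symmL ℝ x

theorem coordRep_eq {p : M} (u : ∀ x, V x) {z : Eu} (hz : z ∈ coordDomain n F V p) :
    coordRep n F p u z =
      fibreCoord F V p ((chartAt Eu p).symm z) (u ((chartAt Eu p).symm z)) := by
  simp only [coordRep, fibreCoord]
  exact (Trivialization.continuousLinearMapAt_apply_of_mem ℝ _ hz.2 _).symm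

theorem fibreCoord_fibreLift {p : M} {z : Eu} (hz : z ∈ coordDomain n F V p) (f : F) :
    fibreCoord F V p ((chartAt Eu p).symm z) (fibreLift F V p ((chartAt Eu p).symm z) f) = f :=
  (trivializationAt F V p).continuousLinearMapAt_symmL hz.2 f

theorem fibreLift_fibreCoord {p : M} {z : Eu} (hz : z ∈ coordDomain n F V p)
    (v : V ((chartAt Eu p).symm z)) :
    fibreLift F V p ((chartAt Eu p).symm z) (fibreCoord F V p ((chartAt Eu p).symm z) v) = v :=
  (trivializationAt F V p).symmL_continuousLinearMapAt hz.2 v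

theorem fibreCoord_injective {p : M} {z : Eu} (hz : z ∈ coordDomain n F V p) :
    Function.Injective (fibreCoord F V p ((chartAt Eu p).symm z)) :=
  Function.LeftInverse.injective (fibreLift_fibreCoord hz)

theorem coordDomain_tangent [IsManifold (𝓡 n) 1 M] (p : M) :
    coordDomain n Eu (fun x : M => TangentSpace (𝓡 n) x) p = (chartAt Eu p).target := by
  ext z
  refine ⟨fun h => h.1, fun h => ⟨h, ?_⟩⟩
  exact (chartAt Eu p).map_target h

/-- A smooth function of the coordinates is near the point the expression of a global smooth
section. -/
theorem exists_section_coordRep_eq [T2Space M] [IsManifold (𝓡 n) ∞ M]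
    [ContMDiffVectorBundle ∞ F V (𝓡 n)] (p : M)
    {a : Eu → F} {N : Set Eu} (hN : N ∈ 𝓝 (chartAt Eu p p)) (ha : ContDiffOn ℝ ∞ a N) :
    ∃ σ : ∀ x, V x, SectionOn (n := n) F ∞ σ univ ∧
      ∀ᶠ z in 𝓝 (chartAt Eu p p), coordRep n F p σ z = a z := by
  set c := chartAt Eu p
  set O : Set Eu := interior N ∩ coordDomain n F V p
  have hO : IsOpen O := isOpen_interior.inter (isOpen_coordDomain p)
  have hpO : c p ∈ O := ⟨mem_interior_iff_mem_nhds.2 hN, mem_coordDomain p⟩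
  set O' : Set M := c.source ∩ c ⁻¹' O
  have hO' : IsOpen O' := c.isOpen_inter_preimage hO
  have hpO' : O' ∈ 𝓝 p := hO'.mem_nhds ⟨mem_chart_source _ p, hpO⟩
  set τ : ∀ x, V x := fun x => fibreLift F V p x (a (c x))
  have hτ : ∀ z ∈ coordDomain n F V p, coordRep n F p τ z = a z := by
    intro z hz
    rw [coordRep_eq τ hz]
    simp only [τ]
    rw [fibreCoord_fibreLift hz, c.right_inv hz.1]
  have hτs : SectionOn (n := n) F ∞ τ O' := by
    intro x hx
    have e : c.symm (c x) = x := c.left_inv hx.1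
    have key := (contDiffWithinAt_coordRep_iff (k := ⊤) (p := p) (u := τ) (s := univ)
      (z := c x) hx.2.2).2 (by
        rw [preimage_univ, contDiffWithinAt_univ]
        refine ((ha.contDiffAt (mem_interior_iff_mem_nhds.1 hx.2.1))).congr_of_eventuallyEq ?_
        filter_upwards [(isOpen_coordDomain p).mem_nhds hx.2.2] with z hz using hτ z hz)
    rw [e] at key
    exact key.mono (subset_univ _)
  -- Smoothness of connections and of coefficients is tested on globally smooth sections, so the
  -- local section has to be cut off.
  obtain ⟨ψ, hψ⟩ := ((SmoothBumpFunction.nhds_basis_tsupport (I := 𝓡 n) p).mem_iff).1 hpO'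
  refine ⟨fun x => ψ x • τ x, ?_, ?_⟩
  · exact (ContMDiffOn.smul_section_of_tsupport (n := ∞) (ψ := ψ) ψ.contMDiff.contMDiffOn hO' hψ.2
      hτs).contMDiffOn
  · have h1 : ∀ᶠ z in 𝓝 (c p), (ψ : M → ℝ) (c.symm z) = 1 := by
      refine eventually_symm_of_eventually (P := fun x => ψ x = 1)
        (mem_chart_target Eu p) ?_
      rw [c.left_inv (mem_chart_source _ p)]
      exact ψ.eventuallyEq_one
    filter_upwards [h1, coordDomain_mem_nhds (n := n) (F := F) (V := V) p] with z h hz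
    rw [← hτ z hz, coordRep_eq (fun x => (ψ x : ℝ) • τ x) hz, coordRep_eq τ hz, h, one_smul]

end Frames

/-! ### The connection form of a smooth connection. -/

section Connection

variable {n : ℕ} {M : Type*} [TopologicalSpace M] [ChartedSpace (EuclideanSpace ℝ (Fin n)) M]
  [IsManifold (𝓡 n) ∞ M]
  {F : Type*} [NormedAddCommGroup F] [NormedSpace ℝ F]
  {V : M → Type*} [TopologicalSpace (TotalSpace F V)]
  [∀ x, AddCommGroup (V x)] [∀ x, Module ℝ (V x)] [∀ x, TopologicalSpace (V x)]
  [∀ x, IsTopologicalAddGroup (V x)] [∀ x, ContinuousSMul ℝ (V x)]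
  [FiberBundle F V] [VectorBundle ℝ F V]

local notation "Eu" => EuclideanSpace ℝ (Fin n)

/-- The Leibniz rule for an expansion in a local frame: it separates the derivative of the
components from the derivative of the frame. -/
theorem _root_.IsCovariantDerivativeOn.sum_smul [ContMDiffVectorBundle 1 F V (𝓡 n)]
    {cov : (Π x : M, V x) → (Π x : M, TangentSpace (𝓡 n) x →L[ℝ] V x)}
    (hcov : IsCovariantDerivativeOn F cov univ) {ι : Type*} (t : Finset ι) {g : ι → M → ℝ}
    {σ : ι → ∀ x, V x} {x : M}
    (hσ : ∀ i, MDifferentiableAt (𝓡 n) ((𝓡 n).prod 𝓘(ℝ, F))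
      (fun y => TotalSpace.mk' F y (σ i y)) x)
    (hg : ∀ i, MDifferentiableAt (𝓡 n) 𝓘(ℝ, ℝ) (g i) x) :
    MDifferentiableAt (𝓡 n) ((𝓡 n).prod 𝓘(ℝ, F))
      (fun y => TotalSpace.mk' F y (∑ i ∈ t, g i y • σ i y)) x ∧
    cov (fun y => ∑ i ∈ t, g i y • σ i y) x =
      ∑ i ∈ t, (g i x • cov (σ i) x + (mvfderiv (𝓡 n) (g i) x).smulRight (σ i x)) := by
  classical
  have hs : ∀ i, MDifferentiableAt (𝓡 n) ((𝓡 n).prod 𝓘(ℝ, F))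
      (fun y => TotalSpace.mk' F y (g i y • σ i y)) x := fun i =>
    (hg i).smul_section (hσ i)
  refine ⟨MDifferentiableAt.sum_section fun i _ => hs i, ?_⟩
  induction t using Finset.induction_on with
  | empty =>
    simp only [Finset.sum_empty]
    exact hcov.zero
  | insert a t ha ih =>
    have e : (fun y => ∑ i ∈ insert a t, g i y • σ i y) =
        (g a • σ a) + fun y => ∑ i ∈ t, g i y • σ i y := by
      funext y
      simp [Finset.sum_insert ha]
    have hadd := hcov.add (σ := g a • σ a) (σ' := fun y => ∑ i ∈ t, g i y • σ i y) (x := x) (hs a)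
      (MDifferentiableAt.sum_section fun i _ => hs i)
    rw [e, hadd, ih, hcov.leibniz (hσ a) (hg a), Finset.sum_insert ha]

theorem contDiffOn_smulRight {X Y Z : Type*} [NormedAddCommGroup X] [NormedSpace ℝ X]
    [NormedAddCommGroup Y] [NormedSpace ℝ Y] [NormedAddCommGroup Z] [NormedSpace ℝ Z] {k : ℕ∞ω}
    {h : X → Z} {s : Set X} (φ : Y →L[ℝ] ℝ) (hh : ContDiffOn ℝ k h s) :
    ContDiffOn ℝ k (fun z => φ.smulRight (h z)) s :=
  (ContinuousLinearMap.smulRightL ℝ Y Z φ).contDiff.comp_contDiffOn hh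

set_option maxHeartbeats 1000000 in
set_option synthInstance.maxHeartbeats 200000 in
/-- A smooth connection in the chart and the trivialization at `p`. -/
theorem exists_connectionForm [T2Space M] [FiniteDimensional ℝ F]
    [ContMDiffVectorBundle ∞ F V (𝓡 n)]
    {DV : CovariantDerivative (𝓡 n) F V}
    (hDV : CovariantDerivative.ContMDiffCovariantDerivative DV ∞) (p : M) :
    ∃ N : Set Eu, IsOpen N ∧ chartAt Eu p p ∈ N ∧ N ⊆ coordDomain n F V p ∧
      ∃ θ : Eu → F →L[ℝ] Eu →L[ℝ] F, ContDiffOn ℝ ∞ θ N ∧ ∀ z ∈ N, ∀ σ : ∀ x, V x,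
        DifferentiableAt ℝ (coordRep n F p σ) z →
        ∀ X : TangentSpace (𝓡 n) ((chartAt Eu p).symm z),
          fibreCoord F V p ((chartAt Eu p).symm z) (DV σ ((chartAt Eu p).symm z) X) =
            fderiv ℝ (coordRep n F p σ) z
              (fibreCoord Eu (TangentSpace (𝓡 n)) p ((chartAt Eu p).symm z) X) +
            θ z (coordRep n F p σ z)
              (fibreCoord Eu (TangentSpace (𝓡 n)) p ((chartAt Eu p).symm z) X) := by
  have : IsManifold (𝓡 n) 1 M := .of_le (n := ∞) (by simp)
  have : ContMDiffVectorBundle 1 F V (𝓡 n) := .of_le (n := ∞) (by simp)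
  set c := chartAt Eu p
  set b := Module.finBasis ℝ F
  have hex : ∀ a, ∃ σ : ∀ x, V x, SectionOn (n := n) F ∞ σ univ ∧
      ∀ᶠ z in 𝓝 (c p), coordRep n F p σ z = b a := fun a =>
    exists_section_coordRep_eq p Filter.univ_mem contDiffOn_const
  choose s hs hsb using hex
  have hall : ∀ᶠ z in 𝓝 (c p), ∀ a, coordRep n F p (s a) z = b a :=
    Filter.eventually_all.2 hsb
  obtain ⟨N₀, hN₀, hN₀o, hpN₀⟩ := eventually_nhds_iff.1 hall
  set N := N₀ ∩ coordDomain n F V p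
  have hNo : IsOpen N := hN₀o.inter (isOpen_coordDomain p)
  have hNV : N ⊆ coordDomain n F V p := inter_subset_right
  have hNH : N ⊆ coordDomain n (Eu →L[ℝ] F) (fun x => TangentSpace (𝓡 n) x →L[ℝ] V x) p :=
    fun z hz => ⟨(hNV hz).1, c.map_target (hNV hz).1, (hNV hz).2⟩
  have hDs : ∀ a, ContDiffOn ℝ ∞ (coordRep n (Eu →L[ℝ] F) p (fun x => DV (s a) x)) N := by
    intro a
    have h1 := hDV.contMDiff.contMDiff (σ := s a) (hs a)
    refine (contDiffOn_coordRep (k := ⊤) p (s := univ) h1).mono fun z hz => ⟨hNH hz, trivial⟩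
  -- The connection form sends a basis vector to the covariant derivative of the corresponding frame
  -- section.
  refine ⟨N, hNo, ⟨hpN₀, mem_coordDomain p⟩, hNV, fun z => ∑ a, (LinearMap.toContinuousLinearMap
    (b.coord a)).smulRight (coordRep n (Eu →L[ℝ] F) p (fun x => DV (s a) x) z), ?_, ?_⟩
  · refine ContDiffOn.sum fun a _ => ?_
    exact contDiffOn_smulRight _ (hDs a)
  intro z hz σ hσ
  set x := c.symm z
  intro X
  have hzV := hNV hz
  have hzt : z ∈ coordDomain n Eu (fun x : M => TangentSpace (𝓡 n) x) p := by
    rw [coordDomain_tangent]; exact hzV.1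
  have hcx : c x = z := c.right_inv hzV.1
  set g : Fin (Module.finrank ℝ F) → M → ℝ := fun a y => b.coord a (coordRep n F p σ (c y))
  have hgc : ∀ a, (g a ∘ c.symm) =ᶠ[𝓝 z] fun w => b.coord a (coordRep n F p σ w) := by
    intro a
    filter_upwards [c.open_target.mem_nhds hzV.1] with w hw
    simp [g, c.right_inv hw]
  have hgd : ∀ a, DifferentiableAt ℝ (fun w => b.coord a (coordRep n F p σ w)) z := fun a =>
    (LinearMap.toContinuousLinearMap (b.coord a)).differentiableAt.comp z hσ
  have hg : ∀ a, MDifferentiableAt (𝓡 n) 𝓘(ℝ, ℝ) (g a) x := by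
    intro a
    have h1 : MDifferentiableAt (𝓡 n) 𝓘(ℝ, Eu) (extChartAt (𝓡 n) p) x :=
      mdifferentiableAt_extChartAt (c.map_target hzV.1)
    have h2 : MDifferentiableAt 𝓘(ℝ, Eu) 𝓘(ℝ, ℝ) (fun w => b.coord a (coordRep n F p σ w))
        (extChartAt (𝓡 n) p x) := by
      have e : extChartAt (𝓡 n) p x = z := by simpa using hcx
      rw [e]
      exact (hgd a).mdifferentiableAt
    exact h2.comp x h1
  have hσx : MDifferentiableAt (𝓡 n) ((𝓡 n).prod 𝓘(ℝ, F)) (fun y => TotalSpace.mk' F y (σ y)) x :=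
    (mdifferentiableAt_section_iff_coordRep hzV).2 hσ
  have hsx : ∀ a, MDifferentiableAt (𝓡 n) ((𝓡 n).prod 𝓘(ℝ, F))
      (fun y => TotalSpace.mk' F y (s a y)) x := fun a =>
    ((hs a).contMDiffAt Filter.univ_mem).mdifferentiableAt (by simp)
  obtain ⟨hm, hsum⟩ := DV.isCovariantDerivativeOnUniv.sum_smul Finset.univ hsx hg
  -- Covariant derivatives are local, so an expansion valid near `x` suffices.
  have heq : ∀ᶠ y in 𝓝 x, σ y = ∑ a, g a y • s a y := by
    have hx : x ∈ c.source := c.map_target hzV.1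
    filter_upwards [c.open_source.mem_nhds hx,
      preimage_mem_nhds_of_mem hx (by rw [hcx]; exact hNo.mem_nhds hz)] with y hy hyN
    have hyV := hNV hyN
    have ey : c.symm (c y) = y := c.left_inv hy
    have key : σ (c.symm (c y)) = ∑ a, g a (c.symm (c y)) • s a (c.symm (c y)) := by
      apply fibreCoord_injective hyV
      rw [← coordRep_eq σ hyV, map_sum]
      have : ∀ a, fibreCoord F V p (c.symm (c y)) (g a (c.symm (c y)) • s a (c.symm (c y))) =
          b.coord a (coordRep n F p σ (c y)) • b a := fun a => by
        rw [map_smul, ← coordRep_eq (s a) hyV, hN₀ _ hyN.1]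
        simp only [g, ey]
      rw [Finset.sum_congr rfl fun a _ => this a]
      exact (b.sum_repr _).symm
    rw [ey] at key
    exact key
  rw [DV.isCovariantDerivativeOnUniv.congr_of_eventuallyEq hσx hm Filter.univ_mem heq, hsum]
  have hfd : ∀ a, mvfderiv (𝓡 n) (g a) x X = b.coord a (fderiv ℝ (coordRep n F p σ) z
      (fibreCoord Eu (TangentSpace (𝓡 n)) p x X)) := by
    intro a
    rw [mvfderiv_eq_fderiv_coord hzV.1 (hg a), (hgc a).fderiv_eq]
    have h1 := ((LinearMap.toContinuousLinearMap (b.coord a)).hasFDerivAt.comp z hσ.hasFDerivAt)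
    have h2 : HasFDerivAt (fun w => b.coord a (coordRep n F p σ w))
        ((LinearMap.toContinuousLinearMap (b.coord a)).comp (fderiv ℝ (coordRep n F p σ) z)) z := h1
    rw [h2.fderiv]
    rfl
  have hL : ∀ a, coordRep n (Eu →L[ℝ] F) p (fun x => DV (s a) x) z
      (fibreCoord Eu (TangentSpace (𝓡 n)) p x X) = fibreCoord F V p x (DV (s a) x X) := by
    intro a
    rw [coordRep, hom_trivializationAt_apply]
    simp only [ContinuousLinearMap.inCoordinates, ContinuousLinearMap.comp_apply]
    rw [fibreLift_fibreCoord hzt]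
  have hsz : ∀ a, fibreCoord F V p x (s a x) = b a := fun a => by
    rw [← hN₀ z hz.1 a, coordRep_eq (s a) hzV]
  have hgx : ∀ a, g a x = b.coord a (coordRep n F p σ z) := fun a => by simp only [g, hcx]
  simp only [_root_.sum_apply, _root_.add_apply, map_sum, map_add,
    _root_.smul_apply, map_smul, ContinuousLinearMap.smulRight_apply, hfd, hsz, hgx,
    Finset.sum_add_distrib, hL, LinearMap.coe_toContinuousLinearMap']
  rw [add_comm]
  congr 1
  exact b.sum_repr _

end Connection

/-! ### Linear differential expressions with smooth coefficients. -/

section LowerOrder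

theorem contDiffOn_flip {X A B C : Type*} [NormedAddCommGroup X] [NormedSpace ℝ X]
    [NormedAddCommGroup A] [NormedSpace ℝ A] [NormedAddCommGroup B] [NormedSpace ℝ B]
    [NormedAddCommGroup C] [NormedSpace ℝ C] [FiniteDimensional ℝ A] [FiniteDimensional ℝ B]
    {r : ℕ∞ω} {s : Set X} {f : X → A →L[ℝ] B →L[ℝ] C}
    (hf : ContDiffOn ℝ r f s) : ContDiffOn ℝ r (fun x => (f x).flip) s :=
  contDiffOn_clm_apply.2 fun _ => contDiffOn_clm_apply.2 fun _ =>
    (hf.clm_apply contDiffOn_const).clm_apply contDiffOn_const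

variable {E F Y Y' : Type*} [NormedAddCommGroup E] [NormedSpace ℝ E]
  [NormedAddCommGroup F] [NormedSpace ℝ F] [NormedAddCommGroup Y] [NormedSpace ℝ Y]
  [NormedAddCommGroup Y'] [NormedSpace ℝ Y']

/-- A linear differential expression of order less than `k`, with coefficients that are smooth
on `N`. -/
def IsDiffExpr (N : Set E) (k : ℕ) (R : (E → F) → E → Y) : Prop :=
  ∃ c : ∀ l : ℕ, E → (E [×l]→L[ℝ] F) →L[ℝ] Y, (∀ l, ContDiffOn ℝ ∞ (c l) N) ∧
    ∀ f z, R f z = ∑ l ∈ Finset.range k, c l z (iteratedFDeriv ℝ l f z)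

namespace IsDiffExpr

variable {N : Set E} {k : ℕ} {R R' : (E → F) → E → Y}

theorem add (h : IsDiffExpr N k R) (h' : IsDiffExpr N k R') :
    IsDiffExpr N k (fun f z => R f z + R' f z) := by
  obtain ⟨c, hc, hR⟩ := h
  obtain ⟨c', hc', hR'⟩ := h'
  refine ⟨fun l z => c l z + c' l z, fun l => (hc l).add (hc' l), fun f z => ?_⟩
  simp [hR, hR', Finset.sum_add_distrib]

theorem zero : IsDiffExpr N k (fun (_ : E → F) _ => (0 : Y)) :=
  ⟨fun _ _ => 0, fun _ => contDiffOn_const, fun _ _ => by simp⟩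

theorem sum {ι : Type*} (t : Finset ι) {R : ι → (E → F) → E → Y}
    (h : ∀ i ∈ t, IsDiffExpr N k (R i)) : IsDiffExpr N k (fun f z => ∑ i ∈ t, R i f z) := by
  classical
  induction t using Finset.induction_on with
  | empty => simpa using zero
  | insert a t ha ih =>
    simp only [Finset.sum_insert ha]
    exact (h a (by simp)).add (ih fun i hi => h i (by simp [hi]))

theorem clm (h : IsDiffExpr N k R) {L : E → Y →L[ℝ] Y'} (hL : ContDiffOn ℝ ∞ L N) :
    IsDiffExpr N k (fun f z => L z (R f z)) := by
  obtain ⟨c, hc, hR⟩ := h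
  exact ⟨fun l z => (L z).comp (c l z), fun l => hL.clm_comp (hc l), fun f z => by simp [hR]⟩

theorem clm_const (h : IsDiffExpr N k R) (L : Y →L[ℝ] Y') :
    IsDiffExpr N k (fun f z => L (R f z)) :=
  h.clm (L := fun _ => L) contDiffOn_const

theorem iteratedFDeriv {l : ℕ} (hl : l < k) :
    IsDiffExpr N k (fun (f : E → F) z => iteratedFDeriv ℝ l f z) := by
  refine ⟨Function.update (fun _ _ => 0) l (fun _ => ContinuousLinearMap.id ℝ _), fun j => ?_,
    fun f z => ?_⟩
  · rcases eq_or_ne j l with rfl | hj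
    · simpa using contDiffOn_const
    · simpa [Function.update_of_ne hj] using contDiffOn_const
  · rw [Finset.sum_eq_single_of_mem l (by simpa using hl)]
    · simp
    · intro j _ hj
      simp [Function.update_of_ne hj]

theorem mono {k' : ℕ} (h : IsDiffExpr N k R) (hk : k ≤ k') : IsDiffExpr N k' R := by
  obtain ⟨c, hc, hR⟩ := h
  have : R = fun f z => ∑ l ∈ Finset.range k, c l z (_root_.iteratedFDeriv ℝ l f z) := by
    funext f z; exact hR f z
  rw [this]
  refine sum _ fun l hl => (iteratedFDeriv ?_).clm (hc l)
  exact (Finset.mem_range.1 hl).trans_le hk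

set_option maxHeartbeats 1000000 in
/-- The derivative of a differential expression is a differential expression. -/
theorem exists_hasFDerivAt [FiniteDimensional ℝ E] [FiniteDimensional ℝ F] (hN : IsOpen N) (h : IsDiffExpr N k R) :
    ∃ R' : (E → F) → E → E →L[ℝ] Y, IsDiffExpr N (k + 1) R' ∧
      ∀ f, ∀ z ∈ N, ContDiffAt ℝ k f z → HasFDerivAt (R f) (R' f z) z := by
  obtain ⟨c, hc, hR⟩ := h
  -- The product rule: the coefficient is differentiated, or the derivative of order `l` becomes one
  -- of order `l + 1` with its first slot curried.
  refine ⟨fun f z => ∑ l ∈ Finset.range k, ((fderiv ℝ (c l) z).flip (_root_.iteratedFDeriv ℝ l f z)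
    + (ContinuousLinearMap.compL ℝ E (E [×l]→L[ℝ] F) Y (c l z)
      (continuousMultilinearCurryLeftEquiv ℝ (fun _ : Fin (l + 1) => E) F
        (_root_.iteratedFDeriv ℝ (l + 1) f z)))), ?_, ?_⟩
  · refine sum _ fun l hl => ?_
    have hl : l < k := Finset.mem_range.1 hl
    refine add ?_ ?_
    · refine (iteratedFDeriv (hl.trans_le (Nat.le_succ k))).clm
        (L := fun z => (fderiv ℝ (c l) z).flip) ?_
      exact contDiffOn_flip ((hc l).fderiv_of_isOpen hN (by simp))
    · exact (iteratedFDeriv (Nat.succ_lt_succ hl)).clm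
        (L := fun z => (ContinuousLinearMap.compL ℝ E (E [×l]→L[ℝ] F) Y (c l z)).comp
          ((continuousMultilinearCurryLeftEquiv ℝ
            (fun _ : Fin (l + 1) => E) F).toContinuousLinearEquiv :
              (E [×(l + 1)]→L[ℝ] F) →L[ℝ] E →L[ℝ] (E [×l]→L[ℝ] F)))
        (contDiffOn_clm_apply.2 fun J => (hc l).clm_comp
          (contDiffOn_const (c := continuousMultilinearCurryLeftEquiv ℝ
            (fun _ : Fin (l + 1) => E) F J)))
  · intro f z hz hf
    have e : R f = fun z => ∑ l ∈ Finset.range k, c l z (_root_.iteratedFDeriv ℝ l f z) :=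
      funext fun z => hR f z
    rw [e]
    refine HasFDerivAt.fun_sum fun l hl => ?_
    have hl : l < k := Finset.mem_range.1 hl
    have h1 : HasFDerivAt (c l) (fderiv ℝ (c l) z) z :=
      (((hc l).contDiffAt (hN.mem_nhds hz)).differentiableAt (by simp)).hasFDerivAt
    have h2 : HasFDerivAt (_root_.iteratedFDeriv ℝ l f)
        (fderiv ℝ (_root_.iteratedFDeriv ℝ l f) z) z :=
      (hf.differentiableAt_iteratedFDeriv (by exact_mod_cast hl)).hasFDerivAt
    have h3 := h1.clm_apply h2
    refine h3.congr_fderiv ?_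
    ext v
    simp [add_comm, iteratedFDeriv_succ_eq_comp_left]

end IsDiffExpr

end LowerOrder

/-! ### Smoothness of families of multilinear maps. -/

section Multilinear

variable {E F X : Type*} [NormedAddCommGroup E] [NormedSpace ℝ E] [FiniteDimensional ℝ E]
  [NormedAddCommGroup F] [NormedSpace ℝ F] [NormedAddCommGroup X] [NormedSpace ℝ X]

/-- Curry off the first slot and use that, in finite dimension, smoothness of a family of linear
maps can be tested on fixed vectors. -/
theorem contDiffOn_multilinear_apply {r : ℕ∞ω} {s : Set X} {k : ℕ} {f : X → E [×k]→L[ℝ] F}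
    (hf : ∀ v, ContDiffOn ℝ r (fun x => f x v) s) : ContDiffOn ℝ r f s := by
  induction k with
  | zero =>
    have h := (continuousMultilinearCurryFin0 ℝ E F).symm.contDiff.comp_contDiffOn (hf 0)
    refine h.congr fun x _ => ?_
    exact ((continuousMultilinearCurryFin0 ℝ E F).symm_apply_apply (f x)).symm
  | succ k ih =>
    have h1 : ContDiffOn ℝ r (fun x => continuousMultilinearCurryLeftEquiv ℝ
        (fun _ : Fin (k + 1) => E) F (f x)) s :=
      contDiffOn_clm_apply.2 fun v => ih fun w => hf (Fin.cons v w)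
    have h := (continuousMultilinearCurryLeftEquiv ℝ
        (fun _ : Fin (k + 1) => E) F).symm.contDiff.comp_contDiffOn h1
    refine h.congr fun x _ => ?_
    exact ((continuousMultilinearCurryLeftEquiv ℝ
        (fun _ : Fin (k + 1) => E) F).symm_apply_apply (f x)).symm

end Multilinear

/-! ### Iterated covariant derivatives in coordinates. -/

section CovariantTensors

variable {n : ℕ} {M : Type*} [TopologicalSpace M] [ChartedSpace (EuclideanSpace ℝ (Fin n)) M]
  [IsManifold (𝓡 n) ∞ M]
  {F : Type*} [NormedAddCommGroup F] [NormedSpace ℝ F]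
  {V : M → Type*} [TopologicalSpace (TotalSpace F V)]
  [∀ x, NormedAddCommGroup (V x)] [∀ x, InnerProductSpace ℝ (V x)]
  [FiberBundle F V] [VectorBundle ℝ F V]

local notation "Eu" => EuclideanSpace ℝ (Fin n)

local notation "TM" => (fun x : M => TangentSpace (𝓡 n) x)

/-- In the trivializations at `p`, the tensor `T` at `x` is the multilinear map `Θ`. -/
def TensRep (F : Type*) [NormedAddCommGroup F] [NormedSpace ℝ F]
    {V : M → Type*} [TopologicalSpace (TotalSpace F V)]
    [∀ x, NormedAddCommGroup (V x)] [∀ x, InnerProductSpace ℝ (V x)]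
    [FiberBundle F V] [VectorBundle ℝ F V] (p : M) {k : ℕ} {x : M} (T : Tens n V k x)
    (Θ : EuclideanSpace ℝ (Fin n) [×k]→L[ℝ] F) : Prop :=
  have : IsManifold (𝓡 n) 1 M := .of_le (n := ∞) (by simp)
  ∀ v : Fin k → EuclideanSpace ℝ (Fin n),
    fibreCoord F V p x (T fun i =>
      fibreLift (EuclideanSpace ℝ (Fin n)) (fun x : M => TangentSpace (𝓡 n) x) p x (v i)) = Θ v

/-- The order zero part of ∇ on `k`-tensors: the form `θ` acts on the value, `γ` on each slot with a
minus sign. It is packaged as a linear map in `Θ` so that it can serve as a coefficient of a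
differential expression. -/
theorem exists_connectionTerm {E : Type*} [NormedAddCommGroup E] [NormedSpace ℝ E]
    [FiniteDimensional ℝ E] [FiniteDimensional ℝ F] (θ : F →L[ℝ] E →L[ℝ] F)
    (γ : E →L[ℝ] E →L[ℝ] E) (k : ℕ) :
    ∃ L : (E [×k]→L[ℝ] F) →L[ℝ] (E [×(k + 1)]→L[ℝ] F), ∀ Θ v, L Θ v =
      θ (Θ (Fin.tail v)) (v 0) -
        ∑ i, Θ (Function.update (Fin.tail v) i (γ (Fin.tail v i) (v 0))) := by
  have h : ∀ Θ : E [×k]→L[ℝ] F, ∃ Θ' : E [×(k + 1)]→L[ℝ] F, ∀ v, Θ' v =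
      θ (Θ (Fin.tail v)) (v 0) -
        ∑ i, Θ (Function.update (Fin.tail v) i (γ (Fin.tail v i) (v 0))) := by
    intro Θ
    have key : ∀ (i : Fin k) (g : E →L[ℝ] E) (v : Fin k → E),
        Θ.compContinuousLinearMap (Function.update (fun _ => ContinuousLinearMap.id ℝ E) i g) v =
          Θ (Function.update v i (g (v i))) := by
      intro i g v
      rw [ContinuousMultilinearMap.compContinuousLinearMap_apply]
      congr 1
      funext j
      rcases eq_or_ne j i with rfl | hj
      · simp
      · simp [Function.update_of_ne hj]
    -- `w` is the direction of differentiation, later uncurried as slot 0.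
    let B : E →ₗ[ℝ] (E [×k]→L[ℝ] F) :=
      { toFun := fun w => (θ.flip w).compContinuousMultilinearMap Θ -
          ∑ i, Θ.compContinuousLinearMap
            (Function.update (fun _ => ContinuousLinearMap.id ℝ E) i (γ.flip w))
        map_add' := by
          intro a b
          ext v
          simp only [_root_.sub_apply, _root_.add_apply,
            _root_.sum_apply, key]
          simp [ContinuousMultilinearMap.map_update_add, Finset.sum_add_distrib]
          abel
        map_smul' := by
          intro a b
          ext v
          simp only [_root_.sub_apply, _root_.smul_apply,
            _root_.sum_apply, key]
          simp [ContinuousMultilinearMap.map_update_smul, Finset.smul_sum, smul_sub] }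
    refine ⟨(continuousMultilinearCurryLeftEquiv ℝ (fun _ : Fin (k + 1) => E) F).symm
      (LinearMap.toContinuousLinearMap B), fun v => ?_⟩
    rw [continuousMultilinearCurryLeftEquiv_symm_apply]
    simp only [LinearMap.coe_toContinuousLinearMap', B, LinearMap.coe_mk, AddHom.coe_mk,
      _root_.sub_apply, _root_.sum_apply, key]
    rfl
  choose L hL using h
  refine ⟨LinearMap.toContinuousLinearMap
    { toFun := L
      map_add' := fun a b => ?_
      map_smul' := fun a b => ?_ }, fun Θ v => by simpa using hL Θ v⟩
  · ext v
    simp only [_root_.add_apply, hL, map_add,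
      Finset.sum_add_distrib]
    abel
  · ext v
    simp only [_root_.smul_apply, hL, map_smul,
      Finset.smul_sum, smul_sub, RingHom.id_apply]

/-- The covariant derivative of a tensor field in the trivializations at `p`. -/
theorem tensRep_covTensor [ContMDiffVectorBundle ∞ F V (𝓡 n)]
    {D : CovariantDerivative (𝓡 n) (EuclideanSpace ℝ (Fin n)) (fun x : M => TangentSpace (𝓡 n) x)}
    {DV : CovariantDerivative (𝓡 n) F V} {p : M} {z : Eu} (hz : z ∈ coordDomain n F V p)
    {θ : F →L[ℝ] Eu →L[ℝ] F} {γ : Eu →L[ℝ] Eu →L[ℝ] Eu}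
    (hθ : ∀ σ : ∀ x, V x, DifferentiableAt ℝ (coordRep n F p σ) z →
        ∀ X : TangentSpace (𝓡 n) ((chartAt Eu p).symm z),
          fibreCoord F V p ((chartAt Eu p).symm z) (DV σ ((chartAt Eu p).symm z) X) =
            fderiv ℝ (coordRep n F p σ) z
              (fibreCoord Eu TM p ((chartAt Eu p).symm z) X) +
            θ (coordRep n F p σ z) (fibreCoord Eu TM p ((chartAt Eu p).symm z) X))
    (hγ : ∀ σ : ∀ x, TangentSpace (𝓡 n) x, DifferentiableAt ℝ (coordRep n Eu p σ) z →
        ∀ X : TangentSpace (𝓡 n) ((chartAt Eu p).symm z),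
          fibreCoord Eu TM p ((chartAt Eu p).symm z) (D σ ((chartAt Eu p).symm z) X) =
            fderiv ℝ (coordRep n Eu p σ) z
              (fibreCoord Eu TM p ((chartAt Eu p).symm z) X) +
            γ (coordRep n Eu p σ z) (fibreCoord Eu TM p ((chartAt Eu p).symm z) X))
    {k : ℕ} {T : ∀ x, Tens n V k x} {W : Eu → Eu [×k]→L[ℝ] F} {W' : Eu →L[ℝ] Eu [×k]→L[ℝ] F}
    (hT : ∀ᶠ w in 𝓝 z, TensRep F p (T ((chartAt Eu p).symm w)) (W w))
    (hW : HasFDerivAt W W' z) {Θ' : Eu [×(k + 1)]→L[ℝ] F}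
    (hΘ' : ∀ v, Θ' v = W' (v 0) (Fin.tail v) + (θ (W z (Fin.tail v)) (v 0) -
        ∑ i, W z (Function.update (Fin.tail v) i (γ (Fin.tail v i) (v 0))))) :
    TensRep F p (covTensor D DV T ((chartAt Eu p).symm z)) Θ' := by
  have : IsManifold (𝓡 n) 1 M := .of_le (n := ∞) (by simp)
  have : ContMDiffVectorBundle 1 F V (𝓡 n) := .of_le (n := ∞) (by simp)
  set c := chartAt Eu p
  set x := c.symm z
  have hzt : z ∈ coordDomain n Eu TM p := by
    rw [coordDomain_tangent]; exact hz.1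
  -- The derivatives of the extended fields appear once when `T(Y₁, …, Y_k)` is differentiated and
  -- once, with opposite sign, in the correction terms. They cancel, leaving an expression in the
  -- values of `Y` alone.
  have key : ∀ Y : Fin (k + 1) → TangentSpace (𝓡 n) x, fibreCoord F V p x
      (DV (fun y => T y fun i => FiberBundle.extend Eu (Y i.succ) y) x (Y 0)
          - ∑ i : Fin k, T x (Function.update (fun j => Y j.succ) i
              (D (FiberBundle.extend Eu (Y i.succ)) x (Y 0)))) =
      Θ' fun i => fibreCoord Eu TM p x (Y i) := by
    intro Y
    set η : Fin k → Eu → Eu := fun i => coordRep n Eu p (V := TM)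
      (FiberBundle.extend Eu (Y i.succ))
    have hη : ∀ i, DifferentiableAt ℝ (η i) z := fun i =>
      (mdifferentiableAt_section_iff_coordRep (V := TM) hzt).1
        (FiberBundle.mdifferentiableAt_extend (𝓡 n) Eu (Y i.succ))
    have hηz : ∀ i, η i z = fibreCoord Eu TM p x (Y i.succ) := fun i => by
      simp only [η]
      rw [coordRep_eq (V := TM) _ hzt]
      congr 1
      exact FiberBundle.extend_apply_self (F := Eu) (E := TM) (Y i.succ)
    have hrep : coordRep n F p (fun y => T y fun i => FiberBundle.extend Eu (Y i.succ) y) =ᶠ[𝓝 z]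
        fun w => W w fun i => η i w := by
      filter_upwards [hT, (isOpen_coordDomain p).mem_nhds hz,
        (isOpen_coordDomain p).mem_nhds hzt] with w hw hwV hwt
      rw [coordRep_eq _ hwV, ← hw]
      congr 2
      funext i
      simp only [η]
      rw [coordRep_eq (V := TM) _ hwt, fibreLift_fibreCoord hwt]
    have hder := hW.continuousMultilinearMap_apply fun i => (hη i).hasFDerivAt
    have hder' := hder.congr_of_eventuallyEq hrep
    rw [map_sub, map_sum, hθ _ hder'.differentiableAt, hder'.fderiv, hrep.eq_of_nhds]
    have hterm : ∀ i : Fin k, fibreCoord F V p x (T x (Function.update (fun j => Y j.succ) i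
              (D (FiberBundle.extend Eu (Y i.succ)) x (Y 0)))) =
        W z (Function.update (fun j => η j z) i
          (fderiv ℝ (η i) z (fibreCoord Eu TM p x (Y 0)) +
            γ (η i z) (fibreCoord Eu TM p x (Y 0)))) := by
      intro i
      rw [← hγ _ (hη i), ← hT.self_of_nhds]
      congr 2
      funext j
      rcases eq_or_ne j i with rfl | hj
      · simp only [Function.update_self]
        rw [fibreLift_fibreCoord hzt]
      · simp only [Function.update_of_ne hj, hηz]
        rw [fibreLift_fibreCoord hzt]
    simp only [hterm, ContinuousMultilinearMap.map_update_add, Finset.sum_add_distrib]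
    rw [hΘ']
    have htail : (Fin.tail fun i => fibreCoord Eu TM p x (Y i)) = fun j => η j z := by
      funext j
      rw [hηz]
      rfl
    rw [htail]
    simp only [_root_.add_apply, ContinuousLinearMap.comp_apply, _root_.sum_apply,
      ContinuousMultilinearMap.apply_apply, ContinuousMultilinearMap.toContinuousLinearMap_apply]
    abel
  -- The coordinate formula is multilinear, so `covTensor` takes its genuine value and not the
  -- default 0.
  have hex : ∃ S : Tens n V (k + 1) x, ∀ Y : Fin (k + 1) → TangentSpace (𝓡 n) x,
      S Y = DV (fun y => T y fun i => FiberBundle.extend Eu (Y i.succ) y) x (Y 0)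
          - ∑ i : Fin k, T x (Function.update (fun j => Y j.succ) i
              (D (FiberBundle.extend Eu (Y i.succ)) x (Y 0))) := by
    refine ⟨(fibreLift F V p x).toLinearMap.compMultilinearMap
      (Θ'.toMultilinearMap.compLinearMap fun _ => (fibreCoord Eu TM p x).toLinearMap), fun Y => ?_⟩
    apply fibreCoord_injective hz
    rw [key]
    exact fibreCoord_fibreLift hz _
  intro v
  rw [covTensor, dif_pos hex, hex.choose_spec]
  refine (key fun i => fibreLift Eu TM p x (v i)).trans ?_
  congr 1
  funext i
  exact fibreCoord_fibreLift hzt _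

/-- The iterated covariant derivatives in the trivializations at `p` are the iterated derivatives,
up to lower order terms with smooth coefficients. -/
theorem exists_tensRep_iterCov [T2Space M] [FiniteDimensional ℝ F] [ContMDiffVectorBundle ∞ F V (𝓡 n)]
    {D : CovariantDerivative (𝓡 n) (EuclideanSpace ℝ (Fin n)) (fun x : M => TangentSpace (𝓡 n) x)}
    (hD : CovariantDerivative.ContMDiffCovariantDerivative D ∞)
    {DV : CovariantDerivative (𝓡 n) F V}
    (hDV : CovariantDerivative.ContMDiffCovariantDerivative DV ∞) (p : M) :
    ∃ N : Set Eu, IsOpen N ∧ chartAt Eu p p ∈ N ∧ N ⊆ coordDomain n F V p ∧ ∀ k : ℕ,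
      ∃ R : (Eu → F) → Eu → Eu [×k]→L[ℝ] F, IsDiffExpr N k R ∧ ∀ (u : ∀ x, V x), ∀ z ∈ N,
        ContDiffAt ℝ k (coordRep n F p u) z →
          TensRep F p (iterCov D DV u k ((chartAt Eu p).symm z))
            (iteratedFDeriv ℝ k (coordRep n F p u) z + R (coordRep n F p u) z) := by
  have : IsManifold (𝓡 n) 1 M := .of_le (n := ∞) (by simp)
  obtain ⟨N₁, hN₁, hp₁, hN₁V, θ, hθ, hθD⟩ := exists_connectionForm hDV p
  obtain ⟨N₂, hN₂, hp₂, hN₂V, γ, hγ, hγD⟩ := exists_connectionForm hD p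
  have hN : IsOpen (N₁ ∩ N₂) := hN₁.inter hN₂
  refine ⟨N₁ ∩ N₂, hN, ⟨hp₁, hp₂⟩, fun z hz => hN₁V hz.1, fun k => ?_⟩
  induction k with
  | zero =>
    refine ⟨fun _ _ => 0, .zero, fun u z hz _ v => ?_⟩
    have h := (coordRep_eq u (hN₁V hz.1)).symm
    simpa [iterCov] using h
  | succ k ih =>
    obtain ⟨R, hR, hrep⟩ := ih
    obtain ⟨R', hR', hder⟩ := hR.exists_hasFDerivAt hN
    choose L hL using fun z => exists_connectionTerm (θ z) (γ z) k
    have hLs : ContDiffOn ℝ ∞ L (N₁ ∩ N₂) := by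
      refine contDiffOn_clm_apply.2 fun Θ => contDiffOn_multilinear_apply fun v => ?_
      simp only [hL]
      refine ContDiffOn.sub ?_ (ContDiffOn.sum fun i _ => ?_)
      · exact ((hθ.mono inter_subset_left).clm_apply contDiffOn_const).clm_apply contDiffOn_const
      · have h1 : ContDiffOn ℝ ∞ (fun z => γ z (Fin.tail v i) (v 0)) (N₁ ∩ N₂) :=
          ((hγ.mono inter_subset_right).clm_apply contDiffOn_const).clm_apply contDiffOn_const
        exact (Θ.toContinuousLinearMap (Fin.tail v) i).contDiff.comp_contDiffOn h1
    -- The new remainder is the derivative of the old one plus the connection term applied to `D^k f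
    -- + R`; both have order at most `k`.
    refine ⟨fun f z => (continuousMultilinearCurryLeftEquiv ℝ (fun _ : Fin (k + 1) => Eu) F).symm
      (R' f z) + L z (iteratedFDeriv ℝ k f z + R f z), ?_, ?_⟩
    · refine IsDiffExpr.add ?_ (IsDiffExpr.clm ?_ hLs)
      · exact hR'.clm_const ((continuousMultilinearCurryLeftEquiv ℝ
          (fun _ : Fin (k + 1) => Eu) F).symm.toContinuousLinearEquiv :
            (Eu →L[ℝ] (Eu [×k]→L[ℝ] F)) →L[ℝ] (Eu [×(k + 1)]→L[ℝ] F))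
      · exact (IsDiffExpr.iteratedFDeriv (Nat.lt_succ_self k)).add (hR.mono (Nat.le_succ k))
    · intro u z hz hu
      set f := coordRep n F p u
      have hu' : ∀ᶠ w in 𝓝 z, ContDiffAt ℝ k f w :=
        (hu.of_le (by exact_mod_cast Nat.le_succ k)).eventually (by simp)
      have hW1 : HasFDerivAt (iteratedFDeriv ℝ k f) (fderiv ℝ (iteratedFDeriv ℝ k f) z) z :=
        (hu.differentiableAt_iteratedFDeriv (by exact_mod_cast Nat.lt_succ_self k)).hasFDerivAt
      refine tensRep_covTensor (hN₁V hz.1) (hθD z hz.1) (hγD z hz.2)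
        (W := fun w => iteratedFDeriv ℝ k f w + R f w)
        (W' := fderiv ℝ (iteratedFDeriv ℝ k f) z + R' f z) ?_ (hW1.add (hder f z hz hu'.self_of_nhds))
        fun v => ?_
      · filter_upwards [hu', hN.mem_nhds hz] with w hw hwN using hrep u w hwN hw
      · simp only [_root_.add_apply, hL, iteratedFDeriv_succ_eq_comp_left,
          Function.comp_apply, continuousMultilinearCurryLeftEquiv_symm_apply]
        abel

end CovariantTensors

/-! ### Symmetry of iterated derivatives under pointwise differentiability. -/

section Symmetry

variable {E F : Type*} [NormedAddCommGroup E] [NormedSpace ℝ E]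
  [NormedAddCommGroup F] [NormedSpace ℝ F]

variable (E F) in
/-- The symmetric continuous multilinear maps. -/
def symmetricMaps (k : ℕ) : Submodule ℝ (E [×k]→L[ℝ] F) where
  carrier := {Θ | ∀ (σ : Equiv.Perm (Fin k)) (v : Fin k → E), Θ (v ∘ σ) = Θ v}
  add_mem' ha hb σ v := by simp [ha σ v, hb σ v]
  zero_mem' σ v := by simp
  smul_mem' c Θ h σ v := by simp [h σ v]

theorem mem_symmetricMaps_iff {k : ℕ} {Θ : E [×k]→L[ℝ] F} : Θ ∈ symmetricMaps E F k ↔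
    ∀ (σ : Equiv.Perm (Fin k)) (v : Fin k → E), Θ (v ∘ σ) = Θ v := Iff.rfl

/-- Adjacent transpositions generate the symmetric group. -/
theorem mem_symmetricMaps_of_swap {k : ℕ} {Θ : E [×(k + 1)]→L[ℝ] F}
    (h : ∀ (i : Fin k) (v : Fin (k + 1) → E), Θ (v ∘ Equiv.swap i.castSucc i.succ) = Θ v) :
    Θ ∈ symmetricMaps E F (k + 1) := by
  rw [mem_symmetricMaps_iff]
  intro σ
  have hσ : σ ∈ Submonoid.closure
      (Set.range fun i : Fin k => Equiv.swap i.castSucc i.succ) := by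
    rw [Equiv.Perm.mclosure_swap_castSucc_succ]; trivial
  induction hσ using Submonoid.closure_induction with
  | mem τ hτ => obtain ⟨i, rfl⟩ := hτ; exact h i
  | one => intro v; rfl
  | mul a b _ _ ha hb =>
    intro v
    rw [Equiv.Perm.coe_mul, ← Function.comp_assoc, hb, ha]

/-- The iterated derivatives are symmetric. -/
theorem iteratedFDeriv_mem_symmetricMaps {k : ℕ} {f : E → F} {z : E} (hf : ContDiffAt ℝ k f z) :
    iteratedFDeriv ℝ k f z ∈ symmetricMaps E F k := by
  induction k generalizing z with
  | zero =>
    rw [mem_symmetricMaps_iff]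
    intro σ v
    congr 1
    exact Subsingleton.elim _ _
  | succ k ih =>
    refine mem_symmetricMaps_of_swap fun i v => ?_
    have hev : ∀ᶠ w in 𝓝 z, ContDiffAt ℝ k f w :=
      (hf.of_le (by exact_mod_cast Nat.le_succ k)).eventually (by simp)
    have hd : DifferentiableAt ℝ (iteratedFDeriv ℝ k f) z :=
      hf.differentiableAt_iteratedFDeriv (by exact_mod_cast Nat.lt_succ_self k)
    rcases k with _ | k
    · exact i.elim0
    have h1 : ∀ w : Fin (k + 2) → E, iteratedFDeriv ℝ (k + 2) f z w =
        fderiv ℝ (iteratedFDeriv ℝ (k + 1) f) z (w 0) (Fin.tail w) := by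
      intro w
      rw [iteratedFDeriv_succ_eq_comp_left, Function.comp_apply,
        continuousMultilinearCurryLeftEquiv_symm_apply]
    have h3 : ∀ (a : E) (w : Fin (k + 1) → E),
        fderiv ℝ (iteratedFDeriv ℝ (k + 1) f) z a w =
          fderiv ℝ (fun y => iteratedFDeriv ℝ (k + 1) f y w) z a := by
      intro a w
      rw [(hd.hasFDerivAt.continuousMultilinear_apply_const w).fderiv]
      rfl
    -- Exchanging slots 0 and 1 is the symmetry of the second derivative of `D^k f`. Any other
    -- adjacent exchange acts on the tail and follows by differentiating the inductive identity,
    -- valid at all nearby points.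
    refine Fin.cases ?_ (fun j => ?_) i
    · have h2 : ContDiffAt ℝ 2 (iteratedFDeriv ℝ k f) z := by
        refine hf.iteratedFDeriv_right (i := k) ?_
        push_cast
        rw [show (2 : ℕ∞ω) = 1 + 1 by norm_num, add_assoc, add_comm, add_assoc]
        exact le_of_eq (by ring)
      have hsymm := h2.isSymmSndFDerivAt (by simp)
      have hd1 : ∀ w : Fin (k + 2) → E, iteratedFDeriv ℝ (k + 2) f z w =
          fderiv ℝ (fderiv ℝ (iteratedFDeriv ℝ k f)) z (w 0) (w 1) (Fin.tail (Fin.tail w)) := by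
        intro w
        rw [h1, h3]
        have e : (fun y => iteratedFDeriv ℝ (k + 1) f y (Fin.tail w)) = fun y =>
            fderiv ℝ (iteratedFDeriv ℝ k f) y (w 1) (Fin.tail (Fin.tail w)) := by
          funext y
          rw [iteratedFDeriv_succ_eq_comp_left, Function.comp_apply,
            continuousMultilinearCurryLeftEquiv_symm_apply]
          rfl
        have hdd : HasFDerivAt (fderiv ℝ (iteratedFDeriv ℝ k f))
            (fderiv ℝ (fderiv ℝ (iteratedFDeriv ℝ k f)) z) z :=
          ((h2.fderiv_right (m := 1) (by norm_num)).differentiableAt (by simp)).hasFDerivAt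
        have h4 := (hdd.clm_apply (hasFDerivAt_const (w 1) z)).continuousMultilinear_apply_const
          (Fin.tail (Fin.tail w))
        rw [e, h4.fderiv]
        simp
      rw [hd1, hd1, hsymm]
      congr 2
    · rw [h1, h1, h3, h3]
      have e1 : (v ∘ Equiv.swap j.succ.castSucc j.succ.succ) 0 = v 0 := by
        simp only [Function.comp_apply]
        rw [Equiv.swap_apply_of_ne_of_ne]
        · exact (Fin.succ_ne_zero j.castSucc).symm
        · exact (Fin.succ_ne_zero _).symm
      have e2 : Fin.tail (v ∘ Equiv.swap j.succ.castSucc j.succ.succ) =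
          Fin.tail v ∘ Equiv.swap j.castSucc j.succ := by
        funext l
        simp only [Fin.tail, Function.comp_apply, Fin.castSucc_succ]
        congr 1
        exact (Fin.succ_injective _).swap_apply _ _ _
      rw [e1, e2]
      congr 1
      refine Filter.EventuallyEq.fderiv_eq ?_
      filter_upwards [hev] with y hy using ih hy _ _

end Symmetry

/-! ### Smooth left inverses on a subspace. -/

section LeftInverse

variable {E Y G : Type*} [NormedAddCommGroup E] [NormedSpace ℝ E]
  [NormedAddCommGroup Y] [NormedSpace ℝ Y] [NormedAddCommGroup G] [NormedSpace ℝ G]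

/-- A smooth family of linear maps that is injective on a subspace at one point has a smooth family
of left inverses near that point. -/
theorem exists_contDiffOn_leftInverse [FiniteDimensional ℝ Y] [FiniteDimensional ℝ G]
    {S : Set E} {p : E} (hp : p ∈ S) {A : E → Y →L[ℝ] G} (hA : ContDiffOn ℝ ∞ A S)
    (K : Submodule ℝ Y) (hK : ∀ y ∈ K, A p y = 0 → y = 0) :
    ∃ N : Set E, IsOpen N ∧ p ∈ N ∧ ∃ Λ : E → G →L[ℝ] Y, ContDiffOn ℝ ∞ Λ (N ∩ S) ∧
      ∀ z ∈ N ∩ S, ∀ y ∈ K, Λ z (A z y) = y := by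
  obtain ⟨L, hL⟩ := ((A p).comp K.subtypeL).toLinearMap.exists_leftInverse_of_injective (by
    rw [LinearMap.ker_eq_bot']
    rintro ⟨y, hy⟩ h
    exact Subtype.ext (hK y hy h))
  set L' : G →L[ℝ] K := LinearMap.toContinuousLinearMap L
  -- With `L'` a left inverse of `A p` on `K`, the map `B z` is the identity at `p`, hence
  -- invertible nearby, and `B z` inverse after `L'` is a left inverse of `A z` on `K`. Injectivity
  -- is thus needed at the single point `p` only.
  set B : E → K →L[ℝ] K := fun z => L'.comp ((A z).comp K.subtypeL)
  have hB : ContDiffOn ℝ ∞ B S :=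
    contDiffOn_const.clm_comp (hA.clm_comp contDiffOn_const)
  have hBp : B p = ContinuousLinearMap.id ℝ K := by
    ext y
    have := LinearMap.congr_fun hL y
    simpa [B, L'] using congrArg Subtype.val this
  have hopen : IsOpen (Set.range ((↑) : (K ≃L[ℝ] K) → K →L[ℝ] K)) := ContinuousLinearEquiv.isOpen
  have hmem : B ⁻¹' (Set.range ((↑) : (K ≃L[ℝ] K) → K →L[ℝ] K)) ∈ 𝓝[S] p := by
    refine (hB p hp).continuousWithinAt.preimage_mem_nhdsWithin (hopen.mem_nhds ?_)
    rw [hBp]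
    exact ⟨ContinuousLinearEquiv.refl ℝ K, rfl⟩
  obtain ⟨N, hNo, hpN, hN⟩ := mem_nhdsWithin.1 hmem
  refine ⟨N, hNo, hpN, fun z => K.subtypeL.comp ((ContinuousLinearMap.inverse (B z)).comp L'), ?_, ?_⟩
  · refine contDiffOn_const.clm_comp (ContDiffOn.clm_comp ?_ contDiffOn_const)
    intro z hz
    obtain ⟨e, he⟩ := hN hz
    have h1 : ContDiffAt ℝ ∞ ContinuousLinearMap.inverse (B z) := by
      rw [← he]
      exact contDiffAt_map_inverse e
    exact h1.comp_contDiffWithinAt z ((hB z hz.2).mono inter_subset_right)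
  · intro z hz y hy
    obtain ⟨e, he⟩ := hN hz
    have h2 : L' (A z y) = B z ⟨y, hy⟩ := rfl
    simp only [ContinuousLinearMap.comp_apply, h2, ← he, ContinuousLinearMap.inverse_equiv]
    simp

end LeftInverse

/-! ### Fibre metrics in coordinates. -/

section Metric

variable {n : ℕ} {M : Type*} [TopologicalSpace M] [ChartedSpace (EuclideanSpace ℝ (Fin n)) M]
  [IsManifold (𝓡 n) ∞ M]
  {F : Type*} [NormedAddCommGroup F] [NormedSpace ℝ F]
  {V : M → Type*} [TopologicalSpace (TotalSpace F V)]
  [∀ x, NormedAddCommGroup (V x)] [∀ x, InnerProductSpace ℝ (V x)]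
  [FiberBundle F V] [VectorBundle ℝ F V]

local notation "Eu" => EuclideanSpace ℝ (Fin n)

/-- The fibre metric in the chart and the trivialization at `p`. -/
def metricRep (F : Type*) [NormedAddCommGroup F] [NormedSpace ℝ F]
    (V : M → Type*) [TopologicalSpace (TotalSpace F V)]
    [∀ x, NormedAddCommGroup (V x)] [∀ x, InnerProductSpace ℝ (V x)]
    [FiberBundle F V] [VectorBundle ℝ F V] (p : M) (z : EuclideanSpace ℝ (Fin n)) :
    F →L[ℝ] F →L[ℝ] ℝ :=
  (innerSL ℝ : V ((chartAt (EuclideanSpace ℝ (Fin n)) p).symm z) →L[ℝ] _).bilinearComp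
    (fibreLift F V p ((chartAt (EuclideanSpace ℝ (Fin n)) p).symm z))
    (fibreLift F V p ((chartAt (EuclideanSpace ℝ (Fin n)) p).symm z))

theorem metricRep_apply (p : M) (z : Eu) (v w : F) : metricRep F V p z v w =
    inner ℝ (fibreLift F V p ((chartAt Eu p).symm z) v)
      (fibreLift F V p ((chartAt Eu p).symm z) w) := rfl

theorem contMDiffAt_fibreLift [ContMDiffVectorBundle ∞ F V (𝓡 n)] {p : M} {z : Eu}
    (hz : z ∈ coordDomain n F V p) (v : F) :
    ContMDiffAt (𝓡 n) ((𝓡 n).prod 𝓘(ℝ, F)) ∞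
      (fun x => TotalSpace.mk' F x (fibreLift F V p x v)) ((chartAt Eu p).symm z) := by
  refine (contDiffWithinAt_coordRep_iff (k := ⊤) (u := fun x => fibreLift F V p x v)
    (s := univ) hz).2 ?_
  rw [preimage_univ, contDiffWithinAt_univ]
  refine (contDiffAt_const (c := v)).congr_of_eventuallyEq ?_
  filter_upwards [(isOpen_coordDomain p).mem_nhds hz] with w hw
  rw [coordRep_eq (fun x => fibreLift F V p x v) hw, fibreCoord_fibreLift hw]

theorem contDiffOn_metricRep [ContMDiffVectorBundle ∞ F V (𝓡 n)]
    [IsContMDiffRiemannianBundle (𝓡 n) ∞ F V] [FiniteDimensional ℝ F] (p : M) :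
    ContDiffOn ℝ ∞ (metricRep (n := n) F V p) (coordDomain n F V p) := by
  refine contDiffOn_clm_apply.2 fun v => contDiffOn_clm_apply.2 fun w => ?_
  intro z hz
  have h1 := (contMDiffAt_fibreLift hz v).inner_bundle (contMDiffAt_fibreLift hz w)
  have h2 : ContMDiffAt 𝓘(ℝ, Eu) (𝓡 n) ∞ (chartAt Eu p).symm z :=
    (contMDiffOn_chart_symm (I := 𝓡 n) (n := ∞) (x := p)).contMDiffAt
      ((chartAt Eu p).open_target.mem_nhds hz.1)
  exact (contMDiffAt_iff_contDiffAt.1 (h1.comp z h2)).contDiffWithinAt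

/-- Positive definiteness gives injectivity, and a finite dimensional space has the dimension of its
dual. -/
theorem isInvertible_metricRep [FiniteDimensional ℝ F] {p : M} {z : Eu}
    (hz : z ∈ coordDomain n F V p) : (metricRep F V p z).IsInvertible := by
  have hinj : Function.Injective (metricRep F V p z).toLinearMap := by
    rw [← LinearMap.ker_eq_bot, LinearMap.ker_eq_bot']
    intro v hv
    have h1 : metricRep F V p z v v = 0 := by
      have : metricRep F V p z v = 0 := hv
      rw [this]; rfl
    rw [metricRep_apply, inner_self_eq_zero] at h1
    rw [← fibreCoord_fibreLift hz v, h1, map_zero]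
  have hdim : Module.finrank ℝ F = Module.finrank ℝ (F →L[ℝ] ℝ) := by
    rw [← LinearMap.toContinuousLinearMap.finrank_eq]
    exact (Subspace.dual_finrank_eq (K := ℝ) (V := F)).symm
  refine ⟨((metricRep F V p z).toLinearMap.linearEquivOfInjective hinj
    hdim).toContinuousLinearEquiv, ?_⟩
  ext v w
  rfl

theorem contDiffOn_inverse_metricRep [ContMDiffVectorBundle ∞ F V (𝓡 n)]
    [IsContMDiffRiemannianBundle (𝓡 n) ∞ F V] [FiniteDimensional ℝ F] (p : M) :
    ContDiffOn ℝ ∞ (fun z => (metricRep (n := n) F V p z).inverse) (coordDomain n F V p) := by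
  intro z hz
  exact (isInvertible_metricRep hz).contDiffAt_map_inverse.comp_contDiffWithinAt z
    (contDiffOn_metricRep p z hz)

end Metric

/-! ### Coefficients in coordinates, and solving the operator for its highest derivatives. -/

section Coefficients

variable {n : ℕ} {M : Type*} [TopologicalSpace M] [T2Space M]
  [ChartedSpace (EuclideanSpace ℝ (Fin n)) M] [IsManifold (𝓡 n) ∞ M]
  [RiemannianBundle (fun x : M => TangentSpace (𝓡 n) x)]
  [IsContMDiffRiemannianBundle (𝓡 n) ∞ (EuclideanSpace ℝ (Fin n))
    (fun x : M => TangentSpace (𝓡 n) x)]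
  {F : Type*} [NormedAddCommGroup F] [NormedSpace ℝ F]
  {V : M → Type*} [TopologicalSpace (TotalSpace F V)]
  [∀ x, NormedAddCommGroup (V x)] [∀ x, InnerProductSpace ℝ (V x)]
  [FiberBundle F V] [VectorBundle ℝ F V]
  {G : Type*} [NormedAddCommGroup G] [NormedSpace ℝ G]
  {W : M → Type*} [TopologicalSpace (TotalSpace G W)]
  [∀ x, NormedAddCommGroup (W x)] [∀ x, InnerProductSpace ℝ (W x)]
  [FiberBundle G W] [VectorBundle ℝ G W]

local notation "Eu" => EuclideanSpace ℝ (Fin n)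

local notation "TM" => (fun x : M => TangentSpace (𝓡 n) x)

/-- The tensor at `x` that is given in the trivializations at `p` by the multilinear map `Θ`. -/
def tensLift (F : Type*) [NormedAddCommGroup F] [NormedSpace ℝ F]
    (V : M → Type*) [TopologicalSpace (TotalSpace F V)]
    [∀ x, NormedAddCommGroup (V x)] [∀ x, InnerProductSpace ℝ (V x)]
    [FiberBundle F V] [VectorBundle ℝ F V] (p : M) (k : ℕ) (x : M) :
    (EuclideanSpace ℝ (Fin n) [×k]→L[ℝ] F) →ₗ[ℝ] Tens n V k x :=
  have : IsManifold (𝓡 n) 1 M := .of_le (n := ∞) (by simp)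
  { toFun := fun Θ => (fibreLift F V p x).toLinearMap.compMultilinearMap
      (Θ.toMultilinearMap.compLinearMap fun _ => (fibreCoord (EuclideanSpace ℝ (Fin n))
        (fun x : M => TangentSpace (𝓡 n) x) p x).toLinearMap)
    map_add' := fun a b => by ext; simp
    map_smul' := fun a b => by ext; simp }

theorem tensRep_iff {p : M} {k : ℕ} {z : Eu} (hz : z ∈ coordDomain n F V p)
    {T : Tens n V k ((chartAt Eu p).symm z)} {Θ : Eu [×k]→L[ℝ] F} :
    TensRep F p T Θ ↔ T = tensLift F V p k ((chartAt Eu p).symm z) Θ := by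
  have : IsManifold (𝓡 n) 1 M := .of_le (n := ∞) (by simp)
  have hzt : z ∈ coordDomain n Eu TM p := by
    rw [coordDomain_tangent]; exact hz.1
  constructor
  · intro h
    ext Y
    apply fibreCoord_injective hz
    have h1 := h fun i => fibreCoord Eu TM p _ (Y i)
    simp only [fibreLift_fibreCoord hzt] at h1
    rw [h1]
    exact (fibreCoord_fibreLift hz _).symm
  · rintro rfl v
    refine (fibreCoord_fibreLift hz _).trans ?_
    change Θ _ = Θ v
    congr 1
    funext i
    exact fibreCoord_fibreLift hzt _

/-- A smooth family of linear maps on tensors has smooth coefficients in the trivializations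
at `p`. -/
theorem exists_coeffRep [FiniteDimensional ℝ F] [ContMDiffVectorBundle ∞ F V (𝓡 n)]
    [FiniteDimensional ℝ G] [ContMDiffVectorBundle ∞ G W (𝓡 n)]
    {k : ℕ} {A : ∀ x, Tens n V k x →ₗ[ℝ] W x} {s : Set M} (hA : IsSmoothCoeff F G A s) (p : M) :
    ∃ N : Set Eu, IsOpen N ∧ chartAt Eu p p ∈ N ∧
      ∃ Â : Eu → (Eu [×k]→L[ℝ] F) →L[ℝ] G,
        ContDiffOn ℝ ∞ Â (N ∩ (chartAt Eu p).symm ⁻¹' s) ∧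
        ∀ z ∈ N, z ∈ coordDomain n F V p ∧ z ∈ coordDomain n G W p ∧
          ∀ Θ, Â z Θ = fibreCoord G W p ((chartAt Eu p).symm z)
            (A ((chartAt Eu p).symm z) (tensLift F V p k ((chartAt Eu p).symm z) Θ)) := by
  have : IsManifold (𝓡 n) 1 M := .of_le (n := ∞) (by simp)
  set c := chartAt Eu p
  set b := Module.finBasis ℝ F
  -- `pureTensor` builds covectors with the metric, so `X j` is taken near `p` to be the metric dual
  -- of the `j`-th coordinate covector.
  have hX : ∀ j : Fin n, ∃ X : ∀ x : M, TangentSpace (𝓡 n) x,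
      SectionOn (n := n) Eu ∞ X univ ∧ ∀ᶠ z in 𝓝 (c p), coordRep n Eu p X z =
        (metricRep Eu TM p z).inverse (EuclideanSpace.proj j) := fun j =>
    exists_section_coordRep_eq p (coordDomain_mem_nhds (F := Eu) (V := TM) p)
      ((contDiffOn_inverse_metricRep p).clm_apply contDiffOn_const)
  choose X hXs hXc using hX
  have hv : ∀ a, ∃ σ : ∀ x, V x, SectionOn (n := n) F ∞ σ univ ∧
      ∀ᶠ z in 𝓝 (c p), coordRep n F p σ z = b a := fun a =>
    exists_section_coordRep_eq p Filter.univ_mem contDiffOn_const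
  choose v hvs hvc using hv
  have hall := (Filter.eventually_all.2 hXc).and (Filter.eventually_all.2 hvc)
  obtain ⟨N₀, hN₀, hN₀o, hpN₀⟩ := eventually_nhds_iff.1 hall
  set N := N₀ ∩ (coordDomain n F V p ∩ coordDomain n G W p)
  refine ⟨N, hN₀o.inter ((isOpen_coordDomain p).inter (isOpen_coordDomain p)),
    ⟨hpN₀, mem_coordDomain p, mem_coordDomain p⟩, fun z => LinearMap.toContinuousLinearMap
      ((fibreCoord G W p (c.symm z)).toLinearMap ∘ₗ A (c.symm z) ∘ₗ
        tensLift F V p k (c.symm z)), ?_, fun z hz => ⟨hz.2.1, hz.2.2, fun Θ => rfl⟩⟩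
  refine contDiffOn_clm_apply.2 fun Θ => ?_
  have hsum : ContDiffOn ℝ ∞ (fun z => ∑ I : Fin k → Fin n, ∑ a,
      b.coord a (Θ fun i => EuclideanSpace.single (I i) (1 : ℝ)) •
        coordRep n G p (fun x => A x (pureTensor (fun i => X (I i) x) (v a x))) z)
      (N ∩ c.symm ⁻¹' s) := by
    refine ContDiffOn.sum fun I _ => ContDiffOn.sum fun a _ => contDiffOn_const.smul ?_
    exact (contDiffOn_coordRep (k := ⊤) p
      (hA (fun i => X (I i)) (v a) (fun i => hXs _) (hvs a))).mono
      fun z hz => ⟨hz.1.2.2, hz.2⟩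
  refine hsum.congr fun z hz => ?_
  have hzV := hz.1.2.1
  have hzW := hz.1.2.2
  have hzt : z ∈ coordDomain n Eu TM p := by
    rw [coordDomain_tangent]; exact hzV.1
  -- A tensor with constant components is a constant combination of pure tensors of global smooth
  -- sections, the only ones on which smoothness of `A` is known.
  have hlift : tensLift F V p k (c.symm z) Θ = ∑ I : Fin k → Fin n, ∑ a,
      b.coord a (Θ fun i => EuclideanSpace.single (I i) (1 : ℝ)) •
        pureTensor (fun i => X (I i) (c.symm z)) (v a (c.symm z)) := by
    obtain ⟨hXz, hvz⟩ := hN₀ z hz.1.1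
    have hin : ∀ j (Y : TangentSpace (𝓡 n) (c.symm z)), inner ℝ (X j (c.symm z)) Y =
        fibreCoord Eu TM p (c.symm z) Y j := by
      intro j Y
      have h1 : X j (c.symm z) = fibreLift Eu TM p (c.symm z)
          ((metricRep Eu TM p z).inverse (EuclideanSpace.proj j)) := by
        rw [← hXz j, coordRep_eq (X j) hzt, fibreLift_fibreCoord hzt]
      have h2 := metricRep_apply (V := TM) p z
        ((metricRep Eu TM p z).inverse (EuclideanSpace.proj j)) (fibreCoord Eu TM p (c.symm z) Y)
      rw [fibreLift_fibreCoord hzt, ← h1, (isInvertible_metricRep hzt).self_apply_inverse] at h2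
      exact h2.symm
    have hva : ∀ a, fibreCoord F V p (c.symm z) (v a (c.symm z)) = b a := fun a => by
      rw [← hvz a, coordRep_eq (v a) hzV]
    ext Y
    apply fibreCoord_injective hzV
    refine (fibreCoord_fibreLift hzV _).trans ?_
    set y : Fin k → Eu := fun i => fibreCoord Eu TM p (c.symm z) (Y i)
    change Θ y = _
    have hpure : ∀ (I : Fin k → Fin n) a, pureTensor (fun i => X (I i) (c.symm z))
        (v a (c.symm z)) Y = (∏ i, y i (I i)) • v a (c.symm z) := fun I a => by
      simp [pureTensor, hin, y]
    simp only [_root_.sum_apply, _root_.smul_apply, map_sum, map_smul, hpure]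
    have hy : y = fun i => ∑ j, (y i j) • EuclideanSpace.single j (1 : ℝ) := by
      funext i
      exact ((EuclideanSpace.basisFun (Fin n) ℝ).sum_repr (y i)).symm.trans (by simp)
    conv_lhs => rw [hy]
    rw [← ContinuousMultilinearMap.coe_coe, MultilinearMap.map_sum]
    refine Finset.sum_congr rfl fun I _ => ?_
    rw [MultilinearMap.map_smul_univ]
    conv_lhs => rw [← b.sum_repr (Θ.toMultilinearMap _)]
    rw [Finset.smul_sum]
    refine Finset.sum_congr rfl fun a _ => ?_
    rw [smul_comm, ← hva a]
    rfl
  simp only [LinearMap.coe_toContinuousLinearMap', LinearMap.comp_apply,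
    ContinuousLinearMap.coe_coe, hlift, map_sum, map_smul]
  refine Finset.sum_congr rfl fun I _ => Finset.sum_congr rfl fun a _ => ?_
  rw [coordRep_eq _ hzW]

theorem isDiffExpr_mono_set {E Y : Type*} [NormedAddCommGroup E] [NormedSpace ℝ E]
    [NormedAddCommGroup Y] [NormedSpace ℝ Y] {N N' : Set E} {k : ℕ} {R : (E → F) → E → Y}
    (h : IsDiffExpr N k R) (hN : N' ⊆ N) : IsDiffExpr N' k R := by
  obtain ⟨c, hc, hR⟩ := h
  exact ⟨c, fun l => (hc l).mono hN, hR⟩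

/-- An operator with injective symbol determines the derivatives of highest order. -/
theorem exists_iteratedFDeriv_eq [FiniteDimensional ℝ F] [ContMDiffVectorBundle ∞ F V (𝓡 n)]
    [FiniteDimensional ℝ G] [ContMDiffVectorBundle ∞ G W (𝓡 n)]
    {D : CovariantDerivative (𝓡 n) (EuclideanSpace ℝ (Fin n)) (fun x : M => TangentSpace (𝓡 n) x)}
    (hD : CovariantDerivative.ContMDiffCovariantDerivative D ∞)
    {DV : CovariantDerivative (𝓡 n) F V}
    (hDV : CovariantDerivative.ContMDiffCovariantDerivative DV ∞) {m : ℕ} {s : Set M}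
    {A : ∀ x, Tens n V m x →ₗ[ℝ] W x} {B : ∀ k x, Tens n V k x →ₗ[ℝ] W x}
    (hA : IsSmoothCoeff F G A s) (hB : ∀ k < m, IsSmoothCoeff F G (B k) s)
    {p : M} (hp : p ∈ s) (hinj : ∀ T : Tens n V m p, IsSymmTens T → A p T = 0 → T = 0) :
    ∃ N : Set Eu, IsOpen N ∧ chartAt Eu p p ∈ N ∧ N ⊆ coordDomain n F V p ∧
      N ⊆ coordDomain n G W p ∧
      ∃ R : (Eu → F) → Eu → Eu [×m]→L[ℝ] F, IsDiffExpr (N ∩ (chartAt Eu p).symm ⁻¹' s) m R ∧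
      ∃ Λ : Eu → G →L[ℝ] (Eu [×m]→L[ℝ] F),
        ContDiffOn ℝ ∞ Λ (N ∩ (chartAt Eu p).symm ⁻¹' s) ∧
        ∀ (u : ∀ x, V x), ∀ z ∈ N ∩ (chartAt Eu p).symm ⁻¹' s,
          ContDiffAt ℝ m (coordRep n F p u) z →
          iteratedFDeriv ℝ m (coordRep n F p u) z = R (coordRep n F p u) z +
            Λ z (fibreCoord G W p ((chartAt Eu p).symm z)
              (diffOp D DV m A B u ((chartAt Eu p).symm z))) := by
  have : IsManifold (𝓡 n) 1 M := .of_le (n := ∞) (by simp)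
  set c := chartAt Eu p
  set S := c.symm ⁻¹' s
  have hcp : c.symm (c p) = p := c.left_inv (mem_chart_source _ p)
  have hpS : c p ∈ S := by simpa only [S, mem_preimage, hcp] using hp
  obtain ⟨N₁, hN₁, hp₁, hN₁V, hrep⟩ := exists_tensRep_iterCov hD hDV p
  choose R hR hRrep using hrep
  obtain ⟨N₂, hN₂, hp₂, Â, hÂ, hÂA⟩ := exists_coeffRep hA p
  have hB' : ∀ k : Fin m, _ := fun k => exists_coeffRep (hB k k.2) p
  choose N₃ hN₃ hp₃ B' hB's hB'B using hB'
  -- Restricting to symmetric maps is enough, as the left inverse will only have to recover a true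
  -- iterated derivative.
  obtain ⟨N₄, hN₄, hp₄, Λ, hΛ, hΛA⟩ := exists_contDiffOn_leftInverse (S := N₂ ∩ S)
    ⟨hp₂, hpS⟩ hÂ (symmetricMaps Eu F m) (by
      intro Θ hΘ h0
      obtain ⟨hzV, hzW, hz⟩ := hÂA _ hp₂
      have hzt : c p ∈ coordDomain n Eu TM p := by
        rw [coordDomain_tangent]; exact hzV.1
      rw [hz] at h0
      have h1 : A (c.symm (c p)) (tensLift F V p m (c.symm (c p)) Θ) = 0 :=
        fibreCoord_injective hzW (by rw [h0, map_zero])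
      have hinj' : ∀ T : Tens n V m (c.symm (c p)), IsSymmTens T → A _ T = 0 → T = 0 := by
        rw [hcp]; exact hinj
      have h2 := hinj' _ (by
        intro σ Y
        change fibreLift F V p _ (Θ _) = fibreLift F V p _ (Θ _)
        congr 1
        exact hΘ σ fun i => fibreCoord Eu TM p _ (Y i)) h1
      have h3 := (tensRep_iff hzV).2 h2.symm
      ext v
      rw [← h3 v]
      simp)
  set N := (N₁ ∩ N₂) ∩ ((⋂ k, N₃ k) ∩ N₄)
  have hN : IsOpen N := (hN₁.inter hN₂).inter ((isOpen_iInter_of_finite hN₃).inter hN₄)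
  -- In coordinates the operator is `Â (D^m f + R_m f)` plus lower order terms. Applying `Λ`
  -- isolates `D^m f`; the remainder `R_m f` need not be symmetric, so it stays inside `Λ Â`.
  refine ⟨N, hN, ⟨⟨hp₁, hp₂⟩, mem_iInter.2 hp₃, hp₄⟩, fun z hz => hN₁V hz.1.1,
    fun z hz => (hÂA z hz.1.2).2.1, fun f z => - Λ z (Â z (R m f z) + ∑ k : Fin m,
      B' k z (iteratedFDeriv ℝ k f z + R k f z)), ?_, Λ, ?_, ?_⟩
  · refine IsDiffExpr.clm (L := fun z => -Λ z) ?_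
      (hΛ.mono fun z hz => ⟨hz.1.2.2, hz.1.1.2, hz.2⟩).neg
    refine IsDiffExpr.add ((isDiffExpr_mono_set (hR m) fun z hz => hz.1.1.1).clm
      (hÂ.mono fun z hz => ⟨hz.1.1.2, hz.2⟩)) (IsDiffExpr.sum _ fun k _ => ?_)
    refine ((IsDiffExpr.iteratedFDeriv k.2).add ((isDiffExpr_mono_set (hR k)
      fun z hz => hz.1.1.1).mono k.2.le)).clm ((hB's k).mono fun z hz => ?_)
    exact ⟨mem_iInter.1 hz.1.2.1 k, hz.2⟩
  · exact hΛ.mono fun z hz => ⟨hz.1.2.2, hz.1.1.2, hz.2⟩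
  · intro u z hz hu
    set f := coordRep n F p u
    have hzV := hN₁V hz.1.1.1
    have h1 := (tensRep_iff hzV).1 (hRrep m u z hz.1.1.1 hu)
    have h2 : ∀ k : Fin m, iterCov D DV u k (c.symm z) = _ := fun k =>
      (tensRep_iff hzV).1 (hRrep k u z hz.1.1.1 (hu.of_le (by exact_mod_cast k.2.le)))
    have h3 : fibreCoord G W p (c.symm z) (diffOp D DV m A B u (c.symm z)) =
        Â z (iteratedFDeriv ℝ m f z + R m f z) + ∑ k : Fin m,
          B' k z (iteratedFDeriv ℝ k f z + R k f z) := by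
      rw [diffOp, h1, Finset.sum_range, map_add, map_sum, (hÂA z hz.1.1.2).2.2]
      congr 1
      refine Finset.sum_congr rfl fun k _ => ?_
      rw [h2, (hB'B k z (mem_iInter.1 hz.1.2.1 k)).2.2]
    have h4 := hΛA z ⟨hz.1.2.2, hz.1.1.2, hz.2⟩ _ (iteratedFDeriv_mem_symmetricMaps hu)
    rw [h3]
    simp only [map_add, map_sum] at h4 ⊢
    rw [h4]
    abel

end Coefficients

/-! ### From an equation for the highest derivatives to a first order system for jets. -/

section Jets

variable {E F : Type*} [NormedAddCommGroup E] [NormedSpace ℝ E] [FiniteDimensional ℝ E]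
  [NormedAddCommGroup F] [NormedSpace ℝ F] [FiniteDimensional ℝ F]

variable (E F) in
/-- The space of jets of order less than `m`. -/
def JetSpace (m : ℕ) : Type _ := Π k : Fin m, E [×(k : ℕ)]→L[ℝ] F

instance (m : ℕ) : NormedAddCommGroup (JetSpace E F m) :=
  inferInstanceAs (NormedAddCommGroup (Π k : Fin m, E [×(k : ℕ)]→L[ℝ] F))

instance (m : ℕ) : NormedSpace ℝ (JetSpace E F m) :=
  inferInstanceAs (NormedSpace ℝ (Π k : Fin m, E [×(k : ℕ)]→L[ℝ] F))

instance (m : ℕ) : FiniteDimensional ℝ (JetSpace E F m) :=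
  inferInstanceAs (FiniteDimensional ℝ (Π k : Fin m, E [×(k : ℕ)]→L[ℝ] F))

/-- The jet of a function. -/
def jet (m : ℕ) (f : E → F) (z : E) : JetSpace E F m := fun k => iteratedFDeriv ℝ (k : ℕ) f z

variable (E F) in
/-- The components of a jet. -/
def JetSpace.proj {m : ℕ} (k : Fin m) : JetSpace E F m →L[ℝ] E [×(k : ℕ)]→L[ℝ] F :=
  ContinuousLinearMap.proj (R := ℝ) (φ := fun k : Fin m => E [×(k : ℕ)]→L[ℝ] F) k

theorem JetSpace.proj_jet {m : ℕ} (k : Fin m) (f : E → F) (z : E) :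
    JetSpace.proj E F k (jet m f z) = iteratedFDeriv ℝ (k : ℕ) f z := rfl

theorem JetSpace.contDiffOn {X : Type*} [NormedAddCommGroup X] [NormedSpace ℝ X] {m : ℕ}
    {r : ℕ∞ω} {s : Set X} {f : X → JetSpace E F m}
    (hf : ∀ k, ContDiffOn ℝ r (fun x => JetSpace.proj E F k (f x)) s) : ContDiffOn ℝ r f s :=
  contDiffOn_pi.2 hf

theorem JetSpace.hasFDerivAt {X : Type*} [NormedAddCommGroup X] [NormedSpace ℝ X] {m : ℕ}
    {f : X → JetSpace E F m} {f' : X →L[ℝ] JetSpace E F m} {x : X}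
    (hf : ∀ k, HasFDerivAt (fun x => JetSpace.proj E F k (f x))
      ((JetSpace.proj E F k).comp f') x) : HasFDerivAt f f' x :=
  hasFDerivAt_pi'.2 hf

/-- `J k` prescribes the derivative of the `k`-th component as a map with `k + 1` slots; slot 0 is
the direction of differentiation. -/
theorem JetSpace.exists_clm {m : ℕ} (J : ∀ k : Fin m, JetSpace E F m →L[ℝ]
    (E [×((k : ℕ) + 1)]→L[ℝ] F)) : ∃ L : JetSpace E F m →L[ℝ] E →L[ℝ] JetSpace E F m,
      ∀ φ v k w, JetSpace.proj E F k (L φ v) w = J k φ (Fin.cons v w) := by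
  let L₁ : JetSpace E F m → E →L[ℝ] JetSpace E F m := fun φ =>
    ContinuousLinearMap.pi (φ := fun k : Fin m => E [×(k : ℕ)]→L[ℝ] F) fun k =>
      continuousMultilinearCurryLeftEquiv ℝ (fun _ : Fin ((k : ℕ) + 1) => E) F (J k φ)
  have hL₁ : ∀ φ v k w, JetSpace.proj E F k (L₁ φ v) w = J k φ (Fin.cons v w) :=
    fun φ v k w => rfl
  have hext : ∀ a b : JetSpace E F m, (∀ k w, JetSpace.proj E F k a w =
      JetSpace.proj E F k b w) → a = b := fun a b h =>
    funext fun k => ContinuousMultilinearMap.ext fun w => h k w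
  refine ⟨LinearMap.toContinuousLinearMap
    { toFun := L₁
      map_add' := fun a b => ContinuousLinearMap.ext fun v => hext _ _ fun k w => ?_
      map_smul' := fun a b => ContinuousLinearMap.ext fun v => hext _ _ fun k w => ?_ }, hL₁⟩
  · rw [_root_.add_apply, map_add, _root_.add_apply, hL₁, hL₁, hL₁, map_add, _root_.add_apply]
  · rw [RingHom.id_apply, _root_.smul_apply, map_smul, _root_.smul_apply, hL₁, hL₁, map_smul,
      _root_.smul_apply]

/-- An equation for the derivatives of highest order is a closed system for the jets. -/
theorem exists_jetSystem {m : ℕ} {S : Set E} {R : (E → F) → E → E [×(m + 1)]→L[ℝ] F}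
    (hR : IsDiffExpr S (m + 1) R) :
    ∃ Γ : E → JetSpace E F (m + 1) →L[ℝ] E →L[ℝ] JetSpace E F (m + 1), ContDiffOn ℝ ∞ Γ S ∧
      ∀ f, ∀ z ∈ S, ContDiffAt ℝ (m + 1 : ℕ) f z → iteratedFDeriv ℝ (m + 1) f z = R f z →
        HasFDerivAt (jet (m + 1) f) (Γ z (jet (m + 1) f z)) z := by
  obtain ⟨c, hc, hRc⟩ := hR
  have hJ : ∀ k : Fin (m + 1), ∃ J : E → JetSpace E F (m + 1) →L[ℝ]
      (E [×((k : ℕ) + 1)]→L[ℝ] F), ContDiffOn ℝ ∞ J S ∧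
      ∀ f z, iteratedFDeriv ℝ (m + 1) f z = R f z →
        iteratedFDeriv ℝ ((k : ℕ) + 1) f z = J z (jet (m + 1) f z) := by
    rintro ⟨k, hk⟩
    -- Below top order the derivative of a component is the next component; at the top it is
    -- supplied by the equation.
    by_cases h : k + 1 < m + 1
    · exact ⟨fun _ => JetSpace.proj E F ⟨k + 1, h⟩, contDiffOn_const, fun f z _ => rfl⟩
    · obtain rfl : k = m := by omega
      refine ⟨fun z => ∑ l : Fin (k + 1), (c l z).comp (JetSpace.proj E F l),
        ContDiffOn.sum fun l _ => (hc l).clm_comp contDiffOn_const, fun f z h => ?_⟩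
      rw [h, hRc, Finset.sum_range]
      simp only [_root_.sum_apply, ContinuousLinearMap.comp_apply, JetSpace.proj_jet]
  choose J hJs hJ using hJ
  choose Γ hΓ using fun z => JetSpace.exists_clm fun k => J k z
  refine ⟨Γ, ?_, ?_⟩
  · refine contDiffOn_clm_apply.2 fun φ => contDiffOn_clm_apply.2 fun v => JetSpace.contDiffOn
      fun k => contDiffOn_multilinear_apply fun w => ?_
    simp only [hΓ]
    have h1 : ContDiffOn ℝ ∞ (fun z => J k z φ) S := (hJs k).clm_apply contDiffOn_const
    exact (ContinuousMultilinearMap.apply ℝ (fun _ : Fin ((k : ℕ) + 1) => E) F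
      (Fin.cons v w)).contDiff.comp_contDiffOn h1
  · intro f z hz hf hfR
    refine JetSpace.hasFDerivAt fun k => ?_
    have h1 : HasFDerivAt (iteratedFDeriv ℝ (k : ℕ) f) (fderiv ℝ (iteratedFDeriv ℝ (k : ℕ) f) z) z :=
      (hf.differentiableAt_iteratedFDeriv (by exact_mod_cast k.2)).hasFDerivAt
    refine h1.congr_fderiv ?_
    ext v w
    rw [ContinuousLinearMap.comp_apply, hΓ, ← hJ k f z hfR, iteratedFDeriv_succ_eq_comp_left,
      Function.comp_apply, continuousMultilinearCurryLeftEquiv_symm_apply]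
    simp

end Jets

/-! ### Extension of sections across the boundary: local result and gluing. -/

section Extension

variable {n : ℕ} {M : Type*} [TopologicalSpace M] [ChartedSpace (EuclideanSpace ℝ (Fin n)) M]
  [IsManifold (𝓡 n) ∞ M]
  {F : Type*} [NormedAddCommGroup F] [NormedSpace ℝ F]
  {V : M → Type*} [TopologicalSpace (TotalSpace F V)]
  [∀ x, AddCommGroup (V x)] [∀ x, Module ℝ (V x)] [∀ x, TopologicalSpace (V x)]
  [FiberBundle F V] [VectorBundle ℝ F V]

local notation "Eu" => EuclideanSpace ℝ (Fin n)

/-- The domain in the chart at `p`. -/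
def chartDomain (Ω : Set M) (p : M) : Set (EuclideanSpace ℝ (Fin n)) :=
  (chartAt (EuclideanSpace ℝ (Fin n)) p).target ∩
    (chartAt (EuclideanSpace ℝ (Fin n)) p).symm ⁻¹' Ω

theorem isOpen_chartDomain {Ω : Set M} (hΩ : IsOpen Ω) (p : M) :
    IsOpen (chartDomain (n := n) Ω p) :=
  (chartAt Eu p).isOpen_inter_preimage_symm hΩ

theorem mem_closure_chartDomain_iff {Ω : Set M} {p : M} {z : Eu}
    (hz : z ∈ (chartAt Eu p).target) :
    z ∈ closure (chartDomain (n := n) Ω p) ↔ (chartAt Eu p).symm z ∈ closure Ω := by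
  set c := chartAt Eu p
  constructor
  · intro h
    rw [mem_closure_iff_nhdsWithin_neBot] at h ⊢
    have h1 : Filter.Tendsto c.symm (𝓝[chartDomain (n := n) Ω p] z) (𝓝[Ω] (c.symm z)) :=
      tendsto_nhdsWithin_iff.2 ⟨(c.continuousAt_symm hz).tendsto.mono_left nhdsWithin_le_nhds,
        eventually_nhdsWithin_of_forall fun w hw => hw.2⟩
    exact h1.neBot
  · intro h
    have h1 : z ∈ c.symm.source ∩ c.symm ⁻¹' closure Ω := ⟨hz, h⟩
    rw [c.symm.preimage_closure] at h1
    exact c.open_target.inter_closure h1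

theorem exists_boundary_coord {Ω : Set M} (hΩb : HasSmoothBoundary n Ω) {p : M}
    (hp : p ∈ frontier Ω) : ∃ r : Eu → ℝ, ContDiffAt ℝ ∞ r (chartAt Eu p p) ∧
      fderiv ℝ r (chartAt Eu p p) ≠ 0 ∧ r (chartAt Eu p p) = 0 ∧
      ∀ᶠ z in 𝓝 (chartAt Eu p p), z ∈ chartDomain (n := n) Ω p ↔ 0 < r z := by
  obtain ⟨r, hr, hrd, hr0, hrΩ⟩ := hΩb p hp
  set c := chartAt Eu p
  have hct : c p ∈ c.target := mem_chart_target Eu p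
  have hcp : c.symm (c p) = p := c.left_inv (mem_chart_source Eu p)
  refine ⟨r ∘ c.symm, ?_, ?_, by simpa [hcp] using hr0, ?_⟩
  · have h2 : ContMDiffAt 𝓘(ℝ, Eu) (𝓡 n) ∞ c.symm (c p) :=
      (contMDiffOn_chart_symm (I := 𝓡 n) (n := ∞) (x := p)).contMDiffAt
        (c.open_target.mem_nhds hct)
    rw [← hcp] at hr
    exact contMDiffAt_iff_contDiffAt.1 (hr.comp (c p) h2)
  · intro h0
    apply hrd
    have hr' : MDifferentiableAt (𝓡 n) 𝓘(ℝ, ℝ) r (c.symm (c p)) := by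
      rw [hcp]; exact hr.mdifferentiableAt (by simp)
    have h1 := mvfderiv_eq_fderiv_coord hct hr'
    have h2 : mvfderiv (𝓡 n) r (c.symm (c p)) = 0 := by
      ext X
      rw [h1 X, h0]
      rfl
    rwa [hcp] at h2
  · filter_upwards [eventually_symm_of_eventually hct (by rw [hcp]; exact hrΩ),
      c.open_target.mem_nhds hct] with z hz hzt
    exact ⟨fun h => hz.1 h.2, fun h => ⟨hzt, hz.2 h⟩⟩

theorem hasConeProperty_chartDomain {Ω : Set M} (hΩ : IsOpen Ω) (hΩb : HasSmoothBoundary n Ω)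
    {p : M} (hp : p ∈ closure Ω) : HasConeProperty (chartDomain (n := n) Ω p) (chartAt Eu p p) := by
  by_cases h : p ∈ Ω
  · refine hasConeProperty_of_mem (isOpen_chartDomain hΩ p) ⟨mem_chart_target Eu p, ?_⟩
    simpa only [mem_preimage, (chartAt Eu p).left_inv (mem_chart_source Eu p)] using h
  · obtain ⟨r, hr, hrd, -, hrΩ⟩ := exists_boundary_coord hΩb
      (p := p) (by rw [hΩ.frontier_eq]; exact ⟨hp, h⟩)
    exact hasConeProperty_of_hasStrictFDerivAt (hr.hasStrictFDerivAt (by simp)) hrd hrΩ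

/-- A section whose jet satisfies a closed system of equations extends smoothly up to the boundary
near any point of the closure. -/
theorem exists_local_extension [ContMDiffVectorBundle ∞ F V (𝓡 n)] {Ω : Set M} (hΩ : IsOpen Ω)
    (hΩb : HasSmoothBoundary n Ω) {p : M} (hp : p ∈ closure Ω) {u : ∀ x, V x}
    {X : Type*} [NormedAddCommGroup X] [NormedSpace ℝ X] [FiniteDimensional ℝ X]
    {f : Eu → X} {Γ : Eu → X →L[ℝ] Eu →L[ℝ] X} {N : Set Eu} (hN : N ∈ 𝓝 (chartAt Eu p p))
    (hΓ : ContDiffOn ℝ ∞ Γ (N ∩ (chartAt Eu p).symm ⁻¹' closure Ω))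
    (hf : ∀ z ∈ N ∩ (chartAt Eu p).symm ⁻¹' Ω, HasFDerivAt f (Γ z (f z)) z)
    (pr : X →L[ℝ] F) (hpr : ∀ z ∈ N ∩ (chartAt Eu p).symm ⁻¹' Ω, pr (f z) = coordRep n F p u z) :
    ∃ w : ∀ x, V x, ∃ O ∈ 𝓝 p, SectionOn (n := n) F ∞ w (closure Ω ∩ O) ∧
      ∀ x ∈ Ω ∩ O, w x = u x := by
  set c := chartAt Eu p
  have hct : c p ∈ c.target := mem_chart_target Eu p
  have hcp : c.symm (c p) = p := c.left_inv (mem_chart_source Eu p)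
  set N₁ := N ∩ coordDomain n F V p
  have hN₁ : N₁ ∈ 𝓝 (c p) := Filter.inter_mem hN (coordDomain_mem_nhds p)
  obtain ⟨g, N₂, hN₂, hg, hgf⟩ := exists_contDiffOn_extension
    (U := chartDomain (n := n) Ω p) (p := c p)
    ((mem_closure_chartDomain_iff hct).2 (by rwa [hcp]))
    (hasConeProperty_chartDomain hΩ hΩb hp) hN₁ (Γ := Γ)
    (hΓ.mono fun z hz => ⟨hz.2.1, (mem_closure_chartDomain_iff hz.2.2.1).1 hz.1⟩)
    (f := f) (fun z hz => hf z ⟨hz.2.1, hz.1.2⟩)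
  set O : Set Eu := interior (N₁ ∩ N₂)
  have hpO : c p ∈ O := mem_interior_iff_mem_nhds.2 (Filter.inter_mem hN₁ hN₂)
  have hO : ∀ z ∈ O, z ∈ N₁ ∧ z ∈ N₂ := fun z hz =>
    (interior_subset hz : z ∈ N₁ ∩ N₂)
  refine ⟨fun x => fibreLift F V p x (pr (g (c x))), c.source ∩ c ⁻¹' O,
    (c.isOpen_inter_preimage isOpen_interior).mem_nhds ⟨mem_chart_source Eu p, hpO⟩, ?_, ?_⟩
  · intro x hx
    have e : c.symm (c x) = x := c.left_inv hx.2.1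
    have hxO := hO _ hx.2.2
    have key := (contDiffWithinAt_coordRep_iff (k := ⊤) (p := p)
      (u := fun x => fibreLift F V p x (pr (g (c x)))) (s := closure Ω) (z := c x) hxO.1.2).2 (by
        have h1 : ContDiffWithinAt ℝ ∞ (fun z => pr (g z)) (closure (chartDomain (n := n) Ω p) ∩ N₂)
            (c x) := pr.contDiff.contDiffAt.comp_contDiffWithinAt (c x)
          (hg _ ⟨(mem_closure_chartDomain_iff hxO.1.2.1).2 (by rw [e]; exact hx.1), hxO.2⟩)
        have h2 : closure (chartDomain (n := n) Ω p) ∩ N₂ ∈ 𝓝[c.symm ⁻¹' closure Ω] (c x) := by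
          have h3 : O ∈ 𝓝 (c x) := isOpen_interior.mem_nhds hx.2.2
          filter_upwards [mem_nhdsWithin_of_mem_nhds h3, self_mem_nhdsWithin] with z hz hzΩ
          exact ⟨(mem_closure_chartDomain_iff (hO z hz).1.2.1).2 hzΩ, (hO z hz).2⟩
        refine (h1.mono_of_mem_nhdsWithin h2).congr_of_eventuallyEq ?_ ?_
        · filter_upwards [mem_nhdsWithin_of_mem_nhds ((isOpen_coordDomain p).mem_nhds hxO.1.2)]
            with z hz
          rw [coordRep_eq _ hz, fibreCoord_fibreLift hz, c.right_inv hz.1]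
        · rw [coordRep_eq _ hxO.1.2, fibreCoord_fibreLift hxO.1.2, c.right_inv hxO.1.2.1])
    rw [e] at key
    exact key.mono inter_subset_left
  · intro x hx
    have e : c.symm (c x) = x := c.left_inv hx.2.1
    have hxO := hO _ hx.2.2
    have hxΩ : c x ∈ c.symm ⁻¹' Ω := by simpa only [mem_preimage, e] using hx.1
    have h1 : g (c x) = f (c x) := hgf ⟨⟨hxO.1.2.1, hxΩ⟩, hxO.2⟩
    have h2 : fibreLift F V p (c.symm (c x)) (pr (g (c x))) = u (c.symm (c x)) := by
      rw [h1, hpr _ ⟨hxO.1.1, hxΩ⟩, coordRep_eq u hxO.1.2, fibreLift_fibreCoord hxO.1.2]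
    rwa [e] at h2

/-- Local extensions of a section up to the boundary can be glued. -/
theorem exists_extension_of_local [ContMDiffVectorBundle ∞ F V (𝓡 n)] {Ω : Set M}
    {u : ∀ x, V x} (h : ∀ p ∈ closure Ω, ∃ w : ∀ x, V x, ∃ O ∈ 𝓝 p,
      SectionOn (n := n) F ∞ w (closure Ω ∩ O) ∧ ∀ x ∈ Ω ∩ O, w x = u x) :
    ∃ w : ∀ x, V x, SectionOn (n := n) F ∞ w (closure Ω) ∧ ∀ x ∈ Ω, w x = u x := by
  classical
  choose! w O hO hw hwu using h
  -- At a boundary point `x` the value is taken from the local extension centred at `x` itself.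
  refine ⟨fun x => if x ∈ Ω then u x else w x x, fun p hp => ?_, fun x hx => if_pos hx⟩
  have h1 : ContMDiffWithinAt (𝓡 n) ((𝓡 n).prod 𝓘(ℝ, F)) ∞
      (fun x => TotalSpace.mk' F x (w p x)) (closure Ω) p :=
    (hw p hp p ⟨hp, mem_of_mem_nhds (hO p hp)⟩).mono_of_mem_nhdsWithin
      (Filter.inter_mem self_mem_nhdsWithin (mem_nhdsWithin_of_mem_nhds (hO p hp)))
  have hcont : ∀ q ∈ closure Ω, ∀ y ∈ closure Ω ∩ O q, ContinuousWithinAt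
      (fun x => (trivializationAt F V y ⟨x, w q x⟩).2) (closure Ω ∩ O q) y := fun q hq y hy =>
    (contMDiffWithinAt_section.1 (hw q hq y hy)).continuousWithinAt
  -- Two local extensions agree at a common boundary point: both are continuous within the closure
  -- and equal `u` in Ω, so both values are the limit of `u` from inside.
  have key : ∀ y ∈ closure Ω ∩ interior (O p),
      (if y ∈ Ω then u y else w y y) = w p y := by
    intro y hy
    have hyO : y ∈ O p := interior_subset hy.2
    split_ifs with hyΩ
    · exact (hwu p hp y ⟨hyΩ, hyO⟩).symm
    have hOp : O p ∈ 𝓝 y := mem_interior_iff_mem_nhds.1 hy.2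
    have hOy : O y ∈ 𝓝 y := hO y hy.1
    have : (𝓝[Ω] y).NeBot := mem_closure_iff_nhdsWithin_neBot.1 hy.1
    have hle : ∀ {A : Set M}, A ∈ 𝓝 y → 𝓝[Ω] y ≤ 𝓝[closure Ω ∩ A] y := fun hA =>
      nhdsWithin_le_of_mem (Filter.inter_mem
        (Filter.mem_of_superset self_mem_nhdsWithin subset_closure)
        (mem_nhdsWithin_of_mem_nhds hA))
    have t1 := (hcont y hy.1 y ⟨hy.1, mem_of_mem_nhds hOy⟩).tendsto.mono_left (hle hOy)
    have t2 := (hcont p hp y ⟨hy.1, hyO⟩).tendsto.mono_left (hle hOp)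
    have t3 : (fun x => (trivializationAt F V y ⟨x, w y x⟩).2) =ᶠ[𝓝[Ω] y]
        fun x => (trivializationAt F V y ⟨x, w p x⟩).2 := by
      filter_upwards [self_mem_nhdsWithin, mem_nhdsWithin_of_mem_nhds hOy,
        mem_nhdsWithin_of_mem_nhds hOp] with x hx hxy hxp
      rw [hwu y hy.1 x ⟨hx, hxy⟩, hwu p hp x ⟨hx, hxp⟩]
    have h2 := tendsto_nhds_unique (t1.congr' t3) t2
    have hb := FiberBundle.mem_baseSet_trivializationAt' (F := F) (E := V) y
    rw [← Trivialization.continuousLinearMapAt_apply_of_mem ℝ _ hb,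
      ← Trivialization.continuousLinearMapAt_apply_of_mem ℝ _ hb] at h2
    rw [← (trivializationAt F V y).symmL_continuousLinearMapAt (R := ℝ) hb (w y y), h2,
      (trivializationAt F V y).symmL_continuousLinearMapAt (R := ℝ) hb (w p y)]
  refine h1.congr_of_eventuallyEq ?_ ?_
  · filter_upwards [self_mem_nhdsWithin, mem_nhdsWithin_of_mem_nhds
      (isOpen_interior.mem_nhds (mem_interior_iff_mem_nhds.2 (hO p hp)))] with y hy hyO
    rw [key y ⟨hy, hyO⟩]
  · exact congrArg (TotalSpace.mk' F p) (key p ⟨hp, mem_interior_iff_mem_nhds.2 (hO p hp)⟩)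

end Extension

/-! ### Regularity of the kernel of the general operator. -/

section KernelExtension

variable {n : ℕ} {M : Type*} [TopologicalSpace M] [T2Space M]
  [ChartedSpace (EuclideanSpace ℝ (Fin n)) M] [IsManifold (𝓡 n) ∞ M]
  [RiemannianBundle (fun x : M => TangentSpace (𝓡 n) x)]
  [IsContMDiffRiemannianBundle (𝓡 n) ∞ (EuclideanSpace ℝ (Fin n))
    (fun x : M => TangentSpace (𝓡 n) x)]
  {F : Type*} [NormedAddCommGroup F] [NormedSpace ℝ F]
  {V : M → Type*} [TopologicalSpace (TotalSpace F V)]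
  [∀ x, NormedAddCommGroup (V x)] [∀ x, InnerProductSpace ℝ (V x)]
  [FiberBundle F V] [VectorBundle ℝ F V]
  {G : Type*} [NormedAddCommGroup G] [NormedSpace ℝ G]
  {W : M → Type*} [TopologicalSpace (TotalSpace G W)]
  [∀ x, NormedAddCommGroup (W x)] [∀ x, InnerProductSpace ℝ (W x)]
  [FiberBundle G W] [VectorBundle ℝ G W]

local notation "Eu" => EuclideanSpace ℝ (Fin n)

theorem contDiffAt_coordRep_of_isOpen {F : Type*} [NormedAddCommGroup F] [NormedSpace ℝ F]
    {V : M → Type*} [TopologicalSpace (TotalSpace F V)]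
    [∀ x, AddCommGroup (V x)] [∀ x, Module ℝ (V x)] [∀ x, TopologicalSpace (V x)]
    [FiberBundle F V] [VectorBundle ℝ F V] [ContMDiffVectorBundle ∞ F V (𝓡 n)] {Ω : Set M}
    (hΩ : IsOpen Ω) {k : ℕ∞} {u : ∀ x, V x} (hu : SectionOn (n := n) F k u Ω) {p : M} {z : Eu}
    (hz : z ∈ coordDomain n F V p) (hzΩ : (chartAt Eu p).symm z ∈ Ω) :
    ContDiffAt ℝ k (coordRep n F p u) z := by
  refine ((contDiffWithinAt_coordRep_iff hz).1 (hu _ hzΩ)).contDiffAt ?_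
  exact ((chartAt Eu p).continuousAt_symm hz.1).preimage_mem_nhds (hΩ.mem_nhds hzΩ)

/-- With `P*u = 0` the identity for the top derivatives closes the system for the jet of order `m -
1`, which is differentiable when `u` is C^m. The section is recovered from the component of order 0.
-/
theorem kernelExtends_diffOp [FiniteDimensional ℝ F] [ContMDiffVectorBundle ∞ F V (𝓡 n)]
    [FiniteDimensional ℝ G] [ContMDiffVectorBundle ∞ G W (𝓡 n)]
    {D : CovariantDerivative (𝓡 n) (EuclideanSpace ℝ (Fin n)) (fun x : M => TangentSpace (𝓡 n) x)}
    (hD : CovariantDerivative.ContMDiffCovariantDerivative D ∞)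
    {DV : CovariantDerivative (𝓡 n) F V}
    (hDV : CovariantDerivative.ContMDiffCovariantDerivative DV ∞)
    {Ω : Set M} (hΩ : IsOpen Ω) (hΩb : HasSmoothBoundary n Ω) {m : ℕ} (hm : 0 < m)
    {A : ∀ x, Tens n V m x →ₗ[ℝ] W x} {B : ∀ k x, Tens n V k x →ₗ[ℝ] W x}
    (hA : IsSmoothCoeff F G A (closure Ω)) (hB : ∀ k < m, IsSmoothCoeff F G (B k) (closure Ω))
    (hinj : ∀ x ∈ closure Ω, ∀ T : Tens n V m x, IsSymmTens T → A x T = 0 → T = 0) :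
    KernelExtends n F Ω m ∞ (diffOp D DV m A B) := by
  intro u hu hPu
  obtain ⟨m, rfl⟩ := Nat.exists_eq_succ_of_ne_zero hm.ne'
  refine exists_extension_of_local fun p hp => ?_
  obtain ⟨N, hN, hpN, hNV, -, R, hR, Λ, -, hRΛ⟩ :=
    exists_iteratedFDeriv_eq hD hDV hA hB hp (hinj p hp)
  obtain ⟨Γ, hΓ, hjet⟩ := exists_jetSystem hR
  refine exists_local_extension hΩ hΩb hp (f := jet (m + 1) (coordRep n F p u)) (Γ := Γ)
    (hN.mem_nhds hpN) hΓ (fun z hz => ?_)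
    ((ContinuousMultilinearMap.apply ℝ (fun _ => Eu) F 0).comp
      (JetSpace.proj Eu F (0 : Fin (m + 1)))) (fun z hz => ?_)
  · have hz' : z ∈ N ∩ (chartAt Eu p).symm ⁻¹' closure Ω := ⟨hz.1, subset_closure hz.2⟩
    have hu' : ContDiffAt ℝ (m + 1 : ℕ) (coordRep n F p u) z :=
      contDiffAt_coordRep_of_isOpen hΩ (k := (m + 1 : ℕ)) hu (hNV hz.1) hz.2
    refine hjet _ z hz' hu' ?_
    rw [hRΛ u z hz' hu', hPu _ hz.2, map_zero, map_zero, add_zero]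
  · rw [ContinuousLinearMap.comp_apply, JetSpace.proj_jet]
    exact iteratedFDeriv_zero_apply (𝕜 := ℝ) (f := coordRep n F p u) (x := z) 0

/-- Smooth sections are C^k and smooth extensions are C^{m-1}, so (KRC) is the weaker property. -/
theorem satisfiesKRC_of_kernelExtends {F : Type*} [NormedAddCommGroup F] [NormedSpace ℝ F]
    {V : M → Type*} [TopologicalSpace (TotalSpace F V)] [∀ x, TopologicalSpace (V x)]
    [FiberBundle F V] {W : M → Type*} [∀ x, Zero (W x)] {Ω : Set M} {m : ℕ} {k : ℕ∞}
    {Q : (∀ x, V x) → ∀ x, W x} (h : KernelExtends n F Ω k ∞ Q) : SatisfiesKRC n F Ω m Q := by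
  intro u hu hQ
  obtain ⟨w, hw, hwu⟩ := h u (hu.of_le (by exact_mod_cast le_top)) hQ
  have hle : (((m - 1 : ℕ) : ℕ∞) : ℕ∞ω) ≤ (∞ : ℕ∞ω) := by exact_mod_cast le_top
  exact ⟨w, hw.of_le hle, hwu⟩

end KernelExtension

/-! ### Calculus of partial derivatives. -/

section PartialDerivatives

variable {n : ℕ}

/-- The partial derivative of a function on `ℝⁿ`. -/
def pd (i : Fin n) (g : EuclideanSpace ℝ (Fin n) → ℝ) (z : EuclideanSpace ℝ (Fin n)) : ℝ :=
  fderiv ℝ g z (EuclideanSpace.single i 1)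

variable {U : Set (EuclideanSpace ℝ (Fin n))} {g h : EuclideanSpace ℝ (Fin n) → ℝ}

theorem contDiffOn_pd (hU : IsOpen U) (hg : ContDiffOn ℝ ∞ g U) (i : Fin n) :
    ContDiffOn ℝ ∞ (pd i g) U :=
  (hg.fderiv_of_isOpen (m := ∞) hU (by simp)).clm_apply contDiffOn_const

theorem pd_congr (hU : IsOpen U) (hgh : EqOn g h U) (i : Fin n) : EqOn (pd i g) (pd i h) U := by
  intro z hz
  rw [pd, pd, Filter.EventuallyEq.fderiv_eq (Filter.eventuallyEq_of_mem (hU.mem_nhds hz) hgh)]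

theorem pd_add {z : EuclideanSpace ℝ (Fin n)} (hg : DifferentiableAt ℝ g z) (hh : DifferentiableAt ℝ h z) (i : Fin n) :
    pd i (fun z => g z + h z) z = pd i g z + pd i h z := by
  rw [pd, fderiv_fun_add hg hh]; rfl

theorem pd_mul {z : EuclideanSpace ℝ (Fin n)} (hg : DifferentiableAt ℝ g z) (hh : DifferentiableAt ℝ h z) (i : Fin n) :
    pd i (fun z => g z * h z) z = g z * pd i h z + pd i g z * h z := by
  rw [pd, fderiv_fun_mul hg hh]
  simp [pd, mul_comm]

theorem pd_sum {ι : Type*} {t : Finset ι} {g : ι → EuclideanSpace ℝ (Fin n) → ℝ} {z : EuclideanSpace ℝ (Fin n)}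
    (hg : ∀ a ∈ t, DifferentiableAt ℝ (g a) z) (i : Fin n) :
    pd i (fun z => ∑ a ∈ t, g a z) z = ∑ a ∈ t, pd i (g a) z := by
  rw [pd, fderiv_fun_sum hg]
  simp [pd]

theorem pd_comm (hU : IsOpen U) (hg : ContDiffOn ℝ ∞ g U) {z : EuclideanSpace ℝ (Fin n)} (hz : z ∈ U) (i j : Fin n) :
    pd i (pd j g) z = pd j (pd i g) z := by
  have hgz : ContDiffAt ℝ ∞ g z := hg.contDiffAt (hU.mem_nhds hz)
  have hd : DifferentiableAt ℝ (fderiv ℝ g) z :=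
    (hgz.fderiv_right (m := ∞) (by simp)).differentiableAt (by simp)
  have h1 : ∀ i j, pd i (pd j g) z =
      fderiv ℝ (fderiv ℝ g) z (EuclideanSpace.single i 1) (EuclideanSpace.single j 1) := by
    intro i j
    have h2 := hd.hasFDerivAt.clm_apply (hasFDerivAt_const (EuclideanSpace.single j (1 : ℝ)) z)
    have h3 : pd j g = fun y => fderiv ℝ g y (EuclideanSpace.single j 1) := rfl
    rw [pd, h3, h2.fderiv]
    simp
  rw [h1, h1]
  have h2 : ContDiffAt ℝ 2 g z := hgz.of_le (WithTop.coe_le_coe.2 (le_top : (2 : ℕ∞) ≤ ⊤))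
  exact (h2.isSymmSndFDerivAt (by simp)) _ _

end PartialDerivatives

/-! ### Prolongation of the Killing equation. -/

section LinearCombinations

variable {n : ℕ} {ι : Type*} [Fintype ι]

/-- On `U`, the function `g` is a linear combination of the components of `f`, with coefficients
that are smooth on `N`. -/
def IsLinComb (N U : Set (EuclideanSpace ℝ (Fin n))) (f : EuclideanSpace ℝ (Fin n) → ι → ℝ)
    (g : EuclideanSpace ℝ (Fin n) → ℝ) : Prop :=
  ∃ L : EuclideanSpace ℝ (Fin n) → (ι → ℝ) →L[ℝ] ℝ, ContDiffOn ℝ ∞ L N ∧ ∀ z ∈ U, g z = L z (f z)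

variable {N U : Set (EuclideanSpace ℝ (Fin n))} {f : EuclideanSpace ℝ (Fin n) → ι → ℝ} {g h c : EuclideanSpace ℝ (Fin n) → ℝ}

namespace IsLinComb

theorem congr (hg : IsLinComb N U f g) (hgh : ∀ z ∈ U, h z = g z) : IsLinComb N U f h := by
  obtain ⟨L, hL, hLg⟩ := hg
  exact ⟨L, hL, fun z hz => (hgh z hz).trans (hLg z hz)⟩

theorem add (hg : IsLinComb N U f g) (hh : IsLinComb N U f h) :
    IsLinComb N U f fun z => g z + h z := by
  obtain ⟨L, hL, hLg⟩ := hg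
  obtain ⟨L', hL', hLh⟩ := hh
  exact ⟨fun z => L z + L' z, hL.add hL', fun z hz => by simp [hLg z hz, hLh z hz]⟩

theorem mul (hc : ContDiffOn ℝ ∞ c N) (hg : IsLinComb N U f g) :
    IsLinComb N U f fun z => c z * g z := by
  obtain ⟨L, hL, hLg⟩ := hg
  exact ⟨fun z => c z • L z, hc.smul hL, fun z hz => by simp [hLg z hz]⟩

theorem const_mul (r : ℝ) (hg : IsLinComb N U f g) : IsLinComb N U f fun z => r * g z :=
  mul contDiffOn_const hg

theorem sub (hg : IsLinComb N U f g) (hh : IsLinComb N U f h) :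
    IsLinComb N U f fun z => g z - h z :=
  (hg.add (hh.const_mul (-1))).congr fun z _ => by ring

theorem sum {κ : Type*} (t : Finset κ) {g : κ → EuclideanSpace ℝ (Fin n) → ℝ} (hg : ∀ a ∈ t, IsLinComb N U f (g a)) :
    IsLinComb N U f fun z => ∑ a ∈ t, g a z := by
  choose! L hL hLg using hg
  refine ⟨fun z => ∑ a ∈ t, L a z, ContDiffOn.sum fun a ha => hL a ha, fun z hz => ?_⟩
  rw [_root_.sum_apply]
  exact Finset.sum_congr rfl fun a ha => hLg a ha z hz

theorem component (α : ι) : IsLinComb N U f fun z => f z α :=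
  ⟨fun _ => ContinuousLinearMap.proj α, contDiffOn_const, fun _ _ => rfl⟩

/-- A system of equations expressing the partial derivatives of all components. -/
theorem exists_system (hU : IsOpen U) (hf : ∀ α, ContDiffOn ℝ ∞ (fun z => f z α) U)
    (h : ∀ α i, IsLinComb N U f (pd i fun z => f z α)) :
    ∃ Γ : EuclideanSpace ℝ (Fin n) → (ι → ℝ) →L[ℝ] EuclideanSpace ℝ (Fin n) →L[ℝ] (ι → ℝ), ContDiffOn ℝ ∞ Γ N ∧
      ∀ z ∈ U, HasFDerivAt f (Γ z (f z)) z := by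
  choose L hL hLf using h
  refine ⟨fun z => LinearMap.toContinuousLinearMap
    { toFun := fun φ => ContinuousLinearMap.pi fun α => ∑ i, L α i z φ • EuclideanSpace.proj i
      map_add' := fun a b => by ext; simp [add_mul, Finset.sum_add_distrib]
      map_smul' := fun a b => by ext; simp [Finset.mul_sum, mul_assoc] }, ?_, fun z hz => ?_⟩
  · refine contDiffOn_clm_apply.2 fun φ => contDiffOn_clm_apply.2 fun v => contDiffOn_pi.2
      fun α => ?_
    simp only [LinearMap.coe_toContinuousLinearMap', LinearMap.coe_mk, AddHom.coe_mk,
      ContinuousLinearMap.coe_pi', _root_.sum_apply, _root_.smul_apply]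
    exact ContDiffOn.sum fun i _ => ((hL α i).clm_apply contDiffOn_const).smul contDiffOn_const
  · refine hasFDerivAt_pi.2 fun α => ?_
    have h1 : HasFDerivAt (fun z => f z α) (fderiv ℝ (fun z => f z α) z) z :=
      (((hf α).contDiffAt (hU.mem_nhds hz)).differentiableAt (by simp)).hasFDerivAt
    refine h1.congr_fderiv ?_
    ext v
    have hv : v = ∑ i, (v i) • EuclideanSpace.single i (1 : ℝ) :=
      ((EuclideanSpace.basisFun (Fin n) ℝ).sum_repr v).symm.trans (by simp)
    conv_lhs => rw [hv, map_sum]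
    rw [_root_.sum_apply]
    refine Finset.sum_congr rfl fun i _ => ?_
    rw [map_smul, _root_.smul_apply, ← hLf α i z hz]
    simp [pd, mul_comm]

end IsLinComb

/-- The function and its partial derivatives are linear combinations of the components of `f`. -/
structure IsLinCombOne (N U : Set (EuclideanSpace ℝ (Fin n)))
    (f : EuclideanSpace ℝ (Fin n) → ι → ℝ) (g : EuclideanSpace ℝ (Fin n) → ℝ) : Prop where
  contDiffOn : ContDiffOn ℝ ∞ g U
  isLinComb : IsLinComb N U f g
  pd_isLinComb : ∀ i, IsLinComb N U f (pd i g)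

namespace IsLinCombOne

theorem add (hU : IsOpen U) (hg : IsLinCombOne N U f g) (hh : IsLinCombOne N U f h) :
    IsLinCombOne N U f fun z => g z + h z where
  contDiffOn := hg.1.add hh.1
  isLinComb := hg.2.add hh.2
  pd_isLinComb i := ((hg.3 i).add (hh.3 i)).congr fun _ hz =>
    pd_add ((hg.1.contDiffAt (hU.mem_nhds hz)).differentiableAt (by simp))
      ((hh.1.contDiffAt (hU.mem_nhds hz)).differentiableAt (by simp)) i

theorem mul (hU : IsOpen U) (hN : IsOpen N) (hUN : U ⊆ N) (hc : ContDiffOn ℝ ∞ c N)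
    (hg : IsLinCombOne N U f g) : IsLinCombOne N U f fun z => c z * g z where
  contDiffOn := (hc.mono hUN).mul hg.1
  isLinComb := hg.2.mul hc
  pd_isLinComb i := ((hg.3 i).mul hc |>.add (hg.2.mul (contDiffOn_pd hN hc i))).congr fun _ hz =>
    pd_mul ((hc.contDiffAt (hN.mem_nhds (hUN hz))).differentiableAt (by simp))
      ((hg.1.contDiffAt (hU.mem_nhds hz)).differentiableAt (by simp)) i

theorem sum {κ : Type*} (hU : IsOpen U) (t : Finset κ) {g : κ → EuclideanSpace ℝ (Fin n) → ℝ}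
    (hg : ∀ a ∈ t, IsLinCombOne N U f (g a)) : IsLinCombOne N U f fun z => ∑ a ∈ t, g a z where
  contDiffOn := ContDiffOn.sum fun a ha => (hg a ha).1
  isLinComb := .sum t fun a ha => (hg a ha).2
  pd_isLinComb i := (IsLinComb.sum t fun a ha => (hg a ha).3 i).congr fun _ hz =>
    pd_sum (fun a ha => ((hg a ha).1.contDiffAt (hU.mem_nhds hz)).differentiableAt (by simp)) i

end IsLinCombOne

/-- The second derivatives of a one-form are determined by the symmetrized first derivatives. -/
theorem pd_pd_eq_of_symm (hU : IsOpen U) {a : Fin n → EuclideanSpace ℝ (Fin n) → ℝ} (ha : ∀ k, ContDiffOn ℝ ∞ (a k) U)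
    {S : Fin n → Fin n → EuclideanSpace ℝ (Fin n) → ℝ} (hS : ∀ j k, ∀ z ∈ U, pd j (a k) z + pd k (a j) z = S j k z)
    {z : EuclideanSpace ℝ (Fin n)} (hz : z ∈ U) (i j k : Fin n) :
    pd i (pd j (a k)) z = 1 / 2 * (pd i (S j k) z + pd j (S i k) z - pd k (S i j) z) := by
  have h1 : ∀ i j k, pd i (S j k) z = pd i (pd j (a k)) z + pd i (pd k (a j)) z := by
    intro i j k
    rw [← pd_congr hU (hS j k) i hz]
    exact pd_add (((contDiffOn_pd hU (ha k) j).contDiffAt (hU.mem_nhds hz)).differentiableAt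
      (by simp)) (((contDiffOn_pd hU (ha j) k).contDiffAt (hU.mem_nhds hz)).differentiableAt
      (by simp)) i
  -- The Christoffel trick: once partial derivatives commute, four of the six second derivatives
  -- cancel and the other two coincide.
  rw [h1, h1, h1, pd_comm hU (ha i) hz j k, pd_comm hU (ha k) hz j i, pd_comm hU (ha j) hz k i]
  ring

/-- The Killing equation is a closed system for a one-form and its first derivatives. -/
theorem exists_killing_system (hN : IsOpen N) (hU : IsOpen U) (hUN : U ⊆ N)
    {a : Fin n → EuclideanSpace ℝ (Fin n) → ℝ} (ha : ∀ k, ContDiffOn ℝ ∞ (a k) U)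
    {s : Fin n → Fin n → Fin n → EuclideanSpace ℝ (Fin n) → ℝ} (hs : ∀ j k l, ContDiffOn ℝ ∞ (s j k l) N)
    (hK : ∀ j k, ∀ z ∈ U, pd j (a k) z + pd k (a j) z = ∑ l, s j k l z * a l z) :
    ∃ f : EuclideanSpace ℝ (Fin n) → Fin n ⊕ Fin n × Fin n → ℝ, (∀ k z, f z (.inl k) = a k z) ∧
      ∃ Γ : EuclideanSpace ℝ (Fin n) → (Fin n ⊕ Fin n × Fin n → ℝ) →L[ℝ] EuclideanSpace ℝ (Fin n) →L[ℝ] (Fin n ⊕ Fin n × Fin n → ℝ),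
        ContDiffOn ℝ ∞ Γ N ∧ ∀ z ∈ U, HasFDerivAt f (Γ z (f z)) z := by
  -- The unknowns are the components of the form and all their first derivatives.
  set f : EuclideanSpace ℝ (Fin n) → Fin n ⊕ Fin n × Fin n → ℝ := fun z =>
    Sum.elim (fun k => a k z) fun jk => pd jk.1 (a jk.2) z
  refine ⟨f, fun k z => rfl, ?_⟩
  have ha1 : ∀ k, IsLinCombOne N U f (a k) := fun k =>
    ⟨ha k, IsLinComb.component (Sum.inl k), fun i => IsLinComb.component (Sum.inr (i, k))⟩
  have hS : ∀ j k, IsLinCombOne N U f fun z => ∑ l, s j k l z * a l z := fun j k =>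
    .sum hU _ fun l _ => .mul hU hN hUN (hs j k l) (ha1 l)
  refine IsLinComb.exists_system hU ?_ ?_
  · rintro (k | ⟨j, k⟩)
    · exact ha k
    · exact contDiffOn_pd hU (ha k) j
  · rintro (k | ⟨j, k⟩) i
    · exact (ha1 k).3 i
    · refine IsLinComb.congr ?_ fun z hz => pd_pd_eq_of_symm hU ha hK hz i j k
      exact ((((hS j k).3 i).add ((hS i k).3 j)).sub ((hS i j).3 k)).const_mul _

end LinearCombinations

/-! ### One-forms in coordinates and the Killing operator. -/

section OneForms

variable {n : ℕ} {M : Type*} [TopologicalSpace M] [ChartedSpace (EuclideanSpace ℝ (Fin n)) M]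
  [IsManifold (𝓡 n) ∞ M]

local notation "Eu" => EuclideanSpace ℝ (Fin n)

local notation "TM" => (fun x : M => TangentSpace (𝓡 n) x)

theorem coordDomain_cotangent (p : M) :
    coordDomain n (EuclideanSpace ℝ (Fin n) →L[ℝ] ℝ) (fun x : M => Cotangent n x) p =
      (chartAt Eu p).target := by
  have : IsManifold (𝓡 n) 1 M := .of_le (n := ∞) (by simp)
  ext z
  exact ⟨fun h => h.1, fun h => ⟨h, (chartAt Eu p).map_target h, trivial⟩⟩

theorem coordRep_cotangent_apply (η : ∀ x : M, Cotangent n x) {p : M} {z : Eu}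
    (hz : z ∈ (chartAt Eu p).target) (Y : TangentSpace (𝓡 n) ((chartAt Eu p).symm z)) :
    coordRep n (EuclideanSpace ℝ (Fin n) →L[ℝ] ℝ) p η z
      (fibreCoord Eu TM p ((chartAt Eu p).symm z) Y) = η ((chartAt Eu p).symm z) Y := by
  have : IsManifold (𝓡 n) 1 M := .of_le (n := ∞) (by simp)
  have hzt : z ∈ coordDomain n Eu TM p := by rw [coordDomain_tangent]; exact hz
  rw [coordRep, hom_trivializationAt_apply]
  simp only [ContinuousLinearMap.inCoordinates, ContinuousLinearMap.comp_apply]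
  rw [fibreLift_fibreCoord hzt]
  simp

/-- The covariant derivative of a one-form in coordinates. -/
theorem exists_covOneForm_coord [T2Space M]
    {D : CovariantDerivative (𝓡 n) (EuclideanSpace ℝ (Fin n)) (fun x : M => TangentSpace (𝓡 n) x)}
    (hD : CovariantDerivative.ContMDiffCovariantDerivative D ∞) (p : M) :
    ∃ N : Set Eu, IsOpen N ∧ chartAt Eu p p ∈ N ∧ N ⊆ (chartAt Eu p).target ∧
      ∃ γ : Eu → Eu →L[ℝ] Eu →L[ℝ] Eu, ContDiffOn ℝ ∞ γ N ∧ ∀ z ∈ N,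
        ∀ η : ∀ x : M, Cotangent n x,
        DifferentiableAt ℝ (coordRep n (EuclideanSpace ℝ (Fin n) →L[ℝ] ℝ) p η) z →
        ∀ X Y : TangentSpace (𝓡 n) ((chartAt Eu p).symm z),
          covOneForm D η ((chartAt Eu p).symm z) X Y =
            fderiv ℝ (coordRep n (EuclideanSpace ℝ (Fin n) →L[ℝ] ℝ) p η) z
              (fibreCoord Eu TM p ((chartAt Eu p).symm z) X)
              (fibreCoord Eu TM p ((chartAt Eu p).symm z) Y) -
            coordRep n (EuclideanSpace ℝ (Fin n) →L[ℝ] ℝ) p η z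
              (γ z (fibreCoord Eu TM p ((chartAt Eu p).symm z) Y)
                (fibreCoord Eu TM p ((chartAt Eu p).symm z) X)) := by
  have : IsManifold (𝓡 n) 1 M := .of_le (n := ∞) (by simp)
  obtain ⟨N, hN, hpN, hNV, γ, hγ, hγD⟩ := exists_connectionForm hD p
  have hNt : N ⊆ (chartAt Eu p).target := fun z hz => (hNV hz).1
  refine ⟨N, hN, hpN, hNt, γ, hγ, fun z hz η hη => ?_⟩
  set c := chartAt Eu p
  set x := c.symm z
  set a := coordRep n (EuclideanSpace ℝ (Fin n) →L[ℝ] ℝ) p η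
  intro X Y
  have hzt := hNV hz
  set σ : ∀ x : M, TangentSpace (𝓡 n) x := FiberBundle.extend Eu Y
  have hσm := FiberBundle.mdifferentiableAt_extend (𝓡 n) Eu Y
  have hσ : DifferentiableAt ℝ (coordRep n Eu p (V := TM) σ) z :=
    (mdifferentiableAt_section_iff_coordRep (V := TM) hzt).1 hσm
  have hσx : σ x = Y := FiberBundle.extend_apply_self (F := Eu) (E := TM) Y
  have hσz : coordRep n Eu p (V := TM) σ z = fibreCoord Eu TM p x Y := by
    rw [coordRep_eq (V := TM) _ hzt, hσx]
  set g : M → ℝ := fun y => η y (σ y)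
  have hg : (g ∘ c.symm) =ᶠ[𝓝 z] fun w => a w (coordRep n Eu p (V := TM) σ w) := by
    filter_upwards [hN.mem_nhds hz] with w hw
    rw [coordRep_eq (V := TM) _ (hNV hw)]
    exact (coordRep_cotangent_apply η (hNt hw) _).symm
  have hder := (hη.hasFDerivAt.clm_apply hσ.hasFDerivAt).congr_of_eventuallyEq hg
  have hgm : MDifferentiableAt (𝓡 n) 𝓘(ℝ, ℝ) g x := by
    have hx : x ∈ c.source := c.map_target (hNt hz)
    rw [mdifferentiableAt_iff_source_of_mem_source (x := p) (by simpa using hx)]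
    have e : extChartAt (𝓡 n) p x = z := by simpa using c.right_inv (hNt hz)
    rw [e]
    simpa only [mdifferentiableWithinAt_iff_differentiableWithinAt, mfld_simps,
      differentiableWithinAt_univ] using hder.differentiableAt
  have h1 : mvfderiv (𝓡 n) g x X = _ := mvfderiv_eq_fderiv_coord (hNt hz) hgm X
  have h2 : (η x (D σ x X) : ℝ) = a z (fibreCoord Eu TM p x (D σ x X)) :=
    (coordRep_cotangent_apply η (hNt hz) _).symm
  -- The derivative of the extension of `Y` occurs in both terms and cancels.
  rw [covOneForm, h1, h2, hγD z hz σ hσ X, hder.fderiv, hσz]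
  simp only [_root_.add_apply, ContinuousLinearMap.comp_apply, ContinuousLinearMap.flip_apply,
    map_add]
  ring

/-- The linear map that rebuilds a covector from its components. -/
theorem exists_rebuild {ι : Type*} [Fintype ι] (e : Fin n → ι) :
    ∃ pr : (ι → ℝ) →L[ℝ] Eu →L[ℝ] ℝ, ∀ (f : ι → ℝ) (ξ : Eu →L[ℝ] ℝ),
      (∀ k, f (e k) = ξ (EuclideanSpace.single k 1)) → pr f = ξ := by
  refine ⟨∑ k, (ContinuousLinearMap.proj (e k) : (ι → ℝ) →L[ℝ] ℝ).smulRight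
    (EuclideanSpace.proj k : Eu →L[ℝ] ℝ), fun f ξ h => ?_⟩
  ext v
  have hv : v = ∑ i, (v i) • EuclideanSpace.single i (1 : ℝ) :=
    ((EuclideanSpace.basisFun (Fin n) ℝ).sum_repr v).symm.trans (by simp)
  conv_rhs => rw [hv, map_sum]
  rw [_root_.sum_apply, _root_.sum_apply]
  refine Finset.sum_congr rfl fun k _ => ?_
  simp [h, mul_comm]

theorem pd_clm_apply {E' : Type*} [NormedAddCommGroup E'] [NormedSpace ℝ E']
    {a : Eu → E' →L[ℝ] ℝ} {z : Eu} (ha : DifferentiableAt ℝ a z) (j : Fin n) (v : E') :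
    pd j (fun z => a z v) z = fderiv ℝ a z (EuclideanSpace.single j 1) v := by
  have h := ha.hasFDerivAt.clm_apply (hasFDerivAt_const v z)
  rw [pd, h.fderiv]
  simp

theorem clm_eq_sum (ξ : Eu →L[ℝ] ℝ) (v : Eu) :
    ξ v = ∑ l, v l * ξ (EuclideanSpace.single l 1) := by
  have hv : v = ∑ i, (v i) • EuclideanSpace.single i (1 : ℝ) :=
    ((EuclideanSpace.basisFun (Fin n) ℝ).sum_repr v).symm.trans (by simp)
  conv_lhs => rw [hv, map_sum]
  simp

/-- Elements of the kernel of the Killing operator are smooth up to the boundary. -/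
theorem kernelExtends_killingOp [T2Space M] [RiemannianBundle (fun x : M => TangentSpace (𝓡 n) x)]
    [IsContMDiffRiemannianBundle (𝓡 n) ∞ (EuclideanSpace ℝ (Fin n))
      (fun x : M => TangentSpace (𝓡 n) x)]
    {D : CovariantDerivative (𝓡 n) (EuclideanSpace ℝ (Fin n)) (fun x : M => TangentSpace (𝓡 n) x)}
    (hD : CovariantDerivative.ContMDiffCovariantDerivative D ∞)
    {Ω : Set M} (hΩ : IsOpen Ω) (hΩb : HasSmoothBoundary n Ω) :
    KernelExtends n (EuclideanSpace ℝ (Fin n) →L[ℝ] ℝ) Ω ∞ ∞ (killingOp D) := by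
  intro η hη hK
  have : IsManifold (𝓡 n) 1 M := .of_le (n := ∞) (by simp)
  refine exists_extension_of_local fun p hp => ?_
  obtain ⟨N, hN, hpN, hNt, γ, hγ, hcov⟩ := exists_covOneForm_coord hD p
  set c := chartAt Eu p
  set â := coordRep n (EuclideanSpace ℝ (Fin n) →L[ℝ] ℝ) p η
  set U : Set Eu := N ∩ c.symm ⁻¹' Ω
  have hU : IsOpen U := by
    have h := (isOpen_chartDomain (n := n) hΩ p).inter hN
    refine (congrArg IsOpen (?_ : U = _)).mpr h
    ext z
    exact ⟨fun h => ⟨⟨hNt h.1, h.2⟩, h.1⟩, fun h => ⟨h.2, h.1.2⟩⟩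
  have hâ : ∀ z ∈ U, ContDiffAt ℝ ∞ â z := fun z hz =>
    contDiffAt_coordRep_of_isOpen hΩ (k := ⊤) hη
      (by rw [coordDomain_cotangent]; exact hNt hz.1) hz.2
  have hâd : ∀ z ∈ U, DifferentiableAt ℝ â z := fun z hz => (hâ z hz).differentiableAt (by simp)
  have hLift : ∀ z ∈ U, ∀ v : Eu,
      fibreCoord Eu TM p (c.symm z) (fibreLift Eu TM p (c.symm z) v) = v := fun z hz v =>
    fibreCoord_fibreLift (by rw [coordDomain_tangent]; exact hNt hz.1) v
  -- The coefficients `s` are the symmetrized connection coefficients: on coordinate vectors the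
  -- equation reads `∂_j a_k + ∂_k a_j = ∑ s_{jkl} a_l`.
  obtain ⟨f, hf, Γ, hΓ, hfΓ⟩ := exists_killing_system hN hU inter_subset_left
    (a := fun k z => â z (EuclideanSpace.single k 1))
    (s := fun j k l z => (γ z (EuclideanSpace.single k 1) (EuclideanSpace.single j 1) +
      γ z (EuclideanSpace.single j 1) (EuclideanSpace.single k 1)) l)
    (fun k z hz => ((hâ z hz).contDiffWithinAt).clm_apply contDiffWithinAt_const)
    (fun j k l => by
      refine (EuclideanSpace.proj l : Eu →L[ℝ] ℝ).contDiff.comp_contDiffOn (ContDiffOn.add ?_ ?_)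
      · exact (hγ.clm_apply contDiffOn_const).clm_apply contDiffOn_const
      · exact (hγ.clm_apply contDiffOn_const).clm_apply contDiffOn_const)
    (fun j k z hz => by
      have h1 := congrFun (congrFun (hK _ hz.2)
        (fibreLift Eu TM p (c.symm z) (EuclideanSpace.single j 1)))
        (fibreLift Eu TM p (c.symm z) (EuclideanSpace.single k 1))
      rw [killingOp, hcov z hz.1 η (hâd z hz), hcov z hz.1 η (hâd z hz), hLift z hz,
        hLift z hz] at h1
      have h2 : ∑ l, (γ z (EuclideanSpace.single k 1) (EuclideanSpace.single j 1) +
          γ z (EuclideanSpace.single j 1) (EuclideanSpace.single k 1)) l *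
            â z (EuclideanSpace.single l 1) = â z _ := (clm_eq_sum (â z) _).symm
      rw [pd_clm_apply (hâd z hz), pd_clm_apply (hâd z hz), h2, map_add]
      have h3 : (0 : TwoTensor n (c.symm z))
        (fibreLift Eu TM p (c.symm z) (EuclideanSpace.single j 1))
        (fibreLift Eu TM p (c.symm z) (EuclideanSpace.single k 1)) = 0 := rfl
      rw [h3] at h1
      linarith)
  obtain ⟨pr, hpr⟩ := exists_rebuild (n := n) (Sum.inl : Fin n → Fin n ⊕ Fin n × Fin n)
  exact exists_local_extension hΩ hΩb hp (hN.mem_nhds hpN) (hΓ.mono inter_subset_left) hfΓ pr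
    fun z _ => hpr _ _ fun k => hf k z

end OneForms

/-! ### Prolongation of the conformal Killing equation. -/

section ConformalSystem

variable {n : ℕ}

theorem sum_contract {g h : Fin n → Fin n → ℝ} (hh : ∀ i j, h i j = h j i)
    (hgh : ∀ i j, ∑ k, h i k * g k j = if i = j then 1 else 0) (x : Fin n → ℝ) (j : Fin n) :
    ∑ i, ∑ k, h i k * (x k * g i j) = x j := by
  rw [Finset.sum_comm]
  have h1 : ∀ k, ∑ i, h i k * (x k * g i j) = x k * if k = j then 1 else 0 := fun k => by
    rw [← hgh k j, Finset.mul_sum]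
    exact Finset.sum_congr rfl fun i _ => by rw [hh i k]; ring
  simp [h1]

/-- The contraction of the equation for the Hessian of the conformal factor. -/
theorem sum_contract_hessian {g h Λ : Fin n → Fin n → ℝ} (hg : ∀ i j, g i j = g j i)
    (hh : ∀ i j, h i j = h j i) (hgh : ∀ i j, ∑ k, h i k * g k j = if i = j then 1 else 0)
    (l j : Fin n) :
    ∑ i, ∑ k, h i k * (Λ l j * g i k - Λ l k * g i j - Λ i j * g l k + Λ i k * g l j) =
      ((n : ℝ) - 2) * Λ l j + (∑ i, ∑ k, h i k * Λ i k) * g l j := by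
  have h1 : ∑ i, ∑ k, h i k * (Λ l j * g i k) = n * Λ l j := by
    have : ∀ i, ∑ k, h i k * (Λ l j * g i k) = Λ l j := fun i => by
      have h2 := hgh i i
      rw [if_pos rfl] at h2
      calc ∑ k, h i k * (Λ l j * g i k) = Λ l j * ∑ k, h i k * g k i := by
            rw [Finset.mul_sum]
            exact Finset.sum_congr rfl fun k _ => by rw [hg i k]; ring
        _ = Λ l j := by rw [h2, mul_one]
    simp [this]
  have h2 := sum_contract hh hgh (fun k => Λ l k) j
  have h3 : ∑ i, ∑ k, h i k * (Λ i j * g l k) = Λ l j := by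
    rw [Finset.sum_comm, ← sum_contract hh hgh (fun k => Λ k j) l]
    exact Finset.sum_congr rfl fun i _ => Finset.sum_congr rfl fun k _ => by
      rw [hh i k, hg i l]
  have h4 : ∑ i, ∑ k, h i k * (Λ i k * g l j) = (∑ i, ∑ k, h i k * Λ i k) * g l j := by
    simp only [Finset.sum_mul]
    exact Finset.sum_congr rfl fun i _ => Finset.sum_congr rfl fun k _ => by ring
  have e : ∀ i k, h i k * (Λ l j * g i k - Λ l k * g i j - Λ i j * g l k + Λ i k * g l j) =
      h i k * (Λ l j * g i k) - h i k * (Λ l k * g i j) - h i k * (Λ i j * g l k) +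
        h i k * (Λ i k * g l j) := fun i k => by ring
  simp only [e, Finset.sum_add_distrib, Finset.sum_sub_distrib]
  rw [h1, h2, h3, h4]
  ring

/-- If `n ≥ 3`, the Hessian of the conformal factor is determined by the components of the
curvature type tensor built from it. -/
theorem IsLinComb.hessian {ι : Type*} [Fintype ι] {N U : Set (EuclideanSpace ℝ (Fin n))}
    {f : EuclideanSpace ℝ (Fin n) → ι → ℝ} (hn : 3 ≤ n)
    {g h Λ : Fin n → Fin n → EuclideanSpace ℝ (Fin n) → ℝ} (hUN : U ⊆ N)
    (hgs : ∀ i j, ContDiffOn ℝ ∞ (g i j) N) (hhs : ∀ i j, ContDiffOn ℝ ∞ (h i j) N)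
    (hg : ∀ i j, ∀ z ∈ N, g i j z = g j i z) (hh : ∀ i j, ∀ z ∈ N, h i j z = h j i z)
    (hgh : ∀ i j, ∀ z ∈ N, ∑ k, h i k z * g k j z = if i = j then 1 else 0)
    (hΛ : ∀ l i j k, IsLinComb N U f fun z =>
      Λ l j z * g i k z - Λ l k z * g i j z - Λ i j z * g l k z + Λ i k z * g l j z) (l j : Fin n) :
    IsLinComb N U f (Λ l j) := by
  have hn2 : ((n : ℝ) - 2) ≠ 0 := by
    have : (3 : ℝ) ≤ n := by exact_mod_cast hn
    linarith
  have hn1 : (2 * (n : ℝ) - 2) ≠ 0 := by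
    have : (3 : ℝ) ≤ n := by exact_mod_cast hn
    linarith
  -- First contraction: `(n - 2) Λ + (tr Λ) g` is under control.
  have h1 : ∀ l j, IsLinComb N U f fun z =>
      ((n : ℝ) - 2) * Λ l j z + (∑ i, ∑ k, h i k z * Λ i k z) * g l j z := fun l j =>
    (IsLinComb.sum Finset.univ fun i _ => IsLinComb.sum Finset.univ fun k _ =>
      (hΛ l i j k).mul (hhs i k)).congr fun z hz =>
        (sum_contract_hessian (g := fun i j => g i j z) (h := fun i j => h i j z)
          (Λ := fun i j => Λ i j z) (fun i j => hg i j z (hUN hz)) (fun i j => hh i j z (hUN hz))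
          (fun i j => hgh i j z (hUN hz)) l j).symm
  -- Second contraction: the trace of `(n - 2) Λ + (tr Λ) g` is `(2n - 2) tr Λ`.
  have h2 : IsLinComb N U f fun z => ∑ i, ∑ k, h i k z * Λ i k z := by
    refine ((IsLinComb.sum Finset.univ fun l _ => IsLinComb.sum Finset.univ fun j _ =>
      (h1 l j).mul (hhs l j)).const_mul (2 * (n : ℝ) - 2)⁻¹).congr fun z hz => ?_
    set τ := ∑ i, ∑ k, h i k z * Λ i k z with hτ
    have h3 : ∑ l, ∑ j, h l j z * g l j z = n := by
      have : ∀ l, ∑ j, h l j z * g l j z = 1 := fun l => by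
        have h4 := hgh l l z (hUN hz)
        rw [if_pos rfl] at h4
        rw [← h4]
        exact Finset.sum_congr rfl fun j _ => by rw [hg l j z (hUN hz)]
      simp [this]
    have h4 : ∑ l, ∑ j, h l j z * (((n : ℝ) - 2) * Λ l j z + τ * g l j z) =
        ((n : ℝ) - 2) * τ + τ * n := by
      rw [← h3, hτ, Finset.mul_sum, Finset.mul_sum, ← Finset.sum_add_distrib]
      refine Finset.sum_congr rfl fun l _ => ?_
      rw [Finset.mul_sum, Finset.mul_sum, ← Finset.sum_add_distrib]
      exact Finset.sum_congr rfl fun j _ => by ring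
    have h5 : ((n : ℝ) - 2) * τ + τ * n = (2 * (n : ℝ) - 2) * τ := by ring
    rw [h4, h5, inv_mul_cancel_left₀ hn1]
  -- Dividing by `n - 2` is where dimension 2 is excluded.
  refine (((h1 l j).sub (h2.mul (hgs l j))).const_mul ((n : ℝ) - 2)⁻¹).congr fun z _ => ?_
  field_simp
  ring

/-- If `n ≥ 3`, the conformal Killing equation is a closed system for a one-form, its first
derivatives, the conformal factor and its first derivatives. -/
theorem exists_conformal_system (hn : 3 ≤ n) {N U : Set (EuclideanSpace ℝ (Fin n))}
    (hN : IsOpen N) (hU : IsOpen U) (hUN : U ⊆ N)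
    {a : Fin n → EuclideanSpace ℝ (Fin n) → ℝ} (ha : ∀ k, ContDiffOn ℝ ∞ (a k) U)
    {s : Fin n → Fin n → Fin n → EuclideanSpace ℝ (Fin n) → ℝ}
    (hs : ∀ j k l, ContDiffOn ℝ ∞ (s j k l) N)
    {g h : Fin n → Fin n → EuclideanSpace ℝ (Fin n) → ℝ}
    (hgs : ∀ i j, ContDiffOn ℝ ∞ (g i j) N) (hhs : ∀ i j, ContDiffOn ℝ ∞ (h i j) N)
    (hg : ∀ i j, ∀ z ∈ N, g i j z = g j i z) (hh : ∀ i j, ∀ z ∈ N, h i j z = h j i z)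
    (hgh : ∀ i j, ∀ z ∈ N, ∑ k, h i k z * g k j z = if i = j then 1 else 0)
    {r : EuclideanSpace ℝ (Fin n) → ℝ}
    (hK : ∀ j k, ∀ z ∈ U,
      pd j (a k) z + pd k (a j) z = ∑ l, s j k l z * a l z + g j k z * r z) :
    ∃ f : EuclideanSpace ℝ (Fin n) → Fin n ⊕ (Fin n × Fin n) ⊕ Option (Fin n) → ℝ,
      (∀ k z, f z (.inl k) = a k z) ∧
      ∃ Γ : EuclideanSpace ℝ (Fin n) → (Fin n ⊕ (Fin n × Fin n) ⊕ Option (Fin n) → ℝ) →L[ℝ]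
          EuclideanSpace ℝ (Fin n) →L[ℝ] (Fin n ⊕ (Fin n × Fin n) ⊕ Option (Fin n) → ℝ),
        ContDiffOn ℝ ∞ Γ N ∧ ∀ z ∈ U, HasFDerivAt f (Γ z (f z)) z := by
  -- No regularity of `r` is given; contracting one row of the equation with the inverse metric
  -- expresses `r` by `a` and its first derivatives.
  have hr : ContDiffOn ℝ ∞ r U := by
    let i₀ : Fin n := ⟨0, by omega⟩
    have h1 : ContDiffOn ℝ ∞ (fun z => ∑ k, h i₀ k z *
        (pd k (a i₀) z + pd i₀ (a k) z - ∑ l, s k i₀ l z * a l z)) U :=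
      ContDiffOn.sum fun k _ => ((hhs i₀ k).mono hUN).mul
        (((contDiffOn_pd hU (ha i₀) k).add (contDiffOn_pd hU (ha k) i₀)).sub
          (ContDiffOn.sum fun l _ => ((hs k i₀ l).mono hUN).mul (ha l)))
    refine h1.congr fun z hz => ?_
    have h2 : ∀ k, h i₀ k z * (pd k (a i₀) z + pd i₀ (a k) z - ∑ l, s k i₀ l z * a l z) =
        h i₀ k z * g k i₀ z * r z := fun k => by rw [hK k i₀ z hz]; ring
    simp only [h2]
    rw [← Finset.sum_mul, hgh i₀ i₀ z (hUN hz), if_pos rfl, one_mul]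
  set f : EuclideanSpace ℝ (Fin n) → Fin n ⊕ (Fin n × Fin n) ⊕ Option (Fin n) → ℝ := fun z =>
    Sum.elim (fun k => a k z) (Sum.elim (fun jk => pd jk.1 (a jk.2) z)
      fun o => o.elim (r z) fun i => pd i r z)
  refine ⟨f, fun k z => rfl, ?_⟩
  have ha1 : ∀ k, IsLinCombOne N U f (a k) := fun k =>
    ⟨ha k, IsLinComb.component (Sum.inl k), fun i => IsLinComb.component (Sum.inr (Sum.inl (i, k)))⟩
  have hr1 : IsLinCombOne N U f r :=
    ⟨hr, IsLinComb.component (Sum.inr (Sum.inr none)),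
      fun i => IsLinComb.component (Sum.inr (Sum.inr (some i)))⟩
  have hμ : ∀ i, IsLinComb N U f (pd i r) := hr1.3
  have hS : ∀ j k, IsLinCombOne N U f fun z => ∑ l, s j k l z * a l z + g j k z * r z := fun j k =>
    (IsLinCombOne.sum hU _ fun l _ => (ha1 l).mul hU hN hUN (hs j k l)).add hU
      (hr1.mul hU hN hUN (hgs j k))
  have hb : ∀ i j k, IsLinComb N U f (pd i (pd j (a k))) := fun i j k =>
    ((((hS j k).3 i).add ((hS i k).3 j)).sub ((hS i j).3 k)).const_mul (1 / 2) |>.congr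
      fun z hz => pd_pd_eq_of_symm hU ha hK hz i j k
  have hb1 : ∀ j k, IsLinCombOne N U f (pd j (a k)) := fun j k =>
    ⟨contDiffOn_pd hU (ha k) j, IsLinComb.component (Sum.inr (Sum.inl (j, k))), fun i => hb i j k⟩
  -- The part of the differentiated right-hand side free of derivatives of `r`. Its own first
  -- derivatives are again combinations of the unknowns, because the second derivatives of `a`
  -- already are.
  let Q : Fin n → Fin n → Fin n → EuclideanSpace ℝ (Fin n) → ℝ := fun i j k z =>
    ∑ l, (s j k l z * pd i (a l) z + pd i (s j k l) z * a l z) + pd i (g j k) z * r z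
  have hQ : ∀ i j k, IsLinCombOne N U f (Q i j k) := fun i j k =>
    (IsLinCombOne.sum hU _ fun l _ => ((hb1 i l).mul hU hN hUN (hs j k l)).add hU
      ((ha1 l).mul hU hN hUN (contDiffOn_pd hN (hs j k l) i))).add hU
      (hr1.mul hU hN hUN (contDiffOn_pd hN (hgs j k) i))
  have hdU : ∀ {u : EuclideanSpace ℝ (Fin n) → ℝ}, ContDiffOn ℝ ∞ u U → ∀ {z}, z ∈ U →
      DifferentiableAt ℝ u z := fun hu _ hz =>
    (hu.contDiffAt (hU.mem_nhds hz)).differentiableAt (by simp)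
  have hSQ : ∀ i j k, ∀ z ∈ U, pd i (fun z => ∑ l, s j k l z * a l z + g j k z * r z) z =
      Q i j k z + g j k z * pd i r z := by
    intro i j k z hz
    have hsa : ∀ l, ContDiffOn ℝ ∞ (fun z => s j k l z * a l z) U := fun l =>
      ((hs j k l).mono hUN).mul (ha l)
    rw [pd_add (hdU (ContDiffOn.sum fun l _ => hsa l) hz)
      (hdU (((hgs j k).mono hUN).mul hr) hz), pd_sum (fun l _ => hdU (hsa l) hz),
      pd_mul (hdU ((hgs j k).mono hUN) hz) (hdU hr hz)]
    simp only [fun l => pd_mul (hdU ((hs j k l).mono hUN) hz) (hdU (ha l) hz) i, Q]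
    ring
  clear_value Q
  have hT : ∀ i j k, ∀ z ∈ U, pd i (pd j (a k)) z =
      1 / 2 * (Q i j k z + Q j i k z + -1 * Q k i j z +
        (g j k z * pd i r z + g i k z * pd j r z + -1 * (g i j z * pd k r z))) := by
    intro i j k z hz
    rw [pd_pd_eq_of_symm hU ha hK hz, hSQ i j k z hz, hSQ j i k z hz, hSQ k i j z hz]
    ring
  have hTd : ∀ l i j k, ∀ z ∈ U, pd l (pd i (pd j (a k))) z =
      1 / 2 * (pd l (Q i j k) z + pd l (Q j i k) z + -1 * pd l (Q k i j) z +
        ((g j k z * pd l (pd i r) z + pd l (g j k) z * pd i r z) +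
         (g i k z * pd l (pd j r) z + pd l (g i k) z * pd j r z) +
         -1 * (g i j z * pd l (pd k r) z + pd l (g i j) z * pd k r z))) := by
    intro l i j k z hz
    have d1 := fun i j k => hdU (hQ i j k).1 hz
    have d2 := fun i j => hdU ((hgs i j).mono hUN) hz
    have d3 := fun i => hdU (contDiffOn_pd hU hr i) hz
    have pc : ∀ (c : ℝ) {u : EuclideanSpace ℝ (Fin n) → ℝ}, DifferentiableAt ℝ u z →
        pd l (fun z => c * u z) z = c * pd l u z := fun c u hu => by
      rw [pd, fderiv_const_mul hu]; rfl
    rw [pd_congr hU (hT i j k) l hz, pc, pd_add, pd_add, pd_add, pc, pd_add, pd_add, pc, pd_mul,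
      pd_mul, pd_mul]
    all_goals fun_prop (disch := assumption)
  -- The third derivatives `∂_l ∂_i ∂_j a_k` and `∂_i ∂_l ∂_j a_k` agree. Their difference, computed
  -- from `hTd`, is the curvature-type combination of the Hessian of `r` plus terms already
  -- controlled.
  have hΛ := IsLinComb.hessian hn (f := f) (Λ := fun l i => pd l (pd i r)) hUN hgs hhs hg hh hgh
    fun l i j k => by
    have hdg : ∀ i j k l, IsLinComb N U f fun z => pd l (g j k) z * pd i r z := fun i j k l =>
      (hμ i).mul (contDiffOn_pd hN (hgs j k) l)
    have hX : ∀ l i j k, IsLinComb N U f fun z =>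
        pd l (Q i j k) z + pd l (Q j i k) z - pd l (Q k i j) z +
          (pd l (g j k) z * pd i r z + pd l (g i k) z * pd j r z -
            pd l (g i j) z * pd k r z) := fun l i j k =>
      ((((hQ i j k).3 l).add ((hQ j i k).3 l)).sub ((hQ k i j).3 l)).add
        (((hdg i j k l).add (hdg j i k l)).sub (hdg k i j l))
    refine ((hX i l j k).sub (hX l i j k)).congr fun z hz => ?_
    have h1 := hTd l i j k z hz
    have h2 := hTd i l j k z hz
    rw [pd_comm hU (contDiffOn_pd hU (ha k) j) hz l i, h2] at h1
    rw [pd_comm hU hr hz i l] at h1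
    linear_combination (-2) * h1
  refine IsLinComb.exists_system hU ?_ ?_
  · rintro (k | ⟨j, k⟩ | _ | i)
    · exact ha k
    · exact contDiffOn_pd hU (ha k) j
    · exact hr
    · exact contDiffOn_pd hU hr i
  · rintro (k | ⟨j, k⟩ | _ | j) i
    · exact (ha1 k).3 i
    · exact hb i j k
    · exact hμ i
    · exact hΛ i j

end ConformalSystem

/-! ### The conformal Killing operator. -/

section ConformalKilling

theorem metricRep_comm {n : ℕ} {M : Type*} [TopologicalSpace M]
    [ChartedSpace (EuclideanSpace ℝ (Fin n)) M] {F : Type*} [NormedAddCommGroup F] [NormedSpace ℝ F]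
    {V : M → Type*} [TopologicalSpace (TotalSpace F V)]
    [∀ x, NormedAddCommGroup (V x)] [∀ x, InnerProductSpace ℝ (V x)]
    [FiberBundle F V] [VectorBundle ℝ F V] (p : M) (z : EuclideanSpace ℝ (Fin n)) (v w : F) :
    metricRep F V p z v w = metricRep F V p z w v := by
  exact (real_inner_comm _ _)

variable {n : ℕ} {M : Type*} [TopologicalSpace M] [ChartedSpace (EuclideanSpace ℝ (Fin n)) M]
  [IsManifold (𝓡 n) ∞ M] [RiemannianBundle (fun x : M => TangentSpace (𝓡 n) x)]
  [IsContMDiffRiemannianBundle (𝓡 n) ∞ (EuclideanSpace ℝ (Fin n))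
    (fun x : M => TangentSpace (𝓡 n) x)]

local notation "Eu" => EuclideanSpace ℝ (Fin n)

local notation "TM" => (fun x : M => TangentSpace (𝓡 n) x)

/-- The components of the metric and of its inverse in the chart at `p`. -/
theorem exists_metric_components (p : M) :
    ∃ h : Fin n → Fin n → Eu → ℝ,
      (∀ i j, ContDiffOn ℝ ∞ (h i j) (chartAt Eu p).target) ∧
      (∀ i j, ContDiffOn ℝ ∞ (fun z => metricRep Eu TM p z (EuclideanSpace.single i 1)
        (EuclideanSpace.single j 1)) (chartAt Eu p).target) ∧
      (∀ i j, ∀ z ∈ (chartAt Eu p).target, h i j z = h j i z) ∧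
      ∀ i j, ∀ z ∈ (chartAt Eu p).target, ∑ k, h i k z *
        metricRep Eu TM p z (EuclideanSpace.single k 1) (EuclideanSpace.single j 1) =
          if i = j then 1 else 0 := by
  have : IsManifold (𝓡 n) 1 M := .of_le (n := ∞) (by simp)
  have hdom : coordDomain n Eu TM p = (chartAt Eu p).target := coordDomain_tangent p
  have hinv : ∀ z ∈ (chartAt Eu p).target, ∀ ξ : Eu →L[ℝ] ℝ,
      metricRep Eu TM p z ((metricRep Eu TM p z).inverse ξ) = ξ := fun z hz ξ =>
    (isInvertible_metricRep (V := TM) (by rwa [hdom])).self_apply_inverse ξ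
  refine ⟨fun i k z => (metricRep Eu TM p z).inverse (EuclideanSpace.proj i) k, fun i j => ?_,
    fun i j => ?_, fun i j z hz => ?_, fun i j z hz => ?_⟩
  · have h1 := contDiffOn_inverse_metricRep (n := n) (F := Eu) (V := TM) p
    rw [hdom] at h1
    exact (EuclideanSpace.proj j : Eu →L[ℝ] ℝ).contDiff.comp_contDiffOn
      (h1.clm_apply contDiffOn_const)
  · have h1 := contDiffOn_metricRep (n := n) (F := Eu) (V := TM) p
    rw [hdom] at h1
    exact (h1.clm_apply contDiffOn_const).clm_apply contDiffOn_const
  · have h1 : ∀ i j : Fin n, (metricRep Eu TM p z).inverse (EuclideanSpace.proj i) j =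
        metricRep Eu TM p z ((metricRep Eu TM p z).inverse (EuclideanSpace.proj j))
          ((metricRep Eu TM p z).inverse (EuclideanSpace.proj i)) := fun i j => by
      rw [hinv z hz]; rfl
    exact (h1 i j).trans ((metricRep_comm (V := TM) p z _ _).trans (h1 j i).symm)
  · have h1 := clm_eq_sum ((metricRep Eu TM p z).flip (EuclideanSpace.single j 1))
      ((metricRep Eu TM p z).inverse (EuclideanSpace.proj i))
    simp only [ContinuousLinearMap.flip_apply] at h1
    rw [← h1, hinv z hz]
    simp

/-- If `n ≥ 3`, elements of the kernel of the conformal Killing operator are smooth up to the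
boundary. -/
theorem kernelExtends_conformalKillingOp [T2Space M] (hn : 3 ≤ n)
    {D : CovariantDerivative (𝓡 n) (EuclideanSpace ℝ (Fin n)) (fun x : M => TangentSpace (𝓡 n) x)}
    (hD : CovariantDerivative.ContMDiffCovariantDerivative D ∞)
    {Ω : Set M} (hΩ : IsOpen Ω) (hΩb : HasSmoothBoundary n Ω) :
    KernelExtends n (EuclideanSpace ℝ (Fin n) →L[ℝ] ℝ) Ω ∞ ∞ (conformalKillingOp D) := by
  intro η hη hK
  have : IsManifold (𝓡 n) 1 M := .of_le (n := ∞) (by simp)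
  refine exists_extension_of_local fun p hp => ?_
  obtain ⟨N, hN, hpN, hNt, γ, hγ, hcov⟩ := exists_covOneForm_coord hD p
  obtain ⟨h, hh, hg, hhs, hgh⟩ := exists_metric_components (n := n) p
  set c := chartAt Eu p
  set â := coordRep n (EuclideanSpace ℝ (Fin n) →L[ℝ] ℝ) p η
  set U : Set Eu := N ∩ c.symm ⁻¹' Ω
  have hU : IsOpen U := by
    have h := (isOpen_chartDomain (n := n) hΩ p).inter hN
    refine (congrArg IsOpen (?_ : U = _)).mpr h
    ext z
    exact ⟨fun h => ⟨⟨hNt h.1, h.2⟩, h.1⟩, fun h => ⟨h.2, h.1.2⟩⟩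
  have hâ : ∀ z ∈ U, ContDiffAt ℝ ∞ â z := fun z hz =>
    contDiffAt_coordRep_of_isOpen hΩ (k := ⊤) hη
      (by rw [coordDomain_cotangent]; exact hNt hz.1) hz.2
  have hâd : ∀ z ∈ U, DifferentiableAt ℝ â z := fun z hz => (hâ z hz).differentiableAt (by simp)
  have hLift : ∀ z ∈ U, ∀ v : Eu,
      fibreCoord Eu TM p (c.symm z) (fibreLift Eu TM p (c.symm z) v) = v := fun z hz v =>
    fibreCoord_fibreLift (by rw [coordDomain_tangent]; exact hNt hz.1) v
  obtain ⟨f, hf, Γ, hΓ, hfΓ⟩ := exists_conformal_system hn hN hU inter_subset_left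
    (a := fun k z => â z (EuclideanSpace.single k 1))
    (fun k z hz => ((hâ z hz).contDiffWithinAt).clm_apply contDiffWithinAt_const)
    (s := fun j k l z => (γ z (EuclideanSpace.single k 1) (EuclideanSpace.single j 1) +
      γ z (EuclideanSpace.single j 1) (EuclideanSpace.single k 1)) l)
    (fun j k l => by
      refine (EuclideanSpace.proj l : Eu →L[ℝ] ℝ).contDiff.comp_contDiffOn (ContDiffOn.add ?_ ?_)
      · exact (hγ.clm_apply contDiffOn_const).clm_apply contDiffOn_const
      · exact (hγ.clm_apply contDiffOn_const).clm_apply contDiffOn_const)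
    (g := fun i j z => metricRep Eu TM p z (EuclideanSpace.single i 1) (EuclideanSpace.single j 1))
    (fun i j => (hg i j).mono hNt) (fun i j => (hh i j).mono hNt)
    (fun i j z _ => metricRep_comm (V := TM) p z _ _)
    (fun i j z hz => hhs i j z (hNt hz)) (fun i j z hz => hgh i j z (hNt hz))
    -- The codifferential is never computed in coordinates; it only matters that one scalar function
    -- multiplies the metric.
    (r := fun z => -(2 / n) * codiff D η (c.symm z))
    (fun j k z hz => by
      have h1 := congrFun (congrFun (hK _ hz.2)
        (fibreLift Eu TM p (c.symm z) (EuclideanSpace.single j 1)))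
        (fibreLift Eu TM p (c.symm z) (EuclideanSpace.single k 1))
      rw [conformalKillingOp, hcov z hz.1 η (hâd z hz), hcov z hz.1 η (hâd z hz), hLift z hz,
        hLift z hz] at h1
      have h2 : ∑ l, (γ z (EuclideanSpace.single k 1) (EuclideanSpace.single j 1) +
          γ z (EuclideanSpace.single j 1) (EuclideanSpace.single k 1)) l *
            â z (EuclideanSpace.single l 1) = â z _ := (clm_eq_sum (â z) _).symm
      rw [pd_clm_apply (hâd z hz), pd_clm_apply (hâd z hz), h2, map_add, metricRep_apply (V := TM)]
      have h3 : (0 : TwoTensor n (c.symm z))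
        (fibreLift Eu TM p (c.symm z) (EuclideanSpace.single j 1))
        (fibreLift Eu TM p (c.symm z) (EuclideanSpace.single k 1)) = 0 := rfl
      rw [h3] at h1
      linear_combination 2 * h1)
  obtain ⟨pr, hpr⟩ := exists_rebuild (n := n)
    (Sum.inl : Fin n → Fin n ⊕ (Fin n × Fin n) ⊕ Option (Fin n))
  exact exists_local_extension hΩ hΩb hp (hN.mem_nhds hpN) (hΓ.mono inter_subset_left) hfΓ pr
    fun z _ => hpr _ _ fun k => hf k z

end ConformalKilling

/-! ### The metric determinant and its transformation rule. -/

section Gram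

variable {n : ℕ} {M : Type*} [TopologicalSpace M] [ChartedSpace (EuclideanSpace ℝ (Fin n)) M]
  [IsManifold (𝓡 n) ∞ M] [RiemannianBundle (fun x : M => TangentSpace (𝓡 n) x)]

local notation "Eu" => EuclideanSpace ℝ (Fin n)

local notation "TM" => (fun x : M => TangentSpace (𝓡 n) x)

theorem coordVector_eq [IsManifold (𝓡 n) 1 M] {p : M} {z : Eu} (hz : z ∈ (chartAt Eu p).target)
    (i : Fin n) : coordVector p z i =
      fibreLift Eu TM p ((chartAt Eu p).symm z) (EuclideanSpace.single i 1) := by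
  have hx : (chartAt Eu p).symm z ∈ (chartAt Eu p).source := (chartAt Eu p).map_target hz
  rw [coordVector, fibreLift, TangentBundle.symmL_trivializationAt hx]
  have e : extChartAt (𝓡 n) p ((chartAt Eu p).symm z) = z := by
    simp [(chartAt Eu p).right_inv hz]
  rw [e]
  simp only [modelWithCornersSelf_coe, range_id, mfderivWithin_univ]
  rfl

theorem gramMatrix_apply [IsManifold (𝓡 n) 1 M] {p : M} {z : Eu}
    (hz : z ∈ (chartAt Eu p).target) (i j : Fin n) : gramMatrix p z i j =
      metricRep Eu TM p z (EuclideanSpace.single i 1) (EuclideanSpace.single j 1) := by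
  rw [gramMatrix, Matrix.of_apply, coordVector_eq hz, coordVector_eq hz]
  rfl

/-- A Gram matrix is positive semidefinite, and this one has an inverse. -/
theorem gramMatrix_det_pos [IsContMDiffRiemannianBundle (𝓡 n) ∞ (EuclideanSpace ℝ (Fin n))
      (fun x : M => TangentSpace (𝓡 n) x)] {p : M} {z : Eu} (hz : z ∈ (chartAt Eu p).target) :
    0 < (gramMatrix p z).det := by
  have : IsManifold (𝓡 n) 1 M := .of_le (n := ∞) (by simp)
  obtain ⟨h, -, -, -, hh⟩ := exists_metric_components (n := n) p
  have h1 : (Matrix.of fun i j => h i j z) * gramMatrix p z = 1 := by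
    ext i j
    rw [Matrix.mul_apply, Matrix.one_apply, ← hh i j z hz]
    exact Finset.sum_congr rfl fun k _ => by rw [gramMatrix_apply hz]; rfl
  have h2 : (gramMatrix p z).det ≠ 0 := fun h0 => by
    have := congrArg Matrix.det h1
    rw [Matrix.det_mul, h0, mul_zero, Matrix.det_one] at this
    exact zero_ne_one this
  have h3 : (gramMatrix p z).PosSemidef := Matrix.posSemidef_gram ℝ (coordVector p z)
  exact lt_of_le_of_ne h3.det_nonneg (Ne.symm h2)

theorem continuousOn_gramMatrix_det [IsContMDiffRiemannianBundle (𝓡 n) ∞ (EuclideanSpace ℝ (Fin n))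
      (fun x : M => TangentSpace (𝓡 n) x)] (p : M) :
    ContinuousOn (fun z => Real.sqrt (gramMatrix p z).det) (chartAt Eu p).target := by
  have : IsManifold (𝓡 n) 1 M := .of_le (n := ∞) (by simp)
  obtain ⟨h, -, hg, -⟩ := exists_metric_components (n := n) p
  refine Real.continuous_sqrt.comp_continuousOn ?_
  have h1 : ContinuousOn (gramMatrix (n := n) p) (chartAt Eu p).target :=
    continuousOn_pi.2 fun i => continuousOn_pi.2 fun j =>
      (hg i j).continuousOn.congr fun z hz => gramMatrix_apply hz i j
  exact (Continuous.matrix_det continuous_id).comp_continuousOn h1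

/-- The transition map between the charts at `q` and `p`, and the metric coefficients. -/
theorem gramMatrix_transition {p q : M} {z : Eu} (hz : z ∈ (chartAt Eu q).target)
    (hzp : (chartAt Eu q).symm z ∈ (chartAt Eu p).source) :
    HasFDerivAt (chartAt Eu p ∘ (chartAt Eu q).symm)
      (fderiv ℝ (chartAt Eu p ∘ (chartAt Eu q).symm) z) z ∧
    Real.sqrt (gramMatrix q z).det =
      |(fderiv ℝ (chartAt Eu p ∘ (chartAt Eu q).symm) z).det| *
        Real.sqrt (gramMatrix p (chartAt Eu p ((chartAt Eu q).symm z))).det := by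
  have : IsManifold (𝓡 n) 1 M := .of_le (n := ∞) (by simp)
  have hm : MDifferentiableAt (𝓡 n) 𝓘(ℝ, Eu) (chartAt Eu p) ((chartAt Eu q).symm z) :=
    mdifferentiableAt_extChartAt hzp
  have hcoord := fun X : TangentSpace (𝓡 n) ((chartAt Eu q).symm z) =>
    mvfderiv_eq_fderiv_coord hz hm X
  have hd : DifferentiableAt ℝ (chartAt Eu p ∘ (chartAt Eu q).symm) z := by
    have hx : (chartAt Eu q).symm z ∈ (chartAt Eu q).source := (chartAt Eu q).map_target hz
    rw [mdifferentiableAt_iff_source_of_mem_source (x := q) (by simpa using hx)] at hm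
    simpa only [mdifferentiableWithinAt_iff_differentiableWithinAt, mfld_simps,
      differentiableWithinAt_univ, (chartAt Eu q).right_inv hz] using hm
  refine ⟨hd.hasFDerivAt, ?_⟩
  set J := fderiv ℝ (chartAt Eu p ∘ (chartAt Eu q).symm) z
  have hJ : ∀ v : Eu, fibreLift Eu TM q ((chartAt Eu q).symm z) v =
      fibreLift Eu TM p ((chartAt Eu q).symm z) (J v) := by
    intro v
    have h1 := hcoord (fibreLift Eu TM q ((chartAt Eu q).symm z) v)
    have h2 : fibreCoord Eu TM q ((chartAt Eu q).symm z)
        (fibreLift Eu TM q ((chartAt Eu q).symm z) v) = v :=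
      fibreCoord_fibreLift (by rwa [coordDomain_tangent]) v
    have h3 : fibreCoord Eu TM p ((chartAt Eu q).symm z)
        (fibreLift Eu TM q ((chartAt Eu q).symm z) v) = J v := by
      rw [fibreCoord, TangentBundle.continuousLinearMapAt_trivializationAt hzp]
      refine Eq.trans ?_ (h1.trans (congrArg J h2))
      rfl
    rw [← h3]
    exact ((trivializationAt Eu TM p).symmL_continuousLinearMapAt hzp _).symm
  have hw : chartAt Eu p ((chartAt Eu q).symm z) ∈ (chartAt Eu p).target :=
    (chartAt Eu p).map_source hzp
  have hgp : ∀ x, x = (chartAt Eu q).symm z → ∀ v w : Eu,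
      inner ℝ (fibreLift Eu TM p x v) (fibreLift Eu TM p x w) =
        inner ℝ (fibreLift Eu TM p ((chartAt Eu q).symm z) v)
          (fibreLift Eu TM p ((chartAt Eu q).symm z) w) := by
    rintro x rfl v w
    rfl
  set b := (EuclideanSpace.basisFun (Fin n) ℝ).toBasis
  set A : Matrix (Fin n) (Fin n) ℝ := LinearMap.toMatrix b b J.toLinearMap
  have hA : ∀ v : Fin n, J (EuclideanSpace.single v 1) =
      ∑ k, A k v • EuclideanSpace.single k (1 : ℝ) := by
    intro v
    have h1 := b.sum_repr (J (EuclideanSpace.single v 1))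
    rw [← h1]
    refine Finset.sum_congr rfl fun k _ => ?_
    simp [A, LinearMap.toMatrix_apply, b]
  -- The metric transforms by congruence with the Jacobian, so the root of its determinant picks up
  -- `|det J|`.
  have hG : gramMatrix q z = A.transpose *
      gramMatrix p (chartAt Eu p ((chartAt Eu q).symm z)) * A := by
    ext i j
    rw [gramMatrix_apply hz]
    have h1 : metricRep Eu TM q z (EuclideanSpace.single i 1) (EuclideanSpace.single j 1) =
        metricRep Eu TM p (chartAt Eu p ((chartAt Eu q).symm z)) (J (EuclideanSpace.single i 1))
          (J (EuclideanSpace.single j 1)) := by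
      refine Eq.trans ?_ (hgp _ ((chartAt Eu p).left_inv hzp) _ _).symm
      rw [← hJ, ← hJ]
      rfl
    rw [h1, hA, hA]
    simp only [map_sum, map_smul, _root_.sum_apply, _root_.smul_apply, Matrix.mul_apply,
      Matrix.transpose_apply, gramMatrix_apply hw, smul_eq_mul, Finset.sum_mul, Finset.mul_sum]
    exact Finset.sum_congr rfl fun k _ => Finset.sum_congr rfl fun l _ => by ring
  have hdet : J.det = A.det := (LinearMap.det_toMatrix b J.toLinearMap).symm
  rw [hG, Matrix.det_mul, Matrix.det_mul, Matrix.det_transpose, hdet, mul_right_comm,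
    Real.sqrt_mul (mul_self_nonneg _), Real.sqrt_mul_self_eq_abs]

end Gram

/-! ### The Riemannian measure in charts. -/

section VolumeInCharts

theorem _root_.ContinuousOn.measurableSet_inter_preimage {X Y : Type*} [TopologicalSpace X]
    [MeasurableSpace X] [BorelSpace X] [TopologicalSpace Y] [MeasurableSpace Y] [BorelSpace Y]
    {f : X → Y} {s : Set X} (hf : ContinuousOn f s) (hs : MeasurableSet s) {A : Set Y}
    (hA : MeasurableSet A) : MeasurableSet (s ∩ f ⁻¹' A) := by
  have h := hs.subtype_image ((continuousOn_iff_continuous_domRestrict.1 hf).measurable hA)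
  convert h using 1
  ext x
  simp [Set.domRestrict, and_comm]

variable {n : ℕ} {M : Type*} [TopologicalSpace M] [ChartedSpace (EuclideanSpace ℝ (Fin n)) M]
  [MeasurableSpace M] [BorelSpace M]
  [RiemannianBundle (fun x : M => TangentSpace (𝓡 n) x)]

local notation "Eu" => EuclideanSpace ℝ (Fin n)

/-- The Riemannian measure in the coordinates of the chart at `p`. -/
def coordVolume (p : M) : Measure (EuclideanSpace ℝ (Fin n)) :=
  ((volume : Measure (EuclideanSpace ℝ (Fin n))).restrict
    (chartAt (EuclideanSpace ℝ (Fin n)) p).target).withDensity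
      fun z => ENNReal.ofReal (Real.sqrt (gramMatrix p z).det)

theorem coordVolume_apply (p : M) {s : Set Eu} (hs : MeasurableSet s) : coordVolume p s =
    ∫⁻ z in s ∩ (chartAt Eu p).target, ENNReal.ofReal (Real.sqrt (gramMatrix p z).det) := by
  rw [coordVolume, withDensity_apply _ hs, Measure.restrict_restrict hs]

theorem ae_mem_target_coordVolume (p : M) :
    ∀ᵐ z ∂(coordVolume (n := n) p), z ∈ (chartAt Eu p).target :=
  (withDensity_absolutelyContinuous _ _).ae_le
    (ae_restrict_mem (chartAt Eu p).open_target.measurableSet)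

theorem aemeasurable_symm_coordVolume (p : M) :
    AEMeasurable (chartAt Eu p).symm (coordVolume (n := n) p) :=
  ((chartAt Eu p).continuousOn_symm.aemeasurable
    (chartAt Eu p).open_target.measurableSet).mono_ac (withDensity_absolutelyContinuous _ _)

theorem map_coordVolume_le_riemannianVolume (p : M) :
    (coordVolume p).map (chartAt Eu p).symm ≤ riemannianVolume n M :=
  le_iSup (fun p : M => (coordVolume p).map (chartAt Eu p).symm) p

theorem map_coordVolume_apply (p : M) {A : Set M} (hA : MeasurableSet A) :
    (coordVolume p).map (chartAt Eu p).symm A =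
      ∫⁻ z in (chartAt Eu p).target ∩ (chartAt Eu p).symm ⁻¹' A,
        ENNReal.ofReal (Real.sqrt (gramMatrix p z).det) := by
  have hB : MeasurableSet ((chartAt Eu p).target ∩ (chartAt Eu p).symm ⁻¹' A) :=
    ContinuousOn.measurableSet_inter_preimage (chartAt Eu p).continuousOn_symm
      (chartAt Eu p).open_target.measurableSet hA
  rw [Measure.map_apply_of_aemeasurable (aemeasurable_symm_coordVolume p) hA]
  have h1 : (chartAt Eu p).symm ⁻¹' A =ᵐ[coordVolume p]
      ((chartAt Eu p).target ∩ (chartAt Eu p).symm ⁻¹' A : Set Eu) := by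
    filter_upwards [ae_mem_target_coordVolume p] with z hz
    exact propext ⟨fun h => ⟨hz, h⟩, fun h => h.2⟩
  rw [measure_congr h1, coordVolume_apply p hB, inter_right_comm, inter_self]

variable [IsManifold (𝓡 n) ∞ M]

/-- Change of variables under the transition map: the Jacobian is exactly the ratio of the two
densities. -/
theorem map_coordVolume_restrict_le (p q : M) :
    ((coordVolume q).map (chartAt Eu q).symm).restrict (chartAt Eu p).source ≤
      (coordVolume p).map (chartAt Eu p).symm := by
  refine Measure.le_iff.2 fun A hA => ?_
  have hAp : MeasurableSet (A ∩ (chartAt Eu p).source) :=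
    hA.inter (chartAt Eu p).open_source.measurableSet
  rw [Measure.restrict_apply hA, map_coordVolume_apply q hAp, map_coordVolume_apply p hA]
  set B := (chartAt Eu q).target ∩ (chartAt Eu q).symm ⁻¹' (A ∩ (chartAt Eu p).source)
  have hB : MeasurableSet B := ContinuousOn.measurableSet_inter_preimage (chartAt Eu q).continuousOn_symm
      (chartAt Eu q).open_target.measurableSet hAp
  set τ : Eu → Eu := chartAt Eu p ∘ (chartAt Eu q).symm
  have hτ : ∀ z ∈ B, HasFDerivWithinAt τ (fderiv ℝ τ z) B z := fun z hz =>
    (gramMatrix_transition hz.1 hz.2.2).1.hasFDerivWithinAt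
  have hinj : InjOn τ B := fun z hz w hw h =>
    (chartAt Eu q).symm.injOn hz.1 hw.1 ((chartAt Eu p).injOn hz.2.2 hw.2.2 h)
  have hsub : τ '' B ⊆ (chartAt Eu p).target ∩ (chartAt Eu p).symm ⁻¹' A := by
    rintro _ ⟨z, hz, rfl⟩
    refine ⟨(chartAt Eu p).map_source hz.2.2, ?_⟩
    simpa only [mem_preimage, τ, Function.comp_apply, (chartAt Eu p).left_inv hz.2.2] using hz.2.1
  calc ∫⁻ z in B, ENNReal.ofReal (Real.sqrt (gramMatrix q z).det)
      = ∫⁻ z in B, ENNReal.ofReal |(fderiv ℝ τ z).det| *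
          ENNReal.ofReal (Real.sqrt (gramMatrix p (τ z)).det) := by
        refine setLIntegral_congr_fun hB fun z hz => ?_
        beta_reduce
        rw [(gramMatrix_transition hz.1 hz.2.2).2, ENNReal.ofReal_mul (abs_nonneg _)]
        rfl
    _ = ∫⁻ w in τ '' B, ENNReal.ofReal (Real.sqrt (gramMatrix p w).det) :=
        (lintegral_image_eq_lintegral_abs_det_fderiv_mul volume hB hτ hinj fun w =>
          ENNReal.ofReal (Real.sqrt (gramMatrix p w).det)).symm
    _ ≤ _ := lintegral_mono_set hsub

/-- A supremum of measures could exceed each of them. It does not on a chart domain, because there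
every chart measure is bounded by that of the chart at `p`. -/
theorem riemannianVolume_le (p : M) : riemannianVolume n M ≤
    (coordVolume p).map (chartAt Eu p).symm +
      (riemannianVolume n M).restrict (chartAt Eu p).sourceᶜ := by
  refine iSup_le fun q => ?_
  have hS : MeasurableSet (chartAt Eu p).source := (chartAt Eu p).open_source.measurableSet
  have h1 := Measure.restrict_add_restrict_compl
    (μ := (coordVolume q).map (chartAt Eu q).symm) hS
  refine h1.symm.le.trans (add_le_add (map_coordVolume_restrict_le p q) ?_)
  exact Measure.restrict_mono le_rfl (map_coordVolume_le_riemannianVolume q)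

theorem riemannianVolume_restrict_le (p : M) {A : Set M} (hA : MeasurableSet A)
    (hAp : A ⊆ (chartAt Eu p).source) : (riemannianVolume n M).restrict A ≤
      (coordVolume p).map (chartAt Eu p).symm := by
  have h1 := Measure.restrict_mono_measure (riemannianVolume_le (n := n) p) A
  rw [Measure.restrict_add, Measure.restrict_restrict hA] at h1
  have h2 : A ∩ (chartAt Eu p).sourceᶜ = ∅ := by
    ext x; exact ⟨fun h => h.2 (hAp h.1), fun h => h.elim⟩
  rw [h2, Measure.restrict_empty, add_zero] at h1
  exact h1.trans Measure.restrict_le_self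

variable [IsContMDiffRiemannianBundle (𝓡 n) ∞ (EuclideanSpace ℝ (Fin n))
    (fun x : M => TangentSpace (𝓡 n) x)]

/-- Near a point, the Riemannian measure is comparable to the Lebesgue measure of the chart. -/
theorem exists_coordVolume_bounds (p : M) : ∃ S : Set Eu, IsOpen S ∧ chartAt Eu p p ∈ S ∧
    S ⊆ (chartAt Eu p).target ∧ ∃ C : ℝ≥0,
      (coordVolume p).restrict S ≤ (C : ℝ≥0∞) • (volume : Measure Eu).restrict S ∧
      (volume : Measure Eu).restrict S ≤ (C : ℝ≥0∞) • coordVolume p := by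
  set c := chartAt Eu p
  have hct : c p ∈ c.target := mem_chart_target Eu p
  set d : Eu → ℝ := fun z => Real.sqrt (gramMatrix p z).det
  have hd0 : 0 < d (c p) := Real.sqrt_pos.2 (gramMatrix_det_pos hct)
  have hdc : ContinuousAt d (c p) :=
    (continuousOn_gramMatrix_det p).continuousAt (c.open_target.mem_nhds hct)
  have h1 : ∀ᶠ z in 𝓝 (c p), d (c p) / 2 < d z ∧ d z < 2 * d (c p) ∧ z ∈ c.target :=
    (hdc.eventually (lt_mem_nhds (by linarith))).and
      ((hdc.eventually (gt_mem_nhds (by linarith))).and (c.open_target.mem_nhds hct))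
  obtain ⟨S, hS, hSo, hpS⟩ := eventually_nhds_iff.1 h1
  have key : ∀ A, MeasurableSet A → coordVolume p (A ∩ S) =
      ∫⁻ z in A ∩ S, ENNReal.ofReal (d z) := fun A hA => by
    rw [coordVolume_apply p (hA.inter hSo.measurableSet), inter_assoc,
      inter_eq_left.2 fun z hz => (hS z hz).2.2]
  -- On `S` the density lies between half and twice its value at the centre; the two entries of the
  -- maximum serve the two directions.
  refine ⟨S, hSo, hpS, fun z hz => (hS z hz).2.2,
    max (2 * d (c p)).toNNReal (2 / d (c p)).toNNReal, ?_, ?_⟩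
  · refine Measure.le_iff.2 fun A hA => ?_
    rw [Measure.restrict_apply hA, key A hA, Measure.smul_apply, Measure.restrict_apply hA,
      smul_eq_mul, ← setLIntegral_const]
    refine setLIntegral_mono measurable_const fun z hz => ?_
    refine (ENNReal.ofReal_le_ofReal (hS z hz.2).2.1.le).trans ?_
    exact ENNReal.coe_le_coe.2 (le_max_left _ _)
  · refine Measure.le_iff.2 fun A hA => ?_
    rw [Measure.restrict_apply hA, Measure.smul_apply, smul_eq_mul]
    refine le_trans ?_ (mul_le_mul_right (measure_mono (inter_subset_left (t := S))) _)
    rw [key A hA]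
    have h2 : ENNReal.ofReal (d (c p) / 2) * volume (A ∩ S) ≤
        ∫⁻ z in A ∩ S, ENNReal.ofReal (d z) := by
      rw [← setLIntegral_const]
      exact setLIntegral_mono' (hA.inter hSo.measurableSet) fun z hz =>
        ENNReal.ofReal_le_ofReal (hS z hz.2).1.le
    calc volume (A ∩ S) = ENNReal.ofReal (2 / d (c p)) *
          (ENNReal.ofReal (d (c p) / 2) * volume (A ∩ S)) := by
          rw [← mul_assoc, ← ENNReal.ofReal_mul (by positivity)]
          field_simp
          simp
      _ ≤ _ := by
        refine mul_le_mul' ?_ h2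
        exact ENNReal.coe_le_coe.2 (le_max_right _ _)

/-- Integrals over a small set of a chart domain, in coordinates. -/
theorem exists_lintegral_chart_bounds (p : M) : ∃ S : Set Eu, IsOpen S ∧ chartAt Eu p p ∈ S ∧
    S ⊆ (chartAt Eu p).target ∧ ∃ C : ℝ≥0, ∀ (f : M → ℝ≥0∞) (h : Eu → ℝ≥0∞),
      ((∀ x, ¬ (x ∈ (chartAt Eu p).source ∧ chartAt Eu p x ∈ S) → f x = 0) →
        (∀ z ∈ S, f ((chartAt Eu p).symm z) ≤ h z) →
        ∫⁻ x, f x ∂(riemannianVolume n M) ≤ C * ∫⁻ z, h z) ∧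
      ((∀ z, z ∉ S → h z = 0) → (∀ z ∈ S, h z ≤ f ((chartAt Eu p).symm z)) →
        ∫⁻ z, h z ≤ C * ∫⁻ x, f x ∂(riemannianVolume n M)) := by
  obtain ⟨S, hS, hpS, hSt, C, hC1, hC2⟩ := exists_coordVolume_bounds (n := n) p
  refine ⟨S, hS, hpS, hSt, C, fun f h => ⟨fun hf hfh => ?_, fun hh hhf => ?_⟩⟩
  · set c := chartAt Eu p
    set A := c.source ∩ c ⁻¹' S
    have hA : IsOpen A := c.isOpen_inter_preimage hS
    calc ∫⁻ x, f x ∂(riemannianVolume n M) = ∫⁻ x in A, f x ∂(riemannianVolume n M) := by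
          rw [← lintegral_indicator hA.measurableSet]
          refine lintegral_congr fun x => ?_
          by_cases hx : x ∈ A
          · rw [indicator_of_mem hx]
          · rw [indicator_of_notMem hx, hf x hx]
      _ ≤ ∫⁻ x, f x ∂((coordVolume p).map c.symm) :=
          lintegral_mono' (riemannianVolume_restrict_le p hA.measurableSet inter_subset_left) le_rfl
      _ ≤ ∫⁻ z, f (c.symm z) ∂(coordVolume p) := lintegral_map_le _ _
      _ ≤ ∫⁻ z, S.indicator h z ∂(coordVolume p) := by
          refine lintegral_mono_ae ?_
          filter_upwards [ae_mem_target_coordVolume p] with z hz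
          by_cases hzS : z ∈ S
          · rw [indicator_of_mem hzS]
            exact hfh z hzS
          · rw [hf _ fun hx => hzS (by simpa only [c, (chartAt Eu p).right_inv hz] using hx.2)]
            exact zero_le
      _ = ∫⁻ z in S, h z ∂(coordVolume p) := lintegral_indicator hS.measurableSet _
      _ ≤ ∫⁻ z, h z ∂((C : ℝ≥0∞) • (volume : Measure Eu).restrict S) := lintegral_mono' hC1 le_rfl
      _ = C * ∫⁻ z in S, h z := by rw [lintegral_smul_measure, smul_eq_mul]
      _ ≤ C * ∫⁻ z, h z := mul_le_mul_right (setLIntegral_le_lintegral _ _) _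
  · set c := chartAt Eu p
    have hcm : AEMeasurable c ((coordVolume p).map c.symm) := by
      have h1 : ∀ᵐ x ∂((coordVolume p).map c.symm), x ∈ c.source := by
        rw [ae_iff, Measure.map_apply_of_aemeasurable (aemeasurable_symm_coordVolume p)
          (by exact c.open_source.measurableSet.compl)]
        exact ae_iff.1 ((ae_mem_target_coordVolume p).mono fun z hz => c.map_target hz)
      rw [← Measure.restrict_eq_self_of_ae_mem h1]
      exact c.continuousOn.aemeasurable c.open_source.measurableSet
    -- Going back through the chart lets `lintegral_map_le`, which needs no measurability of the
    -- integrand, serve for the reverse estimate too.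
    have hmap : ((coordVolume p).map c.symm).map c = coordVolume p := by
      rw [AEMeasurable.map_map_of_aemeasurable hcm (aemeasurable_symm_coordVolume p)]
      have h1 : c ∘ c.symm =ᵐ[coordVolume p] id := by
        filter_upwards [ae_mem_target_coordVolume p] with z hz using c.right_inv hz
      rw [Measure.map_congr h1, Measure.map_id]
    calc ∫⁻ z, h z = ∫⁻ z in S, h z := by
          rw [← lintegral_indicator hS.measurableSet]
          refine lintegral_congr fun z => ?_
          by_cases hz : z ∈ S
          · rw [indicator_of_mem hz]
          · rw [indicator_of_notMem hz, hh z hz]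
      _ ≤ ∫⁻ z, h z ∂((C : ℝ≥0∞) • coordVolume p) := lintegral_mono' hC2 le_rfl
      _ = C * ∫⁻ z, h z ∂(coordVolume p) := by rw [lintegral_smul_measure, smul_eq_mul]
      _ = C * ∫⁻ z, h z ∂(((coordVolume p).map c.symm).map c) := by rw [hmap]
      _ ≤ C * ∫⁻ x, h (c x) ∂((coordVolume p).map c.symm) :=
          mul_le_mul_right (lintegral_map_le _ _) _
      _ ≤ C * ∫⁻ x, f x ∂((coordVolume p).map c.symm) := by
          refine mul_le_mul_right (lintegral_mono_ae ?_) _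
          have h1 : ∀ᵐ x ∂((coordVolume p).map c.symm), x ∈ c.source := by
            rw [ae_iff, Measure.map_apply_of_aemeasurable (aemeasurable_symm_coordVolume p)
              (by exact c.open_source.measurableSet.compl)]
            exact ae_iff.1 ((ae_mem_target_coordVolume p).mono fun z hz => c.map_target hz)
          filter_upwards [h1] with x hx
          by_cases hz : c x ∈ S
          · exact (hhf _ hz).trans (by rw [c.left_inv hx])
          · rw [hh _ hz]
            exact zero_le
      _ ≤ _ := mul_le_mul_right
          (lintegral_mono' (map_coordVolume_le_riemannianVolume p) le_rfl) _

end VolumeInCharts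

/-! ### Local bounds near a point of the closure. -/

section LocalBounds

/-- The coefficients are continuous within `N`, hence bounded near `p` even if `p` lies on the
boundary of `N`. -/
theorem IsDiffExpr.exists_bound {E F Y : Type*} [NormedAddCommGroup E] [NormedSpace ℝ E]
    [NormedAddCommGroup F] [NormedSpace ℝ F] [NormedAddCommGroup Y] [NormedSpace ℝ Y]
    {N : Set E} {k : ℕ} {R : (E → F) → E → Y} (h : IsDiffExpr N k R) {p : E} (hp : p ∈ N) :
    ∃ C : ℝ, 0 ≤ C ∧ ∃ A ∈ 𝓝 p, ∀ f, ∀ z ∈ N ∩ A,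
      ‖R f z‖ ≤ C * ∑ l ∈ Finset.range k, ‖_root_.iteratedFDeriv ℝ l f z‖ := by
  obtain ⟨c, hc, hR⟩ := h
  choose C hC A hA hCA using fun l => exists_norm_le_of_continuousWithinAt ((hc l).continuousOn p hp)
  refine ⟨∑ l ∈ Finset.range k, C l, Finset.sum_nonneg fun l _ => hC l,
    ⋂ l ∈ Finset.range k, A l, (Filter.biInter_finset_mem _).2 fun l _ => hA l, fun f z hz => ?_⟩
  rw [hR, Finset.mul_sum]
  refine (norm_sum_le _ _).trans (Finset.sum_le_sum fun l hl => ?_)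
  refine ((c l z).le_opNorm _).trans (mul_le_mul_of_nonneg_right ?_ (norm_nonneg _))
  exact (hCA l z ⟨hz.1, mem_iInter₂.1 hz.2 l hl⟩).trans
    (Finset.single_le_sum (f := C) (fun l _ => hC l) hl)

variable {n : ℕ} {M : Type*} [TopologicalSpace M] [T2Space M]
  [ChartedSpace (EuclideanSpace ℝ (Fin n)) M] [IsManifold (𝓡 n) ∞ M]
  {F : Type*} [NormedAddCommGroup F] [NormedSpace ℝ F]
  {V : M → Type*} [TopologicalSpace (TotalSpace F V)]
  [∀ x, NormedAddCommGroup (V x)] [∀ x, InnerProductSpace ℝ (V x)]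
  [FiberBundle F V] [VectorBundle ℝ F V]

local notation "Eu" => EuclideanSpace ℝ (Fin n)

theorem isContinuousRiemannianBundle_of_contMDiff [IsContMDiffRiemannianBundle (𝓡 n) ∞ F V] :
    IsContinuousRiemannianBundle F V := by
  obtain ⟨g, hg, hgi⟩ := IsContMDiffRiemannianBundle.exists_contMDiff
    (IB := 𝓡 n) (n := ∞) (F := F) (E := V)
  exact ⟨g, hg.continuous, hgi⟩

theorem exists_norm_le_fibreCoord [IsContMDiffRiemannianBundle (𝓡 n) ∞ F V] (p : M) :
    ∃ C : ℝ, 0 ≤ C ∧ ∀ᶠ z in 𝓝 (chartAt Eu p p), ∀ v : V ((chartAt Eu p).symm z),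
      ‖v‖ ≤ C * ‖fibreCoord F V p ((chartAt Eu p).symm z) v‖ := by
  have := isContinuousRiemannianBundle_of_contMDiff (n := n) (F := F) (V := V)
  obtain ⟨C, hC, h⟩ := eventually_norm_symmL_trivializationAt_lt F V p
  refine ⟨C, hC.le, ?_⟩
  filter_upwards [eventually_symm_of_eventually (mem_chart_target Eu p)
    (by rwa [(chartAt Eu p).left_inv (mem_chart_source Eu p)]),
    coordDomain_mem_nhds (n := n) (F := F) (V := V) p] with z hz hzV v
  conv_lhs => rw [← fibreLift_fibreCoord hzV v]
  exact (ContinuousLinearMap.le_opNorm _ _).trans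
    (mul_le_mul_of_nonneg_right hz.le (norm_nonneg _))

theorem exists_fibreCoord_norm_le [IsContMDiffRiemannianBundle (𝓡 n) ∞ F V] (p : M) :
    ∃ C : ℝ, 0 ≤ C ∧ ∀ᶠ z in 𝓝 (chartAt Eu p p), ∀ v : V ((chartAt Eu p).symm z),
      ‖fibreCoord F V p ((chartAt Eu p).symm z) v‖ ≤ C * ‖v‖ := by
  have := isContinuousRiemannianBundle_of_contMDiff (n := n) (F := F) (V := V)
  obtain ⟨C, hC, h⟩ := eventually_norm_trivializationAt_lt F V p
  refine ⟨C, hC.le, ?_⟩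
  filter_upwards [eventually_symm_of_eventually (mem_chart_target Eu p)
    (by rwa [(chartAt Eu p).left_inv (mem_chart_source Eu p)])] with z hz v
  exact (ContinuousLinearMap.le_opNorm _ _).trans
    (mul_le_mul_of_nonneg_right hz.le (norm_nonneg _))

variable [RiemannianBundle (fun x : M => TangentSpace (𝓡 n) x)]
  [IsContMDiffRiemannianBundle (𝓡 n) ∞ (EuclideanSpace ℝ (Fin n))
    (fun x : M => TangentSpace (𝓡 n) x)]
  {G : Type*} [NormedAddCommGroup G] [NormedSpace ℝ G]
  {W : M → Type*} [TopologicalSpace (TotalSpace G W)]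
  [∀ x, NormedAddCommGroup (W x)] [∀ x, InnerProductSpace ℝ (W x)]
  [FiberBundle G W] [VectorBundle ℝ G W]

/-- In coordinates, the derivatives of order `m` are bounded by the lower order derivatives and
the operator. -/
theorem exists_norm_iteratedFDeriv_le [FiniteDimensional ℝ F] [ContMDiffVectorBundle ∞ F V (𝓡 n)]
    [FiniteDimensional ℝ G] [ContMDiffVectorBundle ∞ G W (𝓡 n)]
    [IsContMDiffRiemannianBundle (𝓡 n) ∞ G W]
    {D : CovariantDerivative (𝓡 n) (EuclideanSpace ℝ (Fin n)) (fun x : M => TangentSpace (𝓡 n) x)}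
    (hD : CovariantDerivative.ContMDiffCovariantDerivative D ∞)
    {DV : CovariantDerivative (𝓡 n) F V}
    (hDV : CovariantDerivative.ContMDiffCovariantDerivative DV ∞) {m : ℕ} {s : Set M}
    {A : ∀ x, Tens n V m x →ₗ[ℝ] W x} {B : ∀ k x, Tens n V k x →ₗ[ℝ] W x}
    (hA : IsSmoothCoeff F G A s) (hB : ∀ k < m, IsSmoothCoeff F G (B k) s)
    {p : M} (hp : p ∈ s) (hinj : ∀ T : Tens n V m p, IsSymmTens T → A p T = 0 → T = 0) :
    ∃ C₀ : ℝ, ∀ᶠ z in 𝓝 (chartAt Eu p p), (chartAt Eu p).symm z ∈ s → ∀ u : ∀ x, V x,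
      ContDiffAt ℝ m (coordRep n F p u) z →
      ‖iteratedFDeriv ℝ m (coordRep n F p u) z‖ ≤
        C₀ * (∑ k ∈ Finset.range m, ‖iteratedFDeriv ℝ k (coordRep n F p u) z‖ +
          ‖diffOp D DV m A B u ((chartAt Eu p).symm z)‖) := by
  obtain ⟨N, hN, hpN, -, -, R, hR, Λ, hΛ, hRΛ⟩ := exists_iteratedFDeriv_eq hD hDV hA hB hp hinj
  have hps : chartAt Eu p p ∈ N ∩ (chartAt Eu p).symm ⁻¹' s :=
    ⟨hpN, by simpa only [mem_preimage, (chartAt Eu p).left_inv (mem_chart_source Eu p)] using hp⟩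
  obtain ⟨C₁, hC₁, A₁, hA₁, h₁⟩ := hR.exists_bound hps
  obtain ⟨C₂, hC₂, A₂, hA₂, h₂⟩ := exists_norm_le_of_continuousWithinAt (hΛ.continuousOn _ hps)
  obtain ⟨C₃, hC₃, h₃⟩ := exists_fibreCoord_norm_le (n := n) (F := G) (V := W) p
  refine ⟨C₁ + C₂ * C₃, ?_⟩
  filter_upwards [hA₁, hA₂, h₃, hN.mem_nhds hpN] with z hz₁ hz₂ hz₃ hzN hzs u hu
  have hz : z ∈ N ∩ (chartAt Eu p).symm ⁻¹' s := ⟨hzN, hzs⟩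
  have hS : 0 ≤ ∑ k ∈ Finset.range m, ‖iteratedFDeriv ℝ k (coordRep n F p u) z‖ :=
    Finset.sum_nonneg fun _ _ => norm_nonneg _
  rw [hRΛ u z hz hu]
  set w := diffOp D DV m A B u ((chartAt Eu p).symm z)
  have h5 : ‖Λ z (fibreCoord G W p ((chartAt Eu p).symm z) w)‖ ≤ C₂ * (C₃ * ‖w‖) :=
    ((Λ z).le_opNorm _).trans (mul_le_mul (h₂ z ⟨hz, hz₂⟩) (hz₃ w) (norm_nonneg _) hC₂)
  refine (norm_add_le _ _).trans ((add_le_add (h₁ _ z ⟨hz, hz₁⟩) h5).trans ?_)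
  nlinarith [norm_nonneg w, mul_nonneg hC₁ (norm_nonneg w), mul_nonneg (mul_nonneg hC₂ hC₃) hS]

end LocalBounds

/-! ### Defining functions in coordinates. -/

section DefiningFunction

variable {n : ℕ} {M : Type*} [TopologicalSpace M] [T2Space M]
  [ChartedSpace (EuclideanSpace ℝ (Fin n)) M] [IsManifold (𝓡 n) ∞ M]

local notation "Eu" => EuclideanSpace ℝ (Fin n)

theorem closure_chartDomain_eventuallyEq (Ω : Set M) (p : M) :
    (closure (chartDomain (n := n) Ω p) : Set Eu) =ᶠ[𝓝 (chartAt Eu p p)]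
      ((chartAt Eu p).symm ⁻¹' closure Ω : Set Eu) := by
  filter_upwards [(chartAt Eu p).open_target.mem_nhds (mem_chart_target Eu p)] with z hz
  exact propext (mem_closure_chartDomain_iff hz)

theorem IsDefiningFunction.contDiffWithinAt_coord {Ω : Set M} {ρ : M → ℝ}
    (hρ : IsDefiningFunction n Ω ρ) {p : M} {z : Eu} (hz : z ∈ (chartAt Eu p).target)
    (hzΩ : (chartAt Eu p).symm z ∈ closure Ω) :
    ContDiffWithinAt ℝ ∞ (ρ ∘ (chartAt Eu p).symm) ((chartAt Eu p).symm ⁻¹' closure Ω) z := by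
  have h := hρ.smooth _ hzΩ
  have hx : (chartAt Eu p).symm z ∈ (chartAt Eu p).source := (chartAt Eu p).map_target hz
  rw [contMDiffWithinAt_iff_source_of_mem_source (x := p) (by simpa using hx)] at h
  simpa only [contMDiffWithinAt_iff_contDiffWithinAt, mfld_simps, (chartAt Eu p).right_inv hz]
    using h

/-- The manifold derivative is the chart derivative within the preimage of the closure, a set that
near the centre coincides with the closure of the chart domain. -/
theorem IsDefiningFunction.fderivWithin_coord_ne_zero {Ω : Set M} {ρ : M → ℝ}
    (hρ : IsDefiningFunction n Ω ρ) {p : M} (hp : p ∈ frontier Ω) :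
    fderivWithin ℝ (ρ ∘ (chartAt Eu p).symm) (closure (chartDomain (n := n) Ω p))
      (chartAt Eu p p) ≠ 0 := by
  intro h0
  apply hρ.deriv_ne_zero p hp
  have hd : MDifferentiableWithinAt (𝓡 n) 𝓘(ℝ, ℝ) ρ (closure Ω) p :=
    (hρ.smooth p (frontier_subset_closure hp)).mdifferentiableWithinAt (by simp)
  rw [fderivWithin_congr_set (closure_chartDomain_eventuallyEq Ω p)] at h0
  have h1 : mfderivWithin (𝓡 n) 𝓘(ℝ, ℝ) ρ (closure Ω) p = 0 := by
    have h2 : (fderivWithin ℝ (writtenInExtChartAt (𝓡 n) 𝓘(ℝ, ℝ) p ρ)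
        ((extChartAt (𝓡 n) p).symm ⁻¹' closure Ω ∩ range (𝓡 n)) (extChartAt (𝓡 n) p p) :
          Eu →L[ℝ] ℝ) = 0 := by
      have e : writtenInExtChartAt (𝓡 n) 𝓘(ℝ, ℝ) p ρ = ρ ∘ (chartAt Eu p).symm := rfl
      rw [e]
      simpa only [mfld_simps] using h0
    exact (if_pos hd).trans h2
  rw [mvfderivWithin, h1]
  ext
  rfl

end DefiningFunction

/-! ### The weighted estimate near a boundary point. -/

section BoundaryEstimate

variable {n : ℕ} {M : Type*} [TopologicalSpace M] [T2Space M]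
  [ChartedSpace (EuclideanSpace ℝ (Fin n)) M] [IsManifold (𝓡 n) ∞ M]
  [MeasurableSpace M] [BorelSpace M]
  [RiemannianBundle (fun x : M => TangentSpace (𝓡 n) x)]
  [IsContMDiffRiemannianBundle (𝓡 n) ∞ (EuclideanSpace ℝ (Fin n))
    (fun x : M => TangentSpace (𝓡 n) x)]
  {F : Type*} [NormedAddCommGroup F] [NormedSpace ℝ F]
  {V : M → Type*} [TopologicalSpace (TotalSpace F V)]
  [∀ x, NormedAddCommGroup (V x)] [∀ x, InnerProductSpace ℝ (V x)]
  [FiberBundle F V] [VectorBundle ℝ F V]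
  {G : Type*} [NormedAddCommGroup G] [NormedSpace ℝ G]
  {W : M → Type*} [TopologicalSpace (TotalSpace G W)]
  [∀ x, NormedAddCommGroup (W x)] [∀ x, InnerProductSpace ℝ (W x)]
  [FiberBundle G W] [VectorBundle ℝ G W]

local notation "Eu" => EuclideanSpace ℝ (Fin n)

theorem weightPsi_sq {M : Type*} {n a : ℕ} {s : ℝ} {ρ : M → ℝ} {y : M} (hy : 0 < ρ y) :
    weightPsi n a s ρ y ^ 2 = sqWeight (2 * ((a : ℝ) - (n : ℝ) / 2)) s (ρ y) :=
  rpow_mul_exp_sq _ s hy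

/-- The weighted inequality for sections with support near a boundary point. -/
theorem exists_boundary_estimate [FiniteDimensional ℝ F] [ContMDiffVectorBundle ∞ F V (𝓡 n)]
    [IsContMDiffRiemannianBundle (𝓡 n) ∞ F V]
    [FiniteDimensional ℝ G] [ContMDiffVectorBundle ∞ G W (𝓡 n)]
    [IsContMDiffRiemannianBundle (𝓡 n) ∞ G W]
    {D : CovariantDerivative (𝓡 n) (EuclideanSpace ℝ (Fin n)) (fun x : M => TangentSpace (𝓡 n) x)}
    (hD : CovariantDerivative.ContMDiffCovariantDerivative D ∞)
    {DV : CovariantDerivative (𝓡 n) F V}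
    (hDV : CovariantDerivative.ContMDiffCovariantDerivative DV ∞)
    {Ω : Set M} (hΩ : IsOpen Ω) (hΩb : HasSmoothBoundary n Ω) {m : ℕ}
    {A : ∀ x, Tens n V m x →ₗ[ℝ] W x} {B : ∀ k x, Tens n V k x →ₗ[ℝ] W x}
    (hA : IsSmoothCoeff F G A (closure Ω)) (hB : ∀ k < m, IsSmoothCoeff F G (B k) (closure Ω))
    (hinj : ∀ x ∈ closure Ω, ∀ T : Tens n V m x, IsSymmTens T → A x T = 0 → T = 0)
    {ρ : M → ℝ} (hρ : IsDefiningFunction n Ω ρ) (a : ℕ) {s : ℝ} (hs : s ≠ 0)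
    {p : M} (hp : p ∈ frontier Ω) :
    ∃ O : Set M, IsOpen O ∧ p ∈ O ∧ ∃ ε : ℝ, 0 < ε ∧ ∃ C : ℝ≥0, ∀ u : ∀ x, V x,
      SectionOn (n := n) F ∞ u univ → closure {x | u x ≠ 0} ⊆ Ω →
      (∀ x ∈ closure {x | u x ≠ 0}, ρ x < ε) →
      ∫⁻ x in Ω ∩ O, ENNReal.ofReal ((weightPsi n a s ρ x * ‖u x‖) ^ 2) ∂(riemannianVolume n M) ≤
        C * ∫⁻ x in Ω, ENNReal.ofReal ((weightPsi n a s ρ x *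
          (weightPhi ρ x ^ m * ‖diffOp D DV m A B u x‖)) ^ 2) ∂(riemannianVolume n M) := by
  have hpc : p ∈ closure Ω := frontier_subset_closure hp
  obtain ⟨S, hS, hpS, hSt, C₁, hC₁⟩ := exists_lintegral_chart_bounds (n := n) p
  obtain ⟨C₀, hC₀⟩ := exists_norm_iteratedFDeriv_le hD hDV hA hB hpc (hinj p hpc)
  obtain ⟨C₂, hC₂0, hC₂⟩ := exists_norm_le_fibreCoord (n := n) (F := F) (V := V) p
  obtain ⟨r, hr, hrd, hr0, hrU⟩ := exists_boundary_coord (n := n) hΩb hp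
  set c := chartAt Eu p
  have hct : c p ∈ c.target := mem_chart_target Eu p
  have hcp : c.symm (c p) = p := c.left_inv (mem_chart_source Eu p)
  set U := chartDomain (n := n) Ω p
  set q : Eu → ℝ := ρ ∘ c.symm
  have hUo : IsOpen U := isOpen_chartDomain hΩ p
  have hpos : ∀ z ∈ U, 0 < q z := fun z hz => hρ.pos _ hz.2
  have hqU : ContDiffOn ℝ ∞ q U := fun z hz =>
    (hρ.contDiffWithinAt_coord hz.1 (subset_closure hz.2)).mono fun w hw => subset_closure hw.2
  -- The neighbourhood in which the bound for top derivatives, the comparison of measures and the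
  -- trivialization are all available; the cut-off is supported in it.
  have hN : {z | ((c.symm z ∈ closure Ω → ∀ u : ∀ x, V x, ContDiffAt ℝ m (coordRep n F p u) z →
      ‖iteratedFDeriv ℝ m (coordRep n F p u) z‖ ≤
        C₀ * (∑ k ∈ Finset.range m, ‖iteratedFDeriv ℝ k (coordRep n F p u) z‖ +
          ‖diffOp D DV m A B u (c.symm z)‖)) ∧ z ∈ S) ∧ z ∈ coordDomain n F V p} ∈ 𝓝 (c p) :=
    (hC₀.and (hS.mem_nhds hpS)).and (coordDomain_mem_nhds (n := n) (F := F) (V := V) p)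
  obtain ⟨e, κ, ε₁, h, hκ, hε₁, hh, hh0, hh1, hhp, hhc, hhN, hρe, hhe⟩ :=
    exists_tube hUo (hr.differentiableAt (by simp)).hasFDerivAt hr0 hrd hrU
      ((mem_closure_chartDomain_iff hct).2 (by rwa [hcp]))
      (((hρ.contDiffWithinAt_coord hct (by rwa [hcp])).of_le (by simp)).congr_set
        (closure_chartDomain_eventuallyEq Ω p).symm)
      (hρ.fderivWithin_coord_ne_zero hp) (by rw [Function.comp_apply, hcp]; exact hρ.eq_zero p hp)
      (Filter.Eventually.of_forall hpos) hN
  set b : ℝ := 2 * ((a : ℝ) - (n : ℝ) / 2)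
  obtain ⟨ε₂, hε₂, C₃, hC₃, hflat⟩ := exists_flat_api F (volume : Measure Eu) e hκ b hs m C₀
  obtain ⟨N₃, hN₃, hN₃o, hpN₃⟩ := eventually_nhds_iff.1 ((hhp.and hC₂).and
    (Filter.inter_mem (hS.mem_nhds hpS) (coordDomain_mem_nhds (n := n) (F := F) (V := V) p)))
  have hO : IsOpen (c.source ∩ c ⁻¹' N₃) := c.isOpen_inter_preimage hN₃o
  -- On this set the cut-off is 1. In the constant, `C₁` enters twice, for the passage to Lebesgue
  -- measure and back, and `C₂` squared compares the fibre norms.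
  refine ⟨c.source ∩ c ⁻¹' N₃, hO, ⟨mem_chart_source Eu p, hpN₃⟩, min ε₁ ε₂, lt_min hε₁ hε₂,
    C₁ * (C₂ ^ 2).toNNReal * C₃.toNNReal * C₁, fun u hu huΩ huρ => ?_⟩
  set v := coordRep n F p u
  set T := closure {x | u x ≠ 0}
  -- It is compact inside the open domain because the support of `u` is a closed subset of Ω.
  set K : Set Eu := tsupport h ∩ c.symm ⁻¹' T
  have hKU : K ⊆ U := fun z hz => ⟨hSt (hhN hz.1).1.2, huΩ hz.2⟩
  have hcompact : IsCompact K := by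
    have h1 : ContinuousOn c.symm (tsupport h) :=
      c.continuousOn_symm.mono fun z hz => hSt (hhN hz).1.2
    exact hhc.of_isClosed_subset
      (h1.preimage_isClosed_of_isClosed (isClosed_tsupport h) isClosed_closure) inter_subset_left
  have htube : TubeData (U ∩ coordDomain n F V p) K q h e κ :=
    { isOpen := hUo.inter (isOpen_coordDomain p)
      isCompact := hcompact
      subset := fun z hz => ⟨hKU hz, (hhN hz.1).2⟩
      contDiffOn := (hqU.of_le (by simp)).mono inter_subset_left
      pos := fun z hz => hpos z hz.1
      cutoff_contDiff := hh.of_le (by simp)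
      cutoff_nonneg := hh0
      le_fderiv := fun z hz => hρe z ⟨hKU hz, hz.1⟩
      cutoff_fderiv := fun z hz => hhe z ⟨hKU hz, hz.1⟩ ((huρ _ hz.2).trans_le (min_le_left _ _)) }
  have hv : ∀ z ∈ coordDomain n F V p, ContDiffAt ℝ ∞ v z := fun z hz =>
    contDiffAt_coordRep_of_isOpen isOpen_univ (k := ⊤) hu hz trivial
  have hoff : ∀ z ∉ K, h =ᶠ[𝓝 z] 0 ∨ v =ᶠ[𝓝 z] 0 := by
    intro z hz
    by_cases hzh : z ∈ tsupport h
    · right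
      have hzT : c.symm z ∈ Tᶜ := fun hzT => hz ⟨hzh, hzT⟩
      have hzV := (hhN hzh).2
      filter_upwards [eventually_symm_of_eventually hzV.1
        ((isClosed_closure.isOpen_compl).mem_nhds hzT),
        (isOpen_coordDomain p).mem_nhds hzV] with w hw hwV
      have huw : u (c.symm w) = 0 := by
        by_contra h0
        exact hw (subset_closure h0)
      simp only [v]
      rw [coordRep_eq u hwV, huw, map_zero]
      rfl
    · left
      exact notMem_tsupport_iff_eventuallyEq.1 hzh
  classical
  -- Set to 0 off `K`, so that the right-hand integral lives where coordinates and manifold can be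
  -- compared.
  set Q : Eu → ℝ := fun z => if z ∈ K then ‖diffOp D DV m A B u (c.symm z)‖ else 0
  have hQ0 : ∀ z, 0 ≤ Q z := fun z => by
    by_cases hz : z ∈ K <;> simp [Q, hz]
  have hest := hflat (U ∩ coordDomain n F V p) K q h htube
    (fun z hz => ((huρ _ hz.2).trans_le (min_le_right _ _)).le) v
    (fun z hz => (hv z hz.2).contDiffWithinAt) hoff Q hQ0 (fun z hz => by
      have h1 := (hhN hz.1).1.1 (subset_closure (hKU hz).2) u
        ((hv z (hhN hz.1).2).of_le (by exact_mod_cast le_top))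
      simpa only [Q, if_pos hz] using h1)
  have hleft := (hC₁ ((Ω ∩ (c.source ∩ c ⁻¹' N₃)).indicator fun x =>
      ENNReal.ofReal ((weightPsi n a s ρ x * ‖u x‖) ^ 2))
    (fun z => ENNReal.ofReal (C₂ ^ 2) *
      ENNReal.ofReal (h z * sqWeight b s (q z) * ‖v z‖ ^ 2))).1 (fun x hx => by
        rw [indicator_of_notMem]
        exact fun h1 => hx ⟨h1.2.1, (hN₃ _ h1.2.2).2.1⟩) (fun z hz => by
        by_cases h1 : c.symm z ∈ Ω ∩ (c.source ∩ c ⁻¹' N₃)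
        · have hzc : c (c.symm z) = z := c.right_inv (hSt hz)
          have hzN : z ∈ N₃ := by
            have := h1.2.2
            rwa [mem_preimage, hzc] at this
          have h2 : h z = 1 := (hN₃ z hzN).1.1
          have h3 : weightPsi n a s ρ (c.symm z) ^ 2 = sqWeight b s (q z) :=
            weightPsi_sq (hρ.pos _ h1.1)
          have h4 : ‖u (c.symm z)‖ ≤ C₂ * ‖v z‖ := by
            have h5 := (hN₃ z hzN).1.2 (u (c.symm z))
            rwa [← coordRep_eq u (hN₃ z hzN).2.2] at h5
          have h5 : 0 ≤ sqWeight b s (q z) := h3 ▸ sq_nonneg _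
          rw [indicator_of_mem h1, ← ENNReal.ofReal_mul (sq_nonneg _)]
          refine ENNReal.ofReal_le_ofReal ?_
          rw [mul_pow, h3, h2, one_mul]
          calc sqWeight b s (q z) * ‖u (c.symm z)‖ ^ 2
              ≤ sqWeight b s (q z) * (C₂ * ‖v z‖) ^ 2 :=
                mul_le_mul_of_nonneg_left (pow_le_pow_left₀ (norm_nonneg _) h4 2) h5
            _ = _ := by ring
        · rw [indicator_of_notMem h1]
          exact zero_le)
  have hright := (hC₁ (Ω.indicator fun x => ENNReal.ofReal ((weightPsi n a s ρ x *
      (weightPhi ρ x ^ m * ‖diffOp D DV m A B u x‖)) ^ 2))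
    (fun z => ENNReal.ofReal (h z * (sqWeight b s (q z) * q z ^ (4 * m)) * Q z ^ 2))).2
      (fun z hz => by
        have hzK : z ∉ K := fun h1 => hz (hhN h1.1).1.2
        simp [Q, hzK]) (fun z hz => by
        by_cases hzK : z ∈ K
        · rw [indicator_of_mem (show c.symm z ∈ Ω from (hKU hzK).2)]
          refine ENNReal.ofReal_le_ofReal ?_
          simp only [Q, if_pos hzK]
          have h1 : weightPsi n a s ρ (c.symm z) ^ 2 = sqWeight b s (q z) :=
            weightPsi_sq (hpos z (hKU hzK))
          have h2 : weightPhi ρ (c.symm z) = q z ^ 2 := rfl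
          rw [mul_pow, h1, mul_pow, h2, ← pow_mul, ← pow_mul]
          -- The square of `φ^m`, with `φ = ρ²`, is the weight `ρ^{4m}` gained by iterating the
          -- Hardy inequality.
          have h3 : 2 * (m * 2) = 4 * m := by ring
          rw [h3, mul_assoc, mul_assoc]
          refine mul_le_of_le_one_left ?_ (hh1 z)
          have := sqWeight_nonneg b s (hpos z (hKU hzK)).le
          have := (hpos z (hKU hzK)).le
          positivity
        · simp [Q, hzK])
  rw [lintegral_indicator (hΩ.inter hO).measurableSet,
    lintegral_const_mul' _ _ ENNReal.ofReal_ne_top] at hleft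
  rw [lintegral_indicator hΩ.measurableSet] at hright
  refine hleft.trans ?_
  calc _ ≤ (C₁ : ℝ≥0∞) * (ENNReal.ofReal (C₂ ^ 2) * (ENNReal.ofReal C₃ * (C₁ * _))) :=
        mul_le_mul_right (mul_le_mul_right (hest.trans (mul_le_mul_right hright _)) _) _
    _ = _ := by
      rw [ENNReal.ofReal, ENNReal.ofReal]
      push_cast
      ring

end BoundaryEstimate

/-! ### From the local estimates to the asymptotic Poincaré inequality. -/

section PoincareInequality

theorem eLpNorm_two_le_of_lintegral_sq_le {X : Type*} [MeasurableSpace X] {μ : Measure X}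
    {f g : X → ℝ} {C : ℝ≥0} (h : ∫⁻ x, ENNReal.ofReal (f x ^ 2) ∂μ ≤
      C * ∫⁻ x, ENNReal.ofReal (g x ^ 2) ∂μ) :
    eLpNorm f 2 μ ≤ NNReal.sqrt C * eLpNorm g 2 μ := by
  have e : ∀ f : X → ℝ, eLpNorm f 2 μ = (∫⁻ x, ENNReal.ofReal (f x ^ 2) ∂μ) ^ (1 / 2 : ℝ) := by
    intro f
    rw [eLpNorm_eq_lintegral_rpow_enorm_toReal (by norm_num) (by norm_num)]
    congr 1
    · refine lintegral_congr fun x => ?_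
      rw [ENNReal.toReal_ofNat, Real.enorm_eq_ofReal_abs, ENNReal.rpow_ofNat,
        ← ENNReal.ofReal_pow (abs_nonneg _), sq_abs]
  rw [e, e]
  refine (ENNReal.rpow_le_rpow h (by norm_num)).trans ?_
  rw [ENNReal.mul_rpow_of_nonneg _ _ (by norm_num)]
  refine mul_le_mul_left (le_of_eq ?_) _
  rw [NNReal.sqrt_eq_rpow, ENNReal.coe_rpow_of_nonneg _ (by norm_num)]

variable {n : ℕ} {M : Type*} [TopologicalSpace M] [T2Space M]
  [ChartedSpace (EuclideanSpace ℝ (Fin n)) M] [IsManifold (𝓡 n) ∞ M]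
  [MeasurableSpace M] [BorelSpace M]
  [RiemannianBundle (fun x : M => TangentSpace (𝓡 n) x)]
  [IsContMDiffRiemannianBundle (𝓡 n) ∞ (EuclideanSpace ℝ (Fin n))
    (fun x : M => TangentSpace (𝓡 n) x)]
  {F : Type*} [NormedAddCommGroup F] [NormedSpace ℝ F]
  {V : M → Type*} [TopologicalSpace (TotalSpace F V)]
  [∀ x, NormedAddCommGroup (V x)] [∀ x, InnerProductSpace ℝ (V x)]
  [FiberBundle F V] [VectorBundle ℝ F V]
  {G : Type*} [NormedAddCommGroup G] [NormedSpace ℝ G]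
  {W : M → Type*} [TopologicalSpace (TotalSpace G W)]
  [∀ x, NormedAddCommGroup (W x)] [∀ x, InnerProductSpace ℝ (W x)]
  [FiberBundle G W] [VectorBundle ℝ G W]

/-- The boundary is compact, so finitely many local estimates cover a collar. Each one bounds `u` on
its own piece by the integral over all of Ω for the uncut section, so they are simply added, without
a partition of unity. -/
theorem satisfiesAPI_diffOp [FiniteDimensional ℝ F] [ContMDiffVectorBundle ∞ F V (𝓡 n)]
    [IsContMDiffRiemannianBundle (𝓡 n) ∞ F V]
    [FiniteDimensional ℝ G] [ContMDiffVectorBundle ∞ G W (𝓡 n)]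
    [IsContMDiffRiemannianBundle (𝓡 n) ∞ G W]
    {D : CovariantDerivative (𝓡 n) (EuclideanSpace ℝ (Fin n)) (fun x : M => TangentSpace (𝓡 n) x)}
    (hD : CovariantDerivative.ContMDiffCovariantDerivative D ∞)
    {DV : CovariantDerivative (𝓡 n) F V}
    (hDV : CovariantDerivative.ContMDiffCovariantDerivative DV ∞)
    {Ω : Set M} (hΩ : IsOpen Ω) (hΩc : IsCompact (closure Ω)) (hΩb : HasSmoothBoundary n Ω) {m : ℕ}
    {A : ∀ x, Tens n V m x →ₗ[ℝ] W x} {B : ∀ k x, Tens n V k x →ₗ[ℝ] W x}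
    (hA : IsSmoothCoeff F G A (closure Ω)) (hB : ∀ k < m, IsSmoothCoeff F G (B k) (closure Ω))
    (hinj : ∀ x ∈ closure Ω, ∀ T : Tens n V m x, IsSymmTens T → A x T = 0 → T = 0)
    {ρ : M → ℝ} (hρ : IsDefiningFunction n Ω ρ) (a : ℕ) {s : ℝ} (hs : s ≠ 0) :
    SatisfiesAPI (n := n) F Ω ρ a s m (diffOp D DV m A B) := by
  have hfc : IsCompact (frontier Ω) :=
    hΩc.of_isClosed_subset isClosed_frontier frontier_subset_closure
  have hloc := fun p : frontier Ω =>
    exists_boundary_estimate hD hDV hΩ hΩb hA hB hinj hρ a hs p.2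
  choose O hO hpO ε hε C hC using hloc
  obtain ⟨t, ht⟩ := hfc.elim_finite_subcover O hO fun p hp => mem_iUnion.2 ⟨⟨p, hp⟩, hpO ⟨p, hp⟩⟩
  have hρc : ContinuousOn ρ (closure Ω) := hρ.smooth.continuousOn
  -- What the cover misses is a compact subset of Ω, on which `ρ` has a positive minimum.
  obtain ⟨ε₁, hε₁, hε₁O⟩ : ∃ ε₁ : ℝ, 0 < ε₁ ∧ ∀ x ∈ Ω, ρ x < ε₁ → x ∈ ⋃ p ∈ t, O p := by
    have hco : IsOpen (⋃ p ∈ t, O p) := isOpen_biUnion fun p _ => hO p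
    have hK : IsCompact (closure Ω \ ⋃ p ∈ t, O p) := hΩc.diff hco
    have hKΩ : closure Ω \ (⋃ p ∈ t, O p) ⊆ Ω := fun x hx => by
      by_contra hxΩ
      exact hx.2 (ht (by rw [hΩ.frontier_eq]; exact ⟨hx.1, hxΩ⟩))
    rcases (closure Ω \ ⋃ p ∈ t, O p).eq_empty_or_nonempty with h0 | hne
    · refine ⟨1, one_pos, fun x hx _ => ?_⟩
      by_contra hxO
      have : x ∈ closure Ω \ ⋃ p ∈ t, O p := ⟨subset_closure hx, hxO⟩
      rw [h0] at this
      exact this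
    · obtain ⟨y, hy, hymin⟩ := hK.exists_isMinOn hne (hρc.mono sdiff_subset)
      refine ⟨ρ y, hρ.pos y (hKΩ hy), fun x hx hxy => ?_⟩
      by_contra hxO
      exact absurd (hymin ⟨subset_closure hx, hxO⟩) (not_le.2 hxy)
  obtain ⟨ε₂, hε₂, hε₂t⟩ : ∃ ε₂ : ℝ, 0 < ε₂ ∧ ∀ p ∈ t, ε₂ ≤ ε p := by
    rcases t.eq_empty_or_nonempty with h0 | hne
    · exact ⟨1, one_pos, by simp [h0]⟩
    · obtain ⟨q, -, hmin⟩ := t.exists_min_image ε hne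
      exact ⟨ε q, hε q, hmin⟩
  set ε₀ := min ε₁ ε₂
  have hε₀ : 0 < ε₀ := lt_min hε₁ hε₂
  have hKc : IsCompact (closure Ω ∩ ρ ⁻¹' Ici ε₀) :=
    hΩc.of_isClosed_subset (hρc.preimage_isClosed_of_isClosed isClosed_closure isClosed_Ici)
      inter_subset_left
  -- A section supported in Ω off this compact set has support in `ρ < ε₀`, so every local estimate
  -- applies to it.
  refine ⟨closure Ω ∩ ρ ⁻¹' Ici ε₀, hKc, fun x hx => ?_, NNReal.sqrt (∑ p ∈ t, C p),
    fun u hu hsupp => ?_⟩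
  · by_contra hxΩ
    have h1 := hρ.eq_zero x (by rw [hΩ.frontier_eq]; exact ⟨hx.1, hxΩ⟩)
    have h2 : ε₀ ≤ ρ x := hx.2
    linarith
  · have hsΩ : closure {x | u x ≠ 0} ⊆ Ω := fun x hx => (hsupp hx).1
    have hsρ : ∀ x ∈ closure {x | u x ≠ 0}, ρ x < ε₀ := fun x hx => by
      by_contra hle
      exact (hsupp hx).2 ⟨subset_closure (hsΩ hx), not_lt.1 hle⟩
    refine eLpNorm_two_le_of_lintegral_sq_le ?_
    set f : M → ℝ≥0∞ := fun x => ENNReal.ofReal ((weightPsi n a s ρ x * ‖u x‖) ^ 2)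
    calc ∫⁻ x in Ω, f x ∂(riemannianVolume n M)
        = ∫⁻ x in ⋃ p ∈ t, Ω ∩ O p, f x ∂(riemannianVolume n M) := by
          have hm : MeasurableSet (⋃ p ∈ t, Ω ∩ O p) :=
            (isOpen_biUnion fun p _ => hΩ.inter (hO p)).measurableSet
          rw [← lintegral_indicator hm, ← lintegral_indicator hΩ.measurableSet]
          refine lintegral_congr fun x => ?_
          by_cases hx : x ∈ ⋃ p ∈ t, Ω ∩ O p
          · obtain ⟨p, hp, hxp⟩ := mem_iUnion₂.1 hx
            rw [indicator_of_mem hx, indicator_of_mem hxp.1]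
          · rw [indicator_of_notMem hx]
            by_cases hxΩ : x ∈ Ω
            · have hux : u x = 0 := by
                by_contra h0
                have h1 := hε₁O x hxΩ ((hsρ x (subset_closure h0)).trans_le (min_le_left _ _))
                obtain ⟨p, hp, hxp⟩ := mem_iUnion₂.1 h1
                exact hx (mem_iUnion₂.2 ⟨p, hp, hxΩ, hxp⟩)
              rw [indicator_of_mem hxΩ]
              simp [f, hux]
            · rw [indicator_of_notMem hxΩ]
      _ ≤ ∑ p ∈ t, ∫⁻ x in Ω ∩ O p, f x ∂(riemannianVolume n M) := by
          have h1 : (⋃ p ∈ t, Ω ∩ O p) = ⋃ p : t, Ω ∩ O p := biUnion_eq_iUnion _ _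
          rw [h1, ← Finset.sum_coe_sort t, ← tsum_fintype (L := .unconditional _)]
          exact lintegral_iUnion_le _ _
      _ ≤ ∑ p ∈ t, (C p : ℝ≥0∞) * ∫⁻ x in Ω, ENNReal.ofReal ((weightPsi n a s ρ x *
          (weightPhi ρ x ^ m * ‖diffOp D DV m A B u x‖)) ^ 2) ∂(riemannianVolume n M) :=
          Finset.sum_le_sum fun p hp => hC p u hu hsΩ fun x hx =>
            (hsρ x hx).trans_le ((min_le_right _ _).trans (hε₂t p hp))
      _ = _ := by
          rw [← Finset.sum_mul]
          push_cast
          rfl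

end PoincareInequality

end KernelRestriction

end

/-! ### Assembly of the four statements. -/

theorem mainTheorem8 {n : ℕ} {M : Type*} [TopologicalSpace M] [T2Space M]
    [SecondCountableTopology M] [ChartedSpace (EuclideanSpace ℝ (Fin n)) M]
    [IsManifold (𝓡 n) ∞ M] [MeasurableSpace M] [BorelSpace M]
    [RiemannianBundle (fun x : M => TangentSpace (𝓡 n) x)]
    [IsContMDiffRiemannianBundle (𝓡 n) ∞ (EuclideanSpace ℝ (Fin n))
      (fun x : M => TangentSpace (𝓡 n) x)]
    (D : CovariantDerivative (𝓡 n) (EuclideanSpace ℝ (Fin n))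
      (fun x : M => TangentSpace (𝓡 n) x))
    (hD : KernelRestriction.IsLeviCivita D)
    (Ω : Set M) (hΩ : IsOpen Ω) (hΩc : IsCompact (closure Ω))
    (hΩb : KernelRestriction.HasSmoothBoundary n Ω) :
    (∀ (F : Type*) [NormedAddCommGroup F] [NormedSpace ℝ F] [FiniteDimensional ℝ F]
      (V : M → Type*) [TopologicalSpace (TotalSpace F V)]
      [∀ x, NormedAddCommGroup (V x)] [∀ x, InnerProductSpace ℝ (V x)]
      [FiberBundle F V] [VectorBundle ℝ F V] [ContMDiffVectorBundle ∞ F V (𝓡 n)]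
      [IsContMDiffRiemannianBundle (𝓡 n) ∞ F V]
      (G : Type*) [NormedAddCommGroup G] [NormedSpace ℝ G] [FiniteDimensional ℝ G]
      (W : M → Type*) [TopologicalSpace (TotalSpace G W)]
      [∀ x, NormedAddCommGroup (W x)] [∀ x, InnerProductSpace ℝ (W x)]
      [FiberBundle G W] [VectorBundle ℝ G W] [ContMDiffVectorBundle ∞ G W (𝓡 n)]
      [IsContMDiffRiemannianBundle (𝓡 n) ∞ G W]
      (DV : CovariantDerivative (𝓡 n) F V)
      (_ : CovariantDerivative.ContMDiffCovariantDerivative DV ∞)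
      (m : ℕ) (_ : 0 < m)
      (A : ∀ x, KernelRestriction.Tens n V m x →ₗ[ℝ] W x)
      (B : ∀ k x, KernelRestriction.Tens n V k x →ₗ[ℝ] W x)
      (_ : KernelRestriction.IsSmoothCoeff F G A (closure Ω))
      (_ : ∀ k < m, KernelRestriction.IsSmoothCoeff F G (B k) (closure Ω))
      (_ : ∀ x ∈ closure Ω, ∀ T : KernelRestriction.Tens n V m x,
        KernelRestriction.IsSymmTens T → A x T = 0 → T = 0),
      (∀ ρ : M → ℝ, KernelRestriction.IsDefiningFunction n Ω ρ → ∀ (a : ℕ) (s : ℝ), s ≠ 0 →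
        KernelRestriction.SatisfiesAPI (n := n) F Ω ρ a s m
          (KernelRestriction.diffOp D DV m A B)) ∧
      KernelRestriction.SatisfiesKRC n F Ω m (KernelRestriction.diffOp D DV m A B) ∧
      KernelRestriction.KernelExtends n F Ω m ∞ (KernelRestriction.diffOp D DV m A B)) ∧
    (KernelRestriction.SatisfiesKRC n (EuclideanSpace ℝ (Fin n) →L[ℝ] ℝ) Ω 1
        (KernelRestriction.killingOp D) ∧
      KernelRestriction.KernelExtends n (EuclideanSpace ℝ (Fin n) →L[ℝ] ℝ) Ω ∞ ∞
        (KernelRestriction.killingOp D)) ∧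
    (3 ≤ n →
      KernelRestriction.SatisfiesKRC n (EuclideanSpace ℝ (Fin n) →L[ℝ] ℝ) Ω 1
        (KernelRestriction.conformalKillingOp D) ∧
      KernelRestriction.KernelExtends n (EuclideanSpace ℝ (Fin n) →L[ℝ] ℝ) Ω ∞ ∞
        (KernelRestriction.conformalKillingOp D)) := by
  have hDs := hD.smooth
  refine ⟨?_, ?_, fun hn => ?_⟩
  · intro F _ _ _ V _ _ _ _ _ _ _ G _ _ _ W _ _ _ _ _ _ _ DV hDV m hm A B hA hB hinj
    have hK := KernelRestriction.kernelExtends_diffOp hDs hDV hΩ hΩb hm hA hB hinj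
    refine ⟨fun ρ hρ a s hs => ?_, ?_, hK⟩
    · exact KernelRestriction.satisfiesAPI_diffOp hDs hDV hΩ hΩc hΩb hA hB hinj hρ a hs
    · exact KernelRestriction.satisfiesKRC_of_kernelExtends (k := (m : ℕ)) hK
  · have hK := KernelRestriction.kernelExtends_killingOp hDs hΩ hΩb
    exact ⟨KernelRestriction.satisfiesKRC_of_kernelExtends (k := ⊤) hK, hK⟩
  · have hK := KernelRestriction.kernelExtends_conformalKillingOp hn hDs hΩ hΩb
    exact ⟨KernelRestriction.satisfiesKRC_of_kernelExtends (k := ⊤) hK, hK⟩
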